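/- **Conventions.** A $3\mathsf{SAT}$ instance on $n$ variables is a set $\mathcal I$ of clauses $(c,U)$ with $c\in\{\pm1\}^3$ and $U\in[n]^3$. An assignment $x\in\{\pm1\}^n$ satisfies $(c,U)$ if $(c_1x_{U_1},c_2x_{U_2},c_3x_{U_3})\ne(1,1,1)$. It is $(1-\eta)$-satisfying if it satisfies at least $(1-\eta)|\mathcal I|$ clauses, and $\rho$-biased if $\frac1n\left|\sum_{i=1}^n x_i\right|\ge\rho$. For $0\le m\le 8n^3$, the random instance $\mathcal H_3(m,n)$ includes each of the $8n^3$ possible clauses independently with probability $\frac{m}{8n^3}$. **Theorem.** There is a deterministic polynomial-time algorithm $\mathcal A$ that takes a $3\mathsf{SAT}$ instance $\mathcal I$ on any number $n$ of variables and outputs a rational number $\mathcal A(\mathcal I)$, such that the following two conditions hold. 1. For every $n$, every $3\mathsf{SAT}$ instance $\mathcal I$ on $n$ variables and every real $\rho\ge\mathcal A(\mathcal I)$, no $\rho$-biased assignment is $\left(1-\frac{\rho}{32}\right)$-satisfying for $\mathcal I$. 2. Let $0<\delta\le 2$ be a constant and $\Delta=n^{\delta}$, and let $(\rho_n)_n$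 be any sequence of real numbers with $\rho_n\gg\sqrt{\frac{\log n}{\Delta}}$, that is, $\rho_n\big/\sqrt{\frac{\log n}{n^{\delta}}}\to\infty$ as $n\to\infty$. If $\mathcal I\sim\mathcal H_3(m,n)$ with $m=\Delta n=n^{1+\delta}$, then $\mathcal A(\mathcal I)\le\rho_n$ with probability tending to $1$ as $n\to\infty$. In particular, with high probability over $\mathcal I\sim\mathcal H_3(n^{1+\delta},n)$, the algorithm certifies that $\mathcal I$ has no $\rho_n$-biased assignment that is $\left(1-\frac{\rho_n}{32}\right)$-satisfying. -/

import Mathlib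

open Filter Topology

/-! ## Random signed hypergraphs and `kSAT` -/

/-- A potential hyperedge (clause) on `n` variables: a sign pattern `c ∈ {±1}^k` and a tuple
`U ∈ [n]^k` (repetitions allowed). -/
abbrev Clause (k n : ℕ) : Type := (Fin k → ℤˣ) × (Fin k → Fin n)

/-- A signed `k`-uniform hypergraph on `[n]`: a set of clauses. -/
abbrev SignedHypergraph (k n : ℕ) : Type := Finset (Clause k n)

/-- The probability of the event `E` when the instance is drawn by including each of the
`2 ^ k * n ^ k` potential clauses independently with probability `m / (2 ^ k * n ^ k)`. -/
noncomputable def instanceProb (k n : ℕ) (m : ℝ) (E : SignedHypergraph k n → Prop) : ℝ :=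
  let p : ℝ := m / (2 ^ k * (n : ℝ) ^ k)
  open scoped Classical in
  ∑ I : SignedHypergraph k n with E I, p ^ I.card * (1 - p) ^ (2 ^ k * n ^ k - I.card)

/-- The `kSAT` predicate on `{±1}^k`, where `-1` is "true": it is `1 - 𝟙[z = (1, …, 1)]`. -/
def kSAT {k : ℕ} (z : Fin k → ℤˣ) : ℕ := if z = 1 then 0 else 1

/-- The number of clauses `(c, U)` of `I` satisfied by `x`, i.e. with `kSAT (c ∘ x_U) = 1`. -/
def satisfiedCount {k n : ℕ} (I : SignedHypergraph k n) (x : Fin n → ℤˣ) : ℕ :=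
  ∑ e ∈ I, kSAT (fun i => e.1 i * x (e.2 i))

/-- `x` satisfies at least a `1 - η` fraction of the clauses of `I` (multiplied out, so that every
assignment satisfies the instance without clauses). -/
def IsSatisfying {k n : ℕ} (I : SignedHypergraph k n) (η : ℝ) (x : Fin n → ℤˣ) : Prop :=
  (1 - η) * (I.card : ℝ) ≤ (satisfiedCount I x : ℝ)

/-- `x` is `ρ`-biased: `(1 / n) * |∑ i, x i| ≥ ρ`. -/
def IsBiased {n : ℕ} (ρ : ℝ) (x : Fin n → ℤˣ) : Prop :=
  ρ ≤ (1 / (n : ℝ)) * |∑ i, (((x i : ℤˣ) : ℤ) : ℝ)|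

/-! ## A random access machine with logarithmic cost

Programs are structured programs over finitely many integer arrays; every evaluation of an operation
is charged the bit length of its result (and, recursively, of its operands and addresses). -/

namespace RAM

/-- The memory: `s a i` is the content of cell `i` of array `a`. A program mentions only finitely
many arrays. -/
abbrev State : Type := ℕ → ℤ → ℤ

/-- Integer expressions; `get a i` is the content of the cell of array `a` whose address is the
value of `i`. -/
inductive Expr : Type
  | const (z : ℤ)
  | get (a : ℕ) (i : Expr)
  | add (e₁ e₂ : Expr)
  | sub (e₁ e₂ : Expr)
  | mul (e₁ e₂ : Expr)
  | div (e₁ e₂ : Expr)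

/-- The value of an expression. -/
def Expr.val (s : State) : Expr → ℤ
  | .const z => z
  | .get a i => s a (i.val s)
  | .add e₁ e₂ => e₁.val s + e₂.val s
  | .sub e₁ e₂ => e₁.val s - e₂.val s
  | .mul e₁ e₂ => e₁.val s * e₂.val s
  | .div e₁ e₂ => e₁.val s / e₂.val s

/-- The charge for an integer: one plus its bit length. -/
def bitCost (z : ℤ) : ℕ := z.natAbs.size + 1

/-- The cost of evaluating an expression: the sum of the charges for the values of all its
subexpressions. -/
def Expr.cost (s : State) : Expr → ℕ
  | .const z => bitCost z
  | .get a i => bitCost (s a (i.val s)) + i.cost s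
  | .add e₁ e₂ => bitCost (e₁.val s + e₂.val s) + e₁.cost s + e₂.cost s
  | .sub e₁ e₂ => bitCost (e₁.val s - e₂.val s) + e₁.cost s + e₂.cost s
  | .mul e₁ e₂ => bitCost (e₁.val s * e₂.val s) + e₁.cost s + e₂.cost s
  | .div e₁ e₂ => bitCost (e₁.val s / e₂.val s) + e₁.cost s + e₂.cost s

/-- Programs. `store a i e` writes the value of `e` to cell `i` of array `a`; `branch` and `loop`
test whether the value of `e` is positive. -/
inductive Prog : Type
  | skip
  | store (a : ℕ) (i e : Expr)
  | seq (c₁ c₂ : Prog)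
  | branch (e : Expr) (c₁ c₂ : Prog)
  | loop (e : Expr) (c : Prog)

/-- The memory after writing `z` to cell `i` of array `a`. -/
def State.write (s : State) (a : ℕ) (i z : ℤ) : State :=
  Function.update s a (Function.update (s a) i z)

/-- `Exec c s t s'`: the program `c`, started in the memory `s`, halts in the memory `s'` at total
cost `t`. -/
inductive Exec : Prog → State → ℕ → State → Prop
  | skip (s : State) : Exec .skip s 1 s
  | store (s : State) (a : ℕ) (i e : Expr) :
      Exec (.store a i e) s (i.cost s + e.cost s + 1) (s.write a (i.val s) (e.val s))
  | seq {c₁ c₂ : Prog} {s s' s'' : State} {t t' : ℕ} :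
      Exec c₁ s t s' → Exec c₂ s' t' s'' → Exec (.seq c₁ c₂) s (t + t' + 1) s''
  | branch_pos {e : Expr} {c₁ c₂ : Prog} {s s' : State} {t : ℕ} :
      0 < e.val s → Exec c₁ s t s' → Exec (.branch e c₁ c₂) s (e.cost s + t + 1) s'
  | branch_neg {e : Expr} {c₁ c₂ : Prog} {s s' : State} {t : ℕ} :
      ¬ 0 < e.val s → Exec c₂ s t s' → Exec (.branch e c₁ c₂) s (e.cost s + t + 1) s'
  | loop_done {e : Expr} {c : Prog} {s : State} :
      ¬ 0 < e.val s → Exec (.loop e c) s (e.cost s + 1) s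
  | loop_step {e : Expr} {c : Prog} {s s' s'' : State} {t t' : ℕ} :
      0 < e.val s → Exec c s t s' → Exec (.loop e c) s' t' s'' →
        Exec (.loop e c) s (e.cost s + t + t' + 1) s''

/-- The initial memory: array `0` holds the input list, cell `0` of array `1` holds its length, and
all other cells are `0`. -/
def initial (l : List ℤ) : State := fun a i =>
  if a = 0 then (if 0 ≤ i then l.getD i.toNat 0 else 0)
  else if a = 1 ∧ i = 0 then (l.length : ℤ) else 0

/-- The size of an input list: the total bit length of its entries, plus one per entry. -/
def inputSize (l : List ℤ) : ℕ := (l.map bitCost).sum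

/-- `f` is computed by a single program in time polynomial in the size of the encoded input. The
output is the rational number whose numerator and denominator are left in the cells `0` and `1` of
array `0`. -/
def PolyTimeComputable {α : Type} (enc : α → List ℤ) (f : α → ℚ) : Prop :=
  ∃ (c : Prog) (P : Polynomial ℕ), ∀ a : α, ∃ (t : ℕ) (s : State),
    Exec c (initial (enc a)) t s ∧ t ≤ P.eval (inputSize (enc a)) ∧
      f a = (s 0 0 : ℚ) / (s 0 1 : ℚ)

end RAM

/-! ## Instances as inputs of an algorithm -/

/-- The enumeration of the potential clauses by positional notation: the index splits into the sign
pattern, the quotient by `n ^ 3` (binary digits, `0` for `+1` and `1` for `-1`), and the tuple, the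
remainder (digits in base `n`). -/
def clauseAt (n : ℕ) (j : Fin (2 ^ 3 * n ^ 3)) : Clause 3 n :=
  (fun i => if finFunctionFinEquiv.symm j.divNat i = (0 : Fin 2) then 1 else -1,
    finFunctionFinEquiv.symm j.modNat)

/-- An instance is presented by `n`, followed by the `0`/`1` table of membership of the `8 * n ^ 3`
potential clauses. -/
def encodeInstance (a : Σ n : ℕ, SignedHypergraph 3 n) : List ℤ :=
  (a.1 : ℤ) :: List.ofFn fun j => if clauseAt a.1 j ∈ a.2 then (1 : ℤ) else 0

/-!
Expanding the indicator of an unsatisfied clause in characters, and comparing the clause with a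
parity constraint on its first two variables, bounds the sum of `±x` over the third vertices of all
clauses by the number of unsatisfied clauses and seven bilinear forms with random signs. If the
degrees at the third position are balanced, that sum is the bias of `x`, up to scaling. So the
deviation of the degrees and the spectral norms of the seven matrices certify the bias.

For a random instance the degrees concentrate by a Chernoff bound. Each matrix is a random sum
`∑ e ∈ I, ± H e`, and exchanging a clause with its copy of opposite sign, which affects neither the
law of `I` nor the degrees, makes an exchangeable pair. The mean value inequality for traces bounds
the moments of such a sum by its matrix variance, which the degrees control.

The norms are read off from traces of powers `A ^ (2 * k)` with `k` about `log₂ n`, which are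
integers and dominate the same power of the norm up to a constant factor per root. Computing them
takes polynomially many steps on the random access machine, and since no step multiplies two long
numbers, each one lengthens the numbers by a constant only; the logarithmic cost is polynomial too.
-/

section Spectral

open Finset Matrix

variable {ι : Type*} [Fintype ι] [DecidableEq ι]

theorem pow_eq_eigenvectorUnitary_mul_diagonal_mul {𝕜 : Type*} [RCLike 𝕜] {A : Matrix ι ι 𝕜}
    (hA : A.IsHermitian) (k : ℕ) :
    A ^ k = (hA.eigenvectorUnitary : Matrix ι ι 𝕜) *
      diagonal (fun i => (hA.eigenvalues i : 𝕜) ^ k) *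
      star (hA.eigenvectorUnitary : Matrix ι ι 𝕜) := by
  conv_lhs => rw [hA.spectral_theorem, ← map_pow, diagonal_pow, Unitary.conjStarAlgAut_apply]
  rfl

theorem trace_pow_eq_sum_eigenvalues_pow {𝕜 : Type*} [RCLike 𝕜] {A : Matrix ι ι 𝕜}
    (hA : A.IsHermitian) (k : ℕ) : (A ^ k).trace = ∑ i, (hA.eigenvalues i : 𝕜) ^ k := by
  rw [pow_eq_eigenvectorUnitary_mul_diagonal_mul hA, trace_mul_cycle, Unitary.coe_star_mul_self,
    Matrix.one_mul, trace_diagonal]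

theorem dotProduct_pow_mulVec_eq_sum {A : Matrix ι ι ℝ} (hA : A.IsHermitian) (x : ι → ℝ) (k : ℕ) :
    x ⬝ᵥ A ^ k *ᵥ x = ∑ i, hA.eigenvalues i ^ k *
      ((star (hA.eigenvectorUnitary : Matrix ι ι ℝ)) *ᵥ x) i ^ 2 := by
  rw [pow_eq_eigenvectorUnitary_mul_diagonal_mul hA, ← mulVec_mulVec, ← mulVec_mulVec,
    dotProduct_mulVec, ← mulVec_transpose, ← conjTranspose_eq_transpose_of_trivial,
    ← star_eq_conjTranspose]
  simp only [dotProduct, mulVec_diagonal, RCLike.ofReal_real_eq_id, id]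
  exact sum_congr rfl fun i _ => by ring

theorem posSemidef_pow_two_mul {A : Matrix ι ι ℝ} (hA : A.IsHermitian) (k : ℕ) :
    (A ^ (2 * k)).PosSemidef := by
  simpa only [(hA.pow k).eq, ← pow_add, ← two_mul] using posSemidef_self_mul_conjTranspose (A ^ k)

theorem dotProduct_sq_le {ι : Type*} [Fintype ι] (u v : ι → ℝ) :
    (u ⬝ᵥ v) ^ 2 ≤ (u ⬝ᵥ u) * (v ⬝ᵥ v) := by
  simpa only [dotProduct, sq] using sum_mul_sq_le_sq_mul_sq univ u v

theorem dotProduct_mulVec_pow_le_trace {A : Matrix ι ι ℝ} (hA : A.IsHermitian) (x y : ι → ℝ)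
    {k : ℕ} (hk : k ≠ 0) :
    (y ⬝ᵥ A *ᵥ x) ^ (2 * k) ≤ ((x ⬝ᵥ x) * (y ⬝ᵥ y)) ^ k * (A ^ (2 * k)).trace := by
  rcases isEmpty_or_nonempty ι with _ | _
  · simp [hk]
  obtain ⟨m, hm⟩ := Finite.exists_max fun i => hA.eigenvalues i ^ 2
  have hAx : A *ᵥ x ⬝ᵥ A *ᵥ x ≤ hA.eigenvalues m ^ 2 * (x ⬝ᵥ x) := by
    have hsq : A *ᵥ x ⬝ᵥ A *ᵥ x = x ⬝ᵥ A ^ 2 *ᵥ x := by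
      rw [sq, ← mulVec_mulVec, dotProduct_mulVec x, ← mulVec_transpose,
        ← conjTranspose_eq_transpose_of_trivial, hA.eq]
    have hone : x ⬝ᵥ x = x ⬝ᵥ A ^ 0 *ᵥ x := by simp
    rw [hsq, hone, dotProduct_pow_mulVec_eq_sum hA, dotProduct_pow_mulVec_eq_sum hA, mul_sum]
    refine sum_le_sum fun i _ => ?_
    simpa only [pow_zero, one_mul] using mul_le_mul_of_nonneg_right (hm i) (sq_nonneg _)
  have hpow : hA.eigenvalues m ^ (2 * k) ≤ (A ^ (2 * k)).trace := by
    rw [trace_pow_eq_sum_eigenvalues_pow hA]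
    exact single_le_sum (f := fun i => hA.eigenvalues i ^ (2 * k))
      (fun i _ => (even_two_mul k).pow_nonneg _) (mem_univ m)
  have hx : 0 ≤ x ⬝ᵥ x := sum_nonneg fun i _ => mul_self_nonneg _
  have hy : 0 ≤ y ⬝ᵥ y := sum_nonneg fun i _ => mul_self_nonneg _
  calc (y ⬝ᵥ A *ᵥ x) ^ (2 * k) = ((y ⬝ᵥ A *ᵥ x) ^ 2) ^ k := pow_mul _ _ _
    _ ≤ ((y ⬝ᵥ y) * (hA.eigenvalues m ^ 2 * (x ⬝ᵥ x))) ^ k := by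
        gcongr
        exact (dotProduct_sq_le _ _).trans (mul_le_mul_of_nonneg_left hAx hy)
    _ = ((x ⬝ᵥ x) * (y ⬝ᵥ y)) ^ k * hA.eigenvalues m ^ (2 * k) := by rw [pow_mul]; ring
    _ ≤ _ := by gcongr

end Spectral

section MixedTraces

open Finset Matrix

variable {ι : Type*} [Fintype ι] [DecidableEq ι]

theorem trace_mul_pow_mul_pow_eq_sum {A B H : Matrix ι ι ℝ} (hA : A.IsHermitian)
    (hB : B.IsHermitian) (hH : H.IsHermitian) (q s : ℕ) :
    (H * A ^ q * H * B ^ s).trace = ∑ i, ∑ j,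
      (star (hB.eigenvectorUnitary : Matrix ι ι ℝ) * H * hA.eigenvectorUnitary) i j ^ 2 *
        (hA.eigenvalues j ^ q * hB.eigenvalues i ^ s) := by
  set U : Matrix ι ι ℝ := ↑hA.eigenvectorUnitary
  set V : Matrix ι ι ℝ := ↑hB.eigenvectorUnitary
  have hadj : star U * H * V = (star V * H * U)ᵀ := by
    simp [star_eq_conjTranspose, ← conjTranspose_eq_transpose_of_trivial, hH.eq, Matrix.mul_assoc]
  calc (H * A ^ q * H * B ^ s).trace
      = ((H * U * diagonal (fun i => hA.eigenvalues i ^ q) * star U * H * V *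
          diagonal (fun i => hB.eigenvalues i ^ s)) * star V).trace := by
        rw [pow_eq_eigenvectorUnitary_mul_diagonal_mul hA,
          pow_eq_eigenvectorUnitary_mul_diagonal_mul hB]
        simp only [Matrix.mul_assoc, U, V, RCLike.ofReal_real_eq_id, id]
    _ = ((star V * H * U) * diagonal (fun i => hA.eigenvalues i ^ q) *
          ((star U * H * V) * diagonal (fun i => hB.eigenvalues i ^ s))).trace := by
        rw [trace_mul_comm]; simp only [Matrix.mul_assoc]
    _ = _ := by
        rw [hadj]
        simp only [trace, diag_apply, Matrix.mul_apply (N := _ * diagonal _), mul_diagonal,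
          transpose_apply]
        exact sum_congr rfl fun i _ => sum_congr rfl fun j _ => by ring

theorem pow_mul_pow_add_pow_mul_pow_le (x y : ℝ) {q s r : ℕ} (h : q + s = 2 * r) :
    x ^ q * y ^ s + x ^ s * y ^ q ≤ x ^ (2 * r) + y ^ (2 * r) := by
  have rearrange : 0 ≤ (|x| ^ q - |y| ^ q) * (|x| ^ s - |y| ^ s) := by
    rcases le_total |x| |y| with hxy | hxy
    · exact mul_nonneg_of_nonpos_of_nonpos (sub_nonpos.2 (by gcongr)) (sub_nonpos.2 (by gcongr))
    · exact mul_nonneg (sub_nonneg.2 (by gcongr)) (sub_nonneg.2 (by gcongr))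
  calc x ^ q * y ^ s + x ^ s * y ^ q ≤ |x| ^ q * |y| ^ s + |x| ^ s * |y| ^ q := by
        simp only [← abs_pow, ← abs_mul]
        exact add_le_add (le_abs_self _) (le_abs_self _)
    _ ≤ |x| ^ (q + s) + |y| ^ (q + s) := by rw [pow_add, pow_add]; linarith
    _ = x ^ (2 * r) + y ^ (2 * r) := by rw [h, (even_two_mul r).pow_abs, (even_two_mul r).pow_abs]

theorem trace_mul_pow_mul_pow_add_le {A B H : Matrix ι ι ℝ} (hA : A.IsHermitian)
    (hB : B.IsHermitian) (hH : H.IsHermitian) {q s r : ℕ} (h : q + s = 2 * r) :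
    (H * A ^ q * H * B ^ s).trace + (H * A ^ s * H * B ^ q).trace ≤
      (H * H * A ^ (2 * r)).trace + (H * H * B ^ (2 * r)).trace := by
  have hpureA : (H * H * A ^ (2 * r)).trace = (H * A ^ (2 * r) * H * B ^ 0).trace := by
    rw [pow_zero, Matrix.mul_one, trace_mul_cycle H (A ^ (2 * r)) H]
  have hpureB : (H * H * B ^ (2 * r)).trace = (H * A ^ 0 * H * B ^ (2 * r)).trace := by
    rw [pow_zero, Matrix.mul_one]
  rw [hpureA, hpureB]
  simp only [trace_mul_pow_mul_pow_eq_sum hA hB hH, ← sum_add_distrib, ← mul_add]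
  refine sum_le_sum fun i _ => sum_le_sum fun j _ => mul_le_mul_of_nonneg_left ?_ (sq_nonneg _)
  simpa only [pow_zero, one_mul, mul_one] using pow_mul_pow_add_pow_mul_pow_le _ _ h

theorem two_mul_sum_trace_mul_pow_mul_pow_le {A B H : Matrix ι ι ℝ} (hA : A.IsHermitian)
    (hB : B.IsHermitian) (hH : H.IsHermitian) (r : ℕ) :
    2 * ∑ q ∈ range (2 * r + 1), (H * A ^ q * H * B ^ (2 * r - q)).trace ≤
      (2 * r + 1) * ((H * H * A ^ (2 * r)).trace + (H * H * B ^ (2 * r)).trace) := by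
  have hreflect : ∑ q ∈ range (2 * r + 1), (H * A ^ (2 * r - q) * H * B ^ q).trace =
      ∑ q ∈ range (2 * r + 1), (H * A ^ q * H * B ^ (2 * r - q)).trace := by
    rw [← sum_range_reflect]
    refine sum_congr rfl fun q hq => ?_
    have hq' : q ≤ 2 * r := Nat.lt_succ_iff.1 (mem_range.1 hq)
    rw [Nat.add_sub_cancel, Nat.sub_sub_self hq']
  calc 2 * ∑ q ∈ range (2 * r + 1), (H * A ^ q * H * B ^ (2 * r - q)).trace
      = ∑ q ∈ range (2 * r + 1), ((H * A ^ q * H * B ^ (2 * r - q)).trace +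
          (H * A ^ (2 * r - q) * H * B ^ q).trace) := by
        rw [sum_add_distrib, hreflect, two_mul]
    _ ≤ ∑ _q ∈ range (2 * r + 1), ((H * H * A ^ (2 * r)).trace + (H * H * B ^ (2 * r)).trace) :=
        sum_le_sum fun _ hq => trace_mul_pow_mul_pow_add_le hA hB hH
          (Nat.add_sub_of_le (Nat.lt_succ_iff.1 (mem_range.1 hq)))
    _ = _ := by rw [sum_const, card_range, nsmul_eq_mul]; push_cast; ring

theorem pow_sub_pow_eq_sum {R : Type*} [Ring R] (x y : R) (k : ℕ) :
    x ^ k - y ^ k = ∑ q ∈ range k, x ^ q * (x - y) * y ^ (k - 1 - q) := by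
  have telescope : ∀ q ∈ range k, x ^ q * (x - y) * y ^ (k - 1 - q) =
      x ^ (q + 1) * y ^ (k - (q + 1)) - x ^ q * y ^ (k - q) := by
    intro q hq
    have hq := mem_range.1 hq
    rw [show k - 1 - q = k - (q + 1) by omega, show k - q = k - (q + 1) + 1 by omega,
      pow_succ, pow_succ' y, mul_sub, sub_mul]
    simp only [mul_assoc]
  rw [sum_congr rfl telescope, sum_range_sub fun q => x ^ q * y ^ (k - q)]
  simp

theorem trace_mul_pow_sub_pow_le {A B H : Matrix ι ι ℝ} (hA : A.IsHermitian) (hB : B.IsHermitian)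
    (hH : H.IsHermitian) {ξ : ℝ} (hAB : A - B = (2 * ξ) • H) (r : ℕ) :
    ξ * ((H * A ^ (2 * r + 1)).trace - (H * B ^ (2 * r + 1)).trace) ≤
      ξ ^ 2 * ((2 * r + 1) * ((H * H * A ^ (2 * r)).trace + (H * H * B ^ (2 * r)).trace)) := by
  have hexpand : (H * A ^ (2 * r + 1)).trace - (H * B ^ (2 * r + 1)).trace =
      ξ * (2 * ∑ q ∈ range (2 * r + 1), (H * A ^ q * H * B ^ (2 * r - q)).trace) := by
    rw [← trace_sub, ← Matrix.mul_sub, pow_sub_pow_eq_sum, hAB, Matrix.mul_sum, trace_sum]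
    simp only [mul_sum, Matrix.mul_smul, Matrix.smul_mul, trace_smul, smul_eq_mul,
      Nat.add_sub_cancel, Matrix.mul_assoc]
    exact sum_congr rfl fun q _ => by ring
  rw [hexpand, ← mul_assoc, ← sq]
  exact mul_le_mul_of_nonneg_left (two_mul_sum_trace_mul_pow_mul_pow_le hA hB hH r) (sq_nonneg ξ)

end MixedTraces

section MatrixSteinPairs

open Finset Matrix

variable {Ω α ι : Type*} [Fintype α]

/-- A family of exchangeable pairs for the random matrix `X` under the weight `W`: the `e`-th move
`σ e` is a weight-preserving involution that changes `X` by a multiple `2 * ξ e` of `H e`, and the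
changes of all the moves add up to a multiple of `X`. Averaged over `e`, this is a matrix Stein pair
in the sense of Mackey, Jordan, Chen, Farrell and Tropp. -/
structure IsMatrixSteinFamily (W : Ω → ℝ) (X : Ω → Matrix ι ι ℝ) (H : α → Matrix ι ι ℝ)
    (σ : α → Ω → Ω) (ξ : α → Ω → ℝ) : Prop where
  weight_nonneg (ω : Ω) : 0 ≤ W ω
  involutive (e : α) : Function.Involutive (σ e)
  weight_move (e : α) (ω : Ω) : W (σ e ω) = W ω
  isHermitian (ω : Ω) : (X ω).IsHermitian
  isHermitian_direction (e : α) : (H e).IsHermitian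
  coeff_move (e : α) (ω : Ω) : ξ e (σ e ω) = -ξ e ω
  sub_move (e : α) (ω : Ω) : X ω - X (σ e ω) = (2 * ξ e ω) • H e
  sum_coeff_smul (ω : Ω) : ∑ e, ξ e ω • H e = (2 : ℝ) • X ω

namespace IsMatrixSteinFamily

variable {W : Ω → ℝ} {X : Ω → Matrix ι ι ℝ} {H : α → Matrix ι ι ℝ} {σ : α → Ω → Ω} {ξ : α → Ω → ℝ}
  [Fintype Ω]

theorem sum_comp_move (h : IsMatrixSteinFamily W X H σ ξ) (e : α) (F : Ω → ℝ) :
    ∑ ω, F (σ e ω) = ∑ ω, F ω :=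
  Equiv.sum_comp (Function.Involutive.toPerm _ (h.involutive e)) F

theorem two_mul_sum_weight_mul_coeff_mul (h : IsMatrixSteinFamily W X H σ ξ) (e : α) (u : Ω → ℝ) :
    2 * ∑ ω, W ω * (ξ e ω * u ω) = ∑ ω, W ω * (ξ e ω * (u ω - u (σ e ω))) := by
  have hswap : ∑ ω, W ω * (ξ e ω * u (σ e ω)) = -∑ ω, W ω * (ξ e ω * u ω) := by
    rw [← h.sum_comp_move e, ← sum_neg_distrib]
    refine sum_congr rfl fun ω _ => ?_
    rw [h.weight_move, h.coeff_move, h.involutive e ω]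
    ring
  simp only [mul_sub, sum_sub_distrib]
  rw [hswap]
  ring

variable [Fintype ι] [DecidableEq ι]

theorem two_mul_sum_weight_mul_trace_pow_succ (h : IsMatrixSteinFamily W X H σ ξ) (k : ℕ) :
    2 * ∑ ω, W ω * (X ω ^ (k + 1)).trace =
      ∑ e, ∑ ω, W ω * (ξ e ω * (H e * X ω ^ k).trace) := by
  rw [sum_comm, mul_sum]
  refine sum_congr rfl fun ω _ => ?_
  have htrace : 2 * (X ω ^ (k + 1)).trace = ∑ e, ξ e ω * (H e * X ω ^ k).trace := by
    rw [pow_succ', ← smul_eq_mul, ← trace_smul, ← Matrix.smul_mul, ← h.sum_coeff_smul,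
      Matrix.sum_mul, trace_sum]
    simp only [Matrix.smul_mul, trace_smul, smul_eq_mul]
  rw [mul_left_comm, htrace, mul_sum]

theorem sum_weight_mul_coeff_mul_trace_le (h : IsMatrixSteinFamily W X H σ ξ) (e : α) (r : ℕ) :
    ∑ ω, W ω * (ξ e ω * (H e * X ω ^ (2 * r + 1)).trace) ≤
      (2 * r + 1) * ∑ ω, W ω * (ξ e ω ^ 2 * (H e * H e * X ω ^ (2 * r)).trace) := by
  have hmove : ∑ ω, W ω * (ξ e ω ^ 2 * (H e * H e * X (σ e ω) ^ (2 * r)).trace) =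
      ∑ ω, W ω * (ξ e ω ^ 2 * (H e * H e * X ω ^ (2 * r)).trace) := by
    rw [← h.sum_comp_move e]
    refine sum_congr rfl fun ω _ => ?_
    rw [h.weight_move, h.coeff_move, h.involutive e ω, neg_sq]
  have hdouble : 2 * ∑ ω, W ω * (ξ e ω * (H e * X ω ^ (2 * r + 1)).trace) ≤
      2 * ((2 * r + 1) * ∑ ω, W ω * (ξ e ω ^ 2 * (H e * H e * X ω ^ (2 * r)).trace)) :=
    calc 2 * ∑ ω, W ω * (ξ e ω * (H e * X ω ^ (2 * r + 1)).trace)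
        = ∑ ω, W ω * (ξ e ω * ((H e * X ω ^ (2 * r + 1)).trace -
            (H e * X (σ e ω) ^ (2 * r + 1)).trace)) := h.two_mul_sum_weight_mul_coeff_mul e _
      _ ≤ ∑ ω, W ω * (ξ e ω ^ 2 * ((2 * r + 1) * ((H e * H e * X ω ^ (2 * r)).trace +
            (H e * H e * X (σ e ω) ^ (2 * r)).trace))) :=
          sum_le_sum fun ω _ => mul_le_mul_of_nonneg_left
            (trace_mul_pow_sub_pow_le (h.isHermitian _) (h.isHermitian _)
              (h.isHermitian_direction e) (h.sub_move e ω) r) (h.weight_nonneg ω)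
      _ = (2 * r + 1) * (∑ ω, W ω * (ξ e ω ^ 2 * (H e * H e * X ω ^ (2 * r)).trace) +
            ∑ ω, W ω * (ξ e ω ^ 2 * (H e * H e * X (σ e ω) ^ (2 * r)).trace)) := by
          rw [← sum_add_distrib, mul_sum]
          exact sum_congr rfl fun ω _ => by ring
      _ = _ := by rw [hmove]; ring
  linarith

theorem sum_weight_mul_trace_pow_two_mul_succ_le (h : IsMatrixSteinFamily W X H σ ξ) {d : ℝ}
    (hd : ∀ ω, W ω ≠ 0 → ∀ Y : Matrix ι ι ℝ, Y.PosSemidef →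
      ∑ e, ξ e ω ^ 2 * (H e * H e * Y).trace ≤ 2 * d * Y.trace) (r : ℕ) :
    ∑ ω, W ω * (X ω ^ (2 * (r + 1))).trace ≤
      (2 * r + 1) * d * ∑ ω, W ω * (X ω ^ (2 * r)).trace := by
  have hsum : ∑ e, ∑ ω, W ω * (ξ e ω ^ 2 * (H e * H e * X ω ^ (2 * r)).trace) ≤
      2 * d * ∑ ω, W ω * (X ω ^ (2 * r)).trace := by
    rw [sum_comm, mul_sum]
    refine sum_le_sum fun ω _ => ?_
    rw [← mul_sum, mul_left_comm]
    by_cases hω : W ω = 0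
    · simp [hω]
    · exact mul_le_mul_of_nonneg_left
        (hd ω hω _ (posSemidef_pow_two_mul (h.isHermitian ω) r)) (h.weight_nonneg ω)
  have hdouble : 2 * ∑ ω, W ω * (X ω ^ (2 * (r + 1))).trace ≤
      2 * ((2 * r + 1) * d * ∑ ω, W ω * (X ω ^ (2 * r)).trace) :=
    calc 2 * ∑ ω, W ω * (X ω ^ (2 * (r + 1))).trace
        = ∑ e, ∑ ω, W ω * (ξ e ω * (H e * X ω ^ (2 * r + 1)).trace) :=
          h.two_mul_sum_weight_mul_trace_pow_succ (2 * r + 1)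
      _ ≤ ∑ e, (2 * r + 1) * ∑ ω, W ω * (ξ e ω ^ 2 * (H e * H e * X ω ^ (2 * r)).trace) :=
          sum_le_sum fun e _ => h.sum_weight_mul_coeff_mul_trace_le e r
      _ ≤ (2 * r + 1) * (2 * d * ∑ ω, W ω * (X ω ^ (2 * r)).trace) := by
          rw [← mul_sum]; gcongr
      _ = _ := by ring
  linarith

theorem sum_weight_mul_trace_pow_two_mul_le (h : IsMatrixSteinFamily W X H σ ξ) {d : ℝ}
    (hd0 : 0 ≤ d) (hd : ∀ ω, W ω ≠ 0 → ∀ Y : Matrix ι ι ℝ, Y.PosSemidef →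
      ∑ e, ξ e ω ^ 2 * (H e * H e * Y).trace ≤ 2 * d * Y.trace) (r : ℕ) :
    ∑ ω, W ω * (X ω ^ (2 * r)).trace ≤ (2 * r * d) ^ r * ((∑ ω, W ω) * Fintype.card ι) := by
  have hprod : ∑ ω, W ω * (X ω ^ (2 * r)).trace ≤
      (∏ j ∈ range r, (2 * j + 1) * d) * ((∑ ω, W ω) * Fintype.card ι) := by
    induction r with
    | zero => simp [sum_mul]
    | succ r ih =>
      refine (h.sum_weight_mul_trace_pow_two_mul_succ_le hd r).trans ?_
      rw [prod_range_succ, mul_comm (∏ j ∈ range r, _), mul_assoc (_ * d)]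
      gcongr
  refine hprod.trans (mul_le_mul_of_nonneg_right ?_
    (mul_nonneg (sum_nonneg fun ω _ => h.weight_nonneg ω) (Nat.cast_nonneg _)))
  calc ∏ j ∈ range r, ((2 * j + 1) * d : ℝ) ≤ ∏ _j ∈ range r, (2 * r * d) := by
        gcongr with j hj
        exact_mod_cast (by have := mem_range.1 hj; omega : 2 * j + 1 ≤ 2 * r)
    _ = (2 * r * d) ^ r := by rw [prod_const, card_range]

end IsMatrixSteinFamily

end MatrixSteinPairs

section SignedSums

open Finset Matrix

variable {α ι : Type*}

/-- The sum over `I` of the matrices `H e`, with signs `χ e`. -/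
def signedSum (χ : α → ℝ) (H : α → Matrix ι ι ℝ) (I : Finset α) : Matrix ι ι ℝ :=
  ∑ e ∈ I, χ e • H e

theorem isHermitian_signedSum {χ : α → ℝ} {H : α → Matrix ι ι ℝ} (hH : ∀ e, (H e).IsHermitian)
    (I : Finset α) : (signedSum χ H I).IsHermitian := by
  simp only [IsHermitian, signedSum, conjTranspose_sum, conjTranspose_smul, star_trivial, (hH _).eq]

variable [DecidableEq α]

/-- The image of a set under the transposition of `e` and `e'`: the resampling move of the
exchangeable pairs, which keeps the cardinality. -/
def swapImage (e e' : α) (I : Finset α) : Finset α := I.map (Equiv.swap e e').toEmbedding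

theorem mem_swapImage {e e' f : α} {I : Finset α} :
    f ∈ swapImage e e' I ↔ Equiv.swap e e' f ∈ I := by
  simp [swapImage, mem_map_equiv]

theorem swapImage_involutive (e e' : α) : Function.Involutive (swapImage e e') := fun I => by
  ext f
  simp [mem_swapImage]

/-- The coefficient of `2 • H e` in the change of a signed sum over `I` when the elements `e` and
`τ e`, which carry opposite signs, are exchanged. -/
def swapCoeff (χ : α → ℝ) (τ : α → α) (e : α) (I : Finset α) : ℝ :=
  ((if e ∈ I then 1 else 0) - (if τ e ∈ I then 1 else 0)) * χ e

theorem swapCoeff_swapImage (χ : α → ℝ) (τ : α → α) (e : α) (I : Finset α) :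
    swapCoeff χ τ e (swapImage e (τ e) I) = -swapCoeff χ τ e I := by
  simp only [swapCoeff, mem_swapImage, Equiv.swap_apply_left, Equiv.swap_apply_right]
  ring

theorem swapCoeff_sq_le {χ : α → ℝ} (hχ : ∀ e, χ e ^ 2 = 1) (τ : α → α) (e : α) (I : Finset α) :
    swapCoeff χ τ e I ^ 2 ≤ (if e ∈ I then 1 else 0) + (if τ e ∈ I then 1 else 0) := by
  rw [swapCoeff, mul_pow, hχ]
  split_ifs <;> norm_num

variable {χ : α → ℝ} {H : α → Matrix ι ι ℝ} {τ : α → α}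

theorem signedSum_sub_swapImage (hχ : ∀ e, χ e ^ 2 = 1) (hτχ : ∀ e, χ (τ e) = -χ e)
    (hτH : ∀ e, H (τ e) = H e) (e : α) (I : Finset α) :
    signedSum χ H I - signedSum χ H (swapImage e (τ e) I) = (2 * swapCoeff χ τ e I) • H e := by
  have hne : e ≠ τ e := fun h => by
    have hzero : χ e = 0 := self_eq_neg.1 ((congrArg χ h).trans (hτχ e))
    simpa [hzero] using hχ e
  have hterm (f : α) :
      χ f • H f - χ (Equiv.swap e (τ e) f) • H (Equiv.swap e (τ e) f) =
        (((if f = e then 1 else 0) - (if f = τ e then 1 else 0)) * (2 * χ e)) • H e := by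
    rcases eq_or_ne f e with rfl | hfe
    · rw [Equiv.swap_apply_left, hτχ, hτH, if_pos rfl, if_neg hne, ← sub_smul]
      congr 1
      ring
    · rcases eq_or_ne f (τ e) with rfl | hfτ
      · rw [Equiv.swap_apply_right, hτχ, hτH, if_neg hfe, if_pos rfl, ← sub_smul]
        congr 1
        ring
      · simp [Equiv.swap_apply_of_ne_of_ne hfe hfτ, hfe, hfτ]
  simp only [signedSum, swapImage, sum_map, Equiv.coe_toEmbedding]
  rw [← sum_sub_distrib, sum_congr rfl fun f _ => hterm f, ← sum_smul, ← sum_mul, sum_sub_distrib,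
    sum_ite_eq', sum_ite_eq', swapCoeff]
  congr 1
  ring

variable [Fintype α]

theorem signedSum_eq_sum_univ (χ : α → ℝ) (H : α → Matrix ι ι ℝ) (I : Finset α) :
    signedSum χ H I = ∑ e, ((if e ∈ I then 1 else 0) * χ e) • H e := by
  simp [signedSum, ite_mul, ite_smul, sum_ite_mem]

theorem sum_swapCoeff_smul (hτ : Function.Involutive τ) (hτχ : ∀ e, χ (τ e) = -χ e)
    (hτH : ∀ e, H (τ e) = H e) (I : Finset α) :
    ∑ e, swapCoeff χ τ e I • H e = (2 : ℝ) • signedSum χ H I := by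
  have hreindex : ∑ e, ((if τ e ∈ I then 1 else 0) * χ e) • H e = -signedSum χ H I := by
    rw [← Equiv.sum_comp (hτ.toPerm τ)]
    simp [hτ _, hτχ, hτH, signedSum_eq_sum_univ]
  simp only [swapCoeff, sub_mul, sub_smul, sum_sub_distrib]
  rw [hreindex, ← signedSum_eq_sum_univ, sub_neg_eq_add, two_smul]

theorem isMatrixSteinFamily_signedSum (hχ : ∀ e, χ e ^ 2 = 1) (hτ : Function.Involutive τ)
    (hτχ : ∀ e, χ (τ e) = -χ e) (hτH : ∀ e, H (τ e) = H e) (hH : ∀ e, (H e).IsHermitian)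
    {W : Finset α → ℝ} (hW0 : ∀ I, 0 ≤ W I) (hW : ∀ e I, W (swapImage e (τ e) I) = W I) :
    IsMatrixSteinFamily W (signedSum χ H) H (fun e => swapImage e (τ e)) (swapCoeff χ τ) where
  weight_nonneg := hW0
  involutive e := swapImage_involutive e (τ e)
  weight_move := hW
  isHermitian := isHermitian_signedSum hH
  isHermitian_direction := hH
  coeff_move := swapCoeff_swapImage χ τ
  sub_move := signedSum_sub_swapImage hχ hτχ hτH
  sum_coeff_smul := sum_swapCoeff_smul hτ hτχ hτH

variable [Fintype ι]

theorem sum_swapCoeff_sq_mul_trace_le (hχ : ∀ e, χ e ^ 2 = 1) (hτ : Function.Involutive τ)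
    (hτH : ∀ e, H (τ e) = H e) (hH : ∀ e, (H e).IsHermitian) (I : Finset α) {Y : Matrix ι ι ℝ}
    (hY : Y.PosSemidef) :
    ∑ e, swapCoeff χ τ e I ^ 2 * (H e * H e * Y).trace ≤
      2 * ∑ e ∈ I, (H e * H e * Y).trace := by
  have hnonneg (e : α) : 0 ≤ (H e * H e * Y).trace := by
    have h := (hY.mul_mul_conjTranspose_same (H e)).trace_nonneg
    rwa [(hH e).eq, trace_mul_cycle] at h
  have hreindex : ∑ e, (if τ e ∈ I then 1 else 0) * (H e * H e * Y).trace =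
      ∑ e ∈ I, (H e * H e * Y).trace := by
    rw [← Equiv.sum_comp (hτ.toPerm τ)]
    simp [hτ _, hτH, sum_ite_mem]
  calc ∑ e, swapCoeff χ τ e I ^ 2 * (H e * H e * Y).trace
      ≤ ∑ e, ((if e ∈ I then 1 else 0) + (if τ e ∈ I then 1 else 0)) * (H e * H e * Y).trace :=
        sum_le_sum fun e _ => mul_le_mul_of_nonneg_right (swapCoeff_sq_le hχ τ e I) (hnonneg e)
    _ = 2 * ∑ e ∈ I, (H e * H e * Y).trace := by
        simp only [add_mul, sum_add_distrib]
        rw [hreindex, two_mul]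
        simp [sum_ite_mem]

variable [DecidableEq ι]

/-- The hypothesis `hd` bounds the matrix variance `∑ e ∈ I, H e ^ 2` by `d` in the semidefinite
order. -/
theorem sum_weight_mul_trace_signedSum_pow_le (hχ : ∀ e, χ e ^ 2 = 1)
    (hτ : Function.Involutive τ) (hτχ : ∀ e, χ (τ e) = -χ e) (hτH : ∀ e, H (τ e) = H e)
    (hH : ∀ e, (H e).IsHermitian) {W : Finset α → ℝ} (hW0 : ∀ I, 0 ≤ W I)
    (hW : ∀ e I, W (swapImage e (τ e) I) = W I) {d : ℝ} (hd0 : 0 ≤ d)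
    (hd : ∀ I, W I ≠ 0 → ∀ Y : Matrix ι ι ℝ, Y.PosSemidef →
      ∑ e ∈ I, (H e * H e * Y).trace ≤ d * Y.trace) (r : ℕ) :
    ∑ I, W I * (signedSum χ H I ^ (2 * r)).trace ≤
      (2 * r * d) ^ r * ((∑ I, W I) * Fintype.card ι) :=
  (isMatrixSteinFamily_signedSum hχ hτ hτχ hτH hH hW0 hW).sum_weight_mul_trace_pow_two_mul_le hd0
    (fun I hI Y hY => by
      have hsq := sum_swapCoeff_sq_mul_trace_le hχ hτ hτH hH I hY
      linarith [hd I hI Y hY]) r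

end SignedSums

section BernoulliSubsets

open Finset

variable {α : Type*} [Fintype α]

/-- The weight of `I` when every element is included independently with probability `p`. -/
def bernoulliWeight (p : ℝ) (I : Finset α) : ℝ := p ^ #I * (1 - p) ^ (Fintype.card α - #I)

open scoped Classical in
/-- The probability of the event `E` for a random subset of density `p`. -/
noncomputable def bernoulliProb (p : ℝ) (E : Finset α → Prop) : ℝ :=
  ∑ I : Finset α with E I, bernoulliWeight p I

theorem instanceProb_eq_bernoulliProb (k n : ℕ) (m : ℝ) (E : SignedHypergraph k n → Prop) :
    instanceProb k n m E = bernoulliProb (m / (2 ^ k * (n : ℝ) ^ k)) E := by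
  have hcard : Fintype.card (Clause k n) = 2 ^ k * n ^ k := by
    simp [Clause, Fintype.card_prod, Fintype.card_units_int]
  simp only [instanceProb, bernoulliProb, bernoulliWeight, hcard]

theorem bernoulliWeight_swapImage [DecidableEq α] (p : ℝ) (e e' : α) (I : Finset α) :
    bernoulliWeight p (swapImage e e' I) = bernoulliWeight p I := by
  simp [bernoulliWeight, swapImage]

theorem sum_bernoulliWeight_mul_prod (p : ℝ) (g : α → ℝ) :
    ∑ I : Finset α, bernoulliWeight p I * ∏ e ∈ I, g e = ∏ e, (p * g e + (1 - p)) := by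
  classical
  rw [prod_add, powerset_univ]
  refine sum_congr rfl fun I _ => ?_
  rw [prod_mul_distrib, prod_const, prod_const, ← compl_eq_univ_sdiff, card_compl, bernoulliWeight]
  ring

theorem sum_bernoulliWeight (p : ℝ) : ∑ I : Finset α, bernoulliWeight p I = 1 := by
  simpa using sum_bernoulliWeight_mul_prod (α := α) p fun _ => 1

theorem bernoulliProb_add_compl (p : ℝ) (E : Finset α → Prop) :
    bernoulliProb p E + bernoulliProb p (fun I => ¬ E I) = 1 := by
  classical
  rw [← sum_bernoulliWeight (α := α) p, bernoulliProb, bernoulliProb,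
    ← sum_filter_add_sum_filter_not univ E]
  congr!

variable {p : ℝ} (hp0 : 0 ≤ p) (hp1 : p ≤ 1)
include hp0 hp1

theorem bernoulliWeight_nonneg (I : Finset α) : 0 ≤ bernoulliWeight p I :=
  mul_nonneg (pow_nonneg hp0 _) (pow_nonneg (sub_nonneg.2 hp1) _)

theorem bernoulliProb_nonneg (E : Finset α → Prop) : 0 ≤ bernoulliProb p E :=
  sum_nonneg fun I _ => bernoulliWeight_nonneg hp0 hp1 I

theorem bernoulliProb_mono {E F : Finset α → Prop} (h : ∀ I, E I → F I) :
    bernoulliProb p E ≤ bernoulliProb p F := by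
  classical
  exact sum_le_sum_of_subset_of_nonneg (monotone_filter_right _ fun I _ => h I)
    fun I _ _ => bernoulliWeight_nonneg hp0 hp1 I

theorem bernoulliProb_le_one (E : Finset α → Prop) : bernoulliProb p E ≤ 1 := by
  linarith [bernoulliProb_add_compl p E, bernoulliProb_nonneg hp0 hp1 fun I => ¬ E I]

theorem bernoulliProb_exists_le {κ : Type*} [Fintype κ] (E : κ → Finset α → Prop) :
    bernoulliProb p (fun I => ∃ k, E k I) ≤ ∑ k, bernoulliProb p (E k) := by
  classical
  simp only [bernoulliProb, sum_filter]
  rw [sum_comm]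
  refine sum_le_sum fun I _ => ?_
  have hw := bernoulliWeight_nonneg hp0 hp1 I
  have hterm (k : κ) : 0 ≤ if E k I then bernoulliWeight p I else 0 := by positivity
  split_ifs with h
  · obtain ⟨k, hk⟩ := h
    exact (if_pos hk).ge.trans (single_le_sum (fun k _ => hterm k) (mem_univ k))
  · exact sum_nonneg fun k _ => hterm k

theorem bernoulliProb_or_le (E F : Finset α → Prop) :
    bernoulliProb p (fun I => E I ∨ F I) ≤ bernoulliProb p E + bernoulliProb p F := by
  classical
  simp only [bernoulliProb, filter_or, ← sum_union_inter (s₁ := univ.filter E)]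
  exact le_add_of_nonneg_right (sum_nonneg fun I _ => bernoulliWeight_nonneg hp0 hp1 I)

open scoped Classical in
theorem mul_bernoulliProb_and_le {G : Finset α → Prop} {F : Finset α → ℝ}
    (hF : ∀ I, G I → 0 ≤ F I) (t : ℝ) :
    t * bernoulliProb p (fun I => G I ∧ t ≤ F I) ≤ ∑ I with G I, bernoulliWeight p I * F I := by
  simp only [bernoulliProb, ← filter_filter, mul_sum]
  rw [sum_filter]
  refine sum_le_sum fun I hI => ?_
  have hw := bernoulliWeight_nonneg hp0 hp1 I
  split_ifs with h
  · rw [mul_comm]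
    exact mul_le_mul_of_nonneg_left h hw
  · exact mul_nonneg hw (hF I (mem_filter.1 hI).2)

theorem sum_bernoulliWeight_mul_exp_le {a : α → ℝ} (ha : ∀ e, |a e| ≤ 1) :
    ∑ I : Finset α, bernoulliWeight p I * Real.exp (∑ e ∈ I, a e) ≤
      Real.exp (p * ∑ e, (a e + a e ^ 2)) := by
  simp only [Real.exp_sum, sum_bernoulliWeight_mul_prod, mul_sum]
  refine prod_le_prod (fun e _ => ?_) fun e _ => ?_
  · exact add_nonneg (mul_nonneg hp0 (Real.exp_pos _).le) (sub_nonneg.2 hp1)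
  · have hexp := (abs_le.1 (Real.abs_exp_sub_one_sub_id_le (ha e))).2
    have hone := Real.add_one_le_exp (p * (a e + a e ^ 2))
    nlinarith

theorem bernoulliProb_le_exp {a : α → ℝ} (ha : ∀ e, |a e| ≤ 1) (t : ℝ) :
    bernoulliProb p (fun I => t ≤ ∑ e ∈ I, a e) ≤ Real.exp (p * ∑ e, (a e + a e ^ 2) - t) := by
  have hMarkov := mul_bernoulliProb_and_le hp0 hp1 (G := fun _ => True)
    (fun (I : Finset α) _ => (Real.exp_pos (∑ e ∈ I, a e)).le) (Real.exp t)
  simp only [Real.exp_le_exp, true_and, filter_true] at hMarkov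
  rw [Real.exp_sub, le_div_iff₀' (Real.exp_pos _)]
  exact hMarkov.trans (sum_bernoulliWeight_mul_exp_le hp0 hp1 ha)

theorem bernoulliProb_card_filter_le_exp (P : α → Prop) [DecidablePred P] {s c : ℝ}
    (hs : |s| = 1) (hc0 : 0 ≤ c) (hc1 : c ≤ 1) (t : ℝ) :
    bernoulliProb p (fun I => t ≤ s * (#{e ∈ I | P e} - p * #{e | P e})) ≤
      Real.exp (p * #{e | P e} * c ^ 2 - c * t) := by
  have hsum (I : Finset α) : ∑ e ∈ I, (if P e then c * s else 0) = c * s * #{e ∈ I | P e} := by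
    rw [← sum_filter, sum_const, nsmul_eq_mul, mul_comm]
  have hvar : ∑ e, ((if P e then c * s else 0) + (if P e then c * s else 0) ^ 2) =
      (c * s + c ^ 2) * #{e | P e} := by
    have hterm (e : α) : (if P e then c * s else 0) + (if P e then c * s else 0) ^ 2 =
        if P e then c * s + c ^ 2 else 0 := by
      split_ifs
      · rw [mul_pow, ← sq_abs s, hs, one_pow, mul_one]
      · simp
    rw [sum_congr rfl fun e _ => hterm e, ← sum_filter, sum_const, nsmul_eq_mul, mul_comm]
  have hBernstein := bernoulliProb_le_exp hp0 hp1 (a := fun e => if P e then c * s else 0)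
    (fun e => by split_ifs <;> simp [abs_mul, hs, abs_of_nonneg hc0, hc1])
    (c * (s * (p * #{e | P e}) + t))
  simp only [hsum, hvar] at hBernstein
  refine (bernoulliProb_mono hp0 hp1 fun I hI => ?_).trans (hBernstein.trans_eq ?_)
  · rw [mul_assoc c s]
    exact mul_le_mul_of_nonneg_left (by linarith) hc0
  · congr 1
    ring

theorem bernoulliProb_lt_abs_card_filter_sub_le (P : α → Prop) [DecidablePred P] {c : ℝ}
    (hc0 : 0 ≤ c) (hc1 : c ≤ 1) (t : ℝ) :
    bernoulliProb p (fun I => t < |(#{e ∈ I | P e} : ℝ) - p * #{e | P e}|) ≤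
      2 * Real.exp (p * #{e | P e} * c ^ 2 - c * t) := by
  have hsign (s : ℝ) (hs : |s| = 1) :=
    bernoulliProb_card_filter_le_exp hp0 hp1 P hs hc0 hc1 t
  have hunion := bernoulliProb_or_le hp0 hp1
    (fun I => t ≤ 1 * ((#{e ∈ I | P e} : ℝ) - p * #{e | P e}))
    (fun I => t ≤ -1 * ((#{e ∈ I | P e} : ℝ) - p * #{e | P e}))
  refine (bernoulliProb_mono hp0 hp1 fun I hI => ?_).trans (hunion.trans ?_)
  · rcases lt_abs.1 hI with h | h
    · exact Or.inl (by linarith)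
    · exact Or.inr (by linarith)
  · linarith [hsign 1 abs_one, hsign (-1) (by rw [abs_neg, abs_one])]

end BernoulliSubsets

section Certificate

open Finset Matrix

/-- A bilinear form attached to an instance: a clause contributes the product of its signs at the
positions `signs` to the entries given by its vertices at the positions `fst` and `snd`. -/
structure SignForm where
  signs : List (Fin 3)
  fst : Fin 3
  snd : Fin 3

namespace SignForm

variable {n : ℕ}

/-- The sign with which a clause enters the form. -/
def sign (f : SignForm) (e : Clause 3 n) : ℤ := (f.signs.map fun i => ((e.1 i : ℤˣ) : ℤ)).prod

/-- The symmetrized contribution of a clause to the form, without its sign. -/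
def edge (f : SignForm) (R : Type*) [Semiring R] (e : Clause 3 n) : Matrix (Fin n) (Fin n) R :=
  single (e.2 f.fst) (e.2 f.snd) 1 + single (e.2 f.snd) (e.2 f.fst) 1

/-- The integer matrix of the form attached to an instance. -/
def matrix (f : SignForm) (I : SignedHypergraph 3 n) : Matrix (Fin n) (Fin n) ℤ :=
  ∑ e ∈ I, f.sign e • f.edge ℤ e

/-- The matrix of the form over the reals, where the spectral theorem is available. -/
def realMatrix (f : SignForm) (I : SignedHypergraph 3 n) : Matrix (Fin n) (Fin n) ℝ :=
  signedSum (fun e => (f.sign e : ℝ)) (f.edge ℝ) I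

theorem isHermitian_edge (f : SignForm) (e : Clause 3 n) : (f.edge ℝ e).IsHermitian := by
  simp [IsHermitian, edge, add_comm]

theorem isHermitian_realMatrix (f : SignForm) (I : SignedHypergraph 3 n) :
    (f.realMatrix I).IsHermitian :=
  isHermitian_signedSum f.isHermitian_edge I

theorem map_matrix (f : SignForm) (I : SignedHypergraph 3 n) :
    (f.matrix I).map (Int.castRingHom ℝ) = f.realMatrix I := by
  ext i j
  simp [matrix, realMatrix, signedSum, edge, Matrix.sum_apply, Matrix.single_apply]

theorem cast_trace_matrix_pow (f : SignForm) (I : SignedHypergraph 3 n) (k : ℕ) :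
    (((f.matrix I ^ k).trace : ℤ) : ℝ) = (f.realMatrix I ^ k).trace := by
  rw [← map_matrix, ← RingHom.mapMatrix_apply, ← map_pow, RingHom.mapMatrix_apply]
  simp [trace]

theorem cast_dotProduct_matrix_mulVec (f : SignForm) (I : SignedHypergraph 3 n)
    (x y : Fin n → ℤ) :
    ((y ⬝ᵥ f.matrix I *ᵥ x : ℤ) : ℝ) =
      (fun i => (y i : ℝ)) ⬝ᵥ f.realMatrix I *ᵥ fun i => (x i : ℝ) := by
  simp [← f.map_matrix, dotProduct, mulVec]

theorem trace_matrix_pow_nonneg (f : SignForm) (I : SignedHypergraph 3 n) (k : ℕ) :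
    0 ≤ (f.matrix I ^ (2 * k)).trace := by
  have h := (posSemidef_pow_two_mul (f.isHermitian_realMatrix I) k).trace_nonneg
  rw [← cast_trace_matrix_pow] at h
  exact_mod_cast h

theorem edge_mulVec (f : SignForm) {R : Type*} [Semiring R] (e : Clause 3 n) (x : Fin n → R) :
    f.edge R e *ᵥ x =
      Pi.single (e.2 f.fst) (x (e.2 f.snd)) + Pi.single (e.2 f.snd) (x (e.2 f.fst)) := by
  rw [edge, add_mulVec, single_mulVec, single_mulVec, one_mul, one_mul]
  rfl

theorem dotProduct_matrix_mulVec (f : SignForm) (I : SignedHypergraph 3 n) (x y : Fin n → ℤ) :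
    y ⬝ᵥ f.matrix I *ᵥ x = ∑ e ∈ I, f.sign e *
      (y (e.2 f.fst) * x (e.2 f.snd) + y (e.2 f.snd) * x (e.2 f.fst)) := by
  rw [matrix, sum_mulVec, dotProduct_sum]
  refine sum_congr rfl fun e _ => ?_
  rw [smul_mulVec, dotProduct_smul, edge_mulVec, dotProduct_add, dotProduct_single,
    dotProduct_single, smul_eq_mul]

end SignForm

/-- The forms in the certificate: the linear and quadratic characters of the clause predicate, and
the quadratic form which compares a clause with a parity constraint. -/
def signForms : List SignForm :=
  [⟨[0], 0, 0⟩, ⟨[1], 1, 1⟩, ⟨[2], 2, 2⟩, ⟨[0, 1], 0, 1⟩, ⟨[0, 2], 0, 2⟩, ⟨[1, 2], 1, 2⟩,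
    ⟨[0, 1, 2], 0, 1⟩]

variable {n : ℕ}

/-- The even exponent of the traces in the certificate: it is so large that the factor `n` between
the trace and the norm costs only a constant. -/
def traceExponent (n : ℕ) : ℕ := 2 * (Nat.clog 2 n + 1)

/-- The sum of the trace moments of all forms of the certificate. -/
def traceSum (I : SignedHypergraph 3 n) : ℤ :=
  (signForms.map fun f => (f.matrix I ^ traceExponent n).trace).sum

/-- The least exponent of a power of two that dominates the root of `traceSum`. -/
def normLog (I : SignedHypergraph 3 n) : ℕ :=
  Nat.clog (2 ^ traceExponent n) (traceSum I).toNat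

/-- A power of two which bounds the spectral norms of all forms. -/
def normBound (I : SignedHypergraph 3 n) : ℕ := 2 ^ normLog I

/-- The number of clauses with the vertex `i` at position `a`. -/
def degree (I : SignedHypergraph 3 n) (a : Fin 3) (i : Fin n) : ℕ := #{e ∈ I | e.2 a = i}

/-- The total deviation of the degrees at the last position from their average, multiplied by `n`
to be an integer. -/
def degreeDeviation (I : SignedHypergraph 3 n) : ℤ :=
  ∑ i, |(n : ℤ) * degree I 2 i - #I|

/-- The certified bound on the bias. An instance without clauses (or variables) gets the value `2`,
which exceeds every bias. -/
def biasBound (a : Σ n : ℕ, SignedHypergraph 3 n) : ℚ :=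
  if a.2.card * a.1 = 0 then 2
  else ((2 * degreeDeviation a.2 + 7 * a.1 ^ 2 * normBound a.2 + 1 : ℤ) : ℚ) /
    ((a.2.card * a.1 : ℕ) : ℚ)

theorem trace_le_traceSum (I : SignedHypergraph 3 n) {f : SignForm} (hf : f ∈ signForms) :
    (f.matrix I ^ traceExponent n).trace ≤ traceSum I :=
  List.single_le_sum (by
    simp only [List.mem_map]
    rintro _ ⟨g, -, rfl⟩
    exact g.trace_matrix_pow_nonneg I _) _ (List.mem_map.2 ⟨f, hf, rfl⟩)

theorem traceSum_nonneg (I : SignedHypergraph 3 n) : 0 ≤ traceSum I :=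
  List.sum_nonneg (by
    simp only [List.mem_map]
    rintro _ ⟨g, -, rfl⟩
    exact g.trace_matrix_pow_nonneg I _)

theorem one_lt_two_pow_traceExponent (n : ℕ) : 1 < 2 ^ traceExponent n :=
  Nat.one_lt_two_pow (by simp [traceExponent])

theorem traceSum_le_normBound_pow (I : SignedHypergraph 3 n) :
    traceSum I ≤ (normBound I : ℤ) ^ traceExponent n := by
  have h := Nat.le_pow_clog (one_lt_two_pow_traceExponent n) (traceSum I).toNat
  rw [← pow_mul, mul_comm, pow_mul] at h
  rw [← Int.toNat_of_nonneg (traceSum_nonneg I)]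
  exact_mod_cast h

theorem dotProduct_units_self (x : Fin n → ℤˣ) :
    (fun i => ((x i : ℤ) : ℝ)) ⬝ᵥ (fun i => ((x i : ℤ) : ℝ)) = n := by
  have hsq (i : Fin n) : ((x i : ℤ) : ℝ) * ((x i : ℤ) : ℝ) = 1 := by
    rw [← Int.cast_mul, ← Units.val_mul, Int.units_mul_self, Units.val_one, Int.cast_one]
  simp [dotProduct, hsq]

theorem abs_dotProduct_matrix_mulVec_le (I : SignedHypergraph 3 n) {f : SignForm}
    (hf : f ∈ signForms) (x y : Fin n → ℤˣ) :
    |(fun i => (y i : ℤ)) ⬝ᵥ f.matrix I *ᵥ fun i => (x i : ℤ)| ≤ n * normBound I := by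
  have htrace := dotProduct_mulVec_pow_le_trace (f.isHermitian_realMatrix I)
    (fun i => ((x i : ℤ) : ℝ)) (fun i => ((y i : ℤ) : ℝ)) (Nat.clog 2 n).succ_ne_zero
  rw [dotProduct_units_self, dotProduct_units_self, ← sq, ← pow_mul,
    ← f.cast_dotProduct_matrix_mulVec, ← f.cast_trace_matrix_pow] at htrace
  have heven : Even (traceExponent n) := even_two_mul _
  have hne : traceExponent n ≠ 0 := by simp [traceExponent]
  rw [← pow_le_pow_iff_left₀ (abs_nonneg _) (by positivity) hne, heven.pow_abs, mul_pow]
  calc _ ≤ (n : ℤ) ^ traceExponent n * (f.matrix I ^ traceExponent n).trace := by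
        exact_mod_cast htrace
    _ ≤ n ^ traceExponent n * normBound I ^ traceExponent n :=
        mul_le_mul_of_nonneg_left
          ((trace_le_traceSum I hf).trans (traceSum_le_normBound_pow I)) (by positivity)

theorem abs_two_mul_sum_linear_le (I : SignedHypergraph 3 n) (x : Fin n → ℤˣ) (a : Fin 3) :
    |2 * ∑ e ∈ I, (e.1 a * x (e.2 a) : ℤ)| ≤ n * normBound I := by
  have hmem : (⟨[a], a, a⟩ : SignForm) ∈ signForms := by fin_cases a <;> simp [signForms]
  have h := abs_dotProduct_matrix_mulVec_le I hmem x 1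
  rw [SignForm.dotProduct_matrix_mulVec] at h
  convert h using 2
  rw [mul_sum]
  refine sum_congr rfl fun e _ => ?_
  simp only [SignForm.sign, List.map_cons, List.map_nil, List.prod_singleton, Pi.one_apply,
    Units.val_one]
  ring

theorem abs_two_mul_sum_quadratic_le (I : SignedHypergraph 3 n) (x : Fin n → ℤˣ) {a b : Fin 3}
    (hab : a < b) :
    |2 * ∑ e ∈ I, (e.1 a * e.1 b * x (e.2 a) * x (e.2 b) : ℤ)| ≤ n * normBound I := by
  have hmem : (⟨[a, b], a, b⟩ : SignForm) ∈ signForms := by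
    fin_cases a <;> fin_cases b <;> simp_all [signForms]
  have h := abs_dotProduct_matrix_mulVec_le I hmem x x
  rw [SignForm.dotProduct_matrix_mulVec] at h
  convert h using 2
  rw [mul_sum]
  refine sum_congr rfl fun e _ => ?_
  simp only [SignForm.sign, List.map_cons, List.map_nil, List.prod_cons, List.prod_nil]
  ring

theorem abs_two_mul_sum_parity_le (I : SignedHypergraph 3 n) (x : Fin n → ℤˣ) (s : ℤˣ) :
    |2 * ∑ e ∈ I, (s * (e.1 0 * e.1 1 * e.1 2 * x (e.2 0) * x (e.2 1)) : ℤ)| ≤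
      n * normBound I := by
  have hmem : (⟨[0, 1, 2], 0, 1⟩ : SignForm) ∈ signForms := by simp [signForms]
  have h := abs_dotProduct_matrix_mulVec_le I hmem x fun i => s * x i
  rw [SignForm.dotProduct_matrix_mulVec] at h
  convert h using 2
  rw [mul_sum]
  refine sum_congr rfl fun e _ => ?_
  simp only [SignForm.sign, List.map_cons, List.map_nil, List.prod_cons, List.prod_nil,
    Units.val_mul]
  ring

/-- Eight times the indicator is `(1 + c₀ * x₀) * (1 + c₁ * x₁) * (1 + c₂ * x₂)`, so with
`w = c₀ * c₁ * c₂ * x₀ * x₁` the right-hand side exceeds the left-hand side by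
`(1 - s * w) * (1 - s * x₂)`. -/
theorem mul_third_le_expansion (s c₀ c₁ c₂ x₀ x₁ x₂ : ℤˣ) :
    (s * x₂ : ℤ) ≤ 8 * (if c₀ * x₀ = 1 ∧ c₁ * x₁ = 1 ∧ c₂ * x₂ = 1 then 1 else 0)
      - c₀ * x₀ - c₁ * x₁ - c₂ * x₂ - c₀ * c₁ * x₀ * x₁ - c₀ * c₂ * x₀ * x₂ - c₁ * c₂ * x₁ * x₂
      - s * (c₀ * c₁ * c₂ * x₀ * x₁) := by
  revert s c₀ c₁ c₂ x₀ x₁ x₂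
  decide

theorem kSAT_eq_one_sub (z : Fin 3 → ℤˣ) :
    (kSAT z : ℤ) = 1 - if z 0 = 1 ∧ z 1 = 1 ∧ z 2 = 1 then 1 else 0 := by
  revert z
  decide

theorem two_mul_sum_third_le (I : SignedHypergraph 3 n) (x : Fin n → ℤˣ) (s : ℤˣ) :
    2 * ∑ e ∈ I, (s * x (e.2 2) : ℤ) ≤
      16 * (#I - satisfiedCount I x) + 7 * (n * normBound I) := by
  have hsum : ∑ e ∈ I, (s * x (e.2 2) : ℤ) ≤ ∑ e ∈ I,
      (8 * (1 - (kSAT (fun i => e.1 i * x (e.2 i)) : ℤ))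
      - e.1 0 * x (e.2 0) - e.1 1 * x (e.2 1) - e.1 2 * x (e.2 2)
      - e.1 0 * e.1 1 * x (e.2 0) * x (e.2 1) - e.1 0 * e.1 2 * x (e.2 0) * x (e.2 2)
      - e.1 1 * e.1 2 * x (e.2 1) * x (e.2 2)
      - s * (e.1 0 * e.1 1 * e.1 2 * x (e.2 0) * x (e.2 1))) := by
    refine sum_le_sum fun e _ => ?_
    rw [kSAT_eq_one_sub, sub_sub_cancel]
    exact mul_third_le_expansion _ _ _ _ _ _ _
  have hunsat : ∑ e ∈ I, 8 * (1 - (kSAT (fun i => e.1 i * x (e.2 i)) : ℤ)) =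
      8 * (#I - satisfiedCount I x) := by
    simp [satisfiedCount, ← mul_sum]
  have hlinear (a : Fin 3) := (abs_le.1 (abs_two_mul_sum_linear_le I x a)).1
  have hquadratic {a b : Fin 3} (hab : a < b) :=
    (abs_le.1 (abs_two_mul_sum_quadratic_le I x hab)).1
  have hparity := (abs_le.1 (abs_two_mul_sum_parity_le I x s)).1
  simp only [sum_sub_distrib, hunsat] at hsum
  linarith [hlinear 0, hlinear 1, hlinear 2, hquadratic (show (0 : Fin 3) < 1 by decide),
    hquadratic (show (0 : Fin 3) < 2 by decide), hquadratic (show (1 : Fin 3) < 2 by decide)]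

theorem sum_comp_eq_sum_degree_mul {R : Type*} [Semiring R] (I : SignedHypergraph 3 n) (a : Fin 3)
    (g : Fin n → R) :
    ∑ e ∈ I, g (e.2 a) = ∑ i, degree I a i * g i := by
  rw [← sum_fiberwise_of_maps_to (t := univ) (g := fun e : Clause 3 n => e.2 a) (by simp)]
  refine sum_congr rfl fun i _ => ?_
  rw [sum_congr rfl (g := fun _ => g i) (fun e he => by rw [(mem_filter.1 he).2])]
  simp [degree]

theorem card_mul_sum_sub_le_degreeDeviation (I : SignedHypergraph 3 n) (y : Fin n → ℤˣ) :
    #I * ∑ i, (y i : ℤ) - n * ∑ e ∈ I, (y (e.2 2) : ℤ) ≤ degreeDeviation I := by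
  rw [sum_comp_eq_sum_degree_mul I 2 fun i => (y i : ℤ), degreeDeviation, mul_sum, mul_sum,
    ← sum_sub_distrib]
  refine sum_le_sum fun i _ => ?_
  calc #I * (y i : ℤ) - n * (degree I 2 i * (y i : ℤ))
      = -((n * degree I 2 i - #I) * (y i : ℤ)) := by ring
    _ ≤ |(n * degree I 2 i - #I) * (y i : ℤ)| := neg_le_abs _
    _ = |(n : ℤ) * degree I 2 i - #I| := by
        rw [abs_mul, Int.isUnit_iff_abs_eq.1 (y i).isUnit, mul_one]

theorem card_mul_abs_sum_le (I : SignedHypergraph 3 n) (x : Fin n → ℤˣ) :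
    2 * #I * |∑ i, (x i : ℤ)| ≤ 2 * degreeDeviation I +
      n * (16 * (#I - satisfiedCount I x) + 7 * (n * normBound I)) := by
  have hsign (s : ℤˣ) : 2 * #I * ((s : ℤ) * ∑ i, (x i : ℤ)) ≤ 2 * degreeDeviation I +
      n * (16 * (#I - satisfiedCount I x) + 7 * (n * normBound I)) := by
    have hthird := mul_le_mul_of_nonneg_left (two_mul_sum_third_le I x s) (Int.natCast_nonneg n)
    have hdeviation := card_mul_sum_sub_le_degreeDeviation I fun i => s * x i
    simp only [Units.val_mul] at hdeviation
    rw [← mul_sum univ] at hdeviation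
    linarith
  rcases abs_choice (∑ i, (x i : ℤ)) with h | h
  · simpa [h] using hsign 1
  · simpa [h] using hsign (-1)

theorem IsBiased.le_one {ρ : ℝ} {x : Fin n → ℤˣ} (hx : IsBiased ρ x) : ρ ≤ 1 := by
  have hsum : |∑ i, ((x i : ℤ) : ℝ)| ≤ n := by
    refine (abs_sum_le_sum_abs _ _).trans_eq ?_
    have habs (i : Fin n) : |((x i : ℤ) : ℝ)| = 1 := by
      rw [← Int.cast_abs, Int.isUnit_iff_abs_eq.1 (x i).isUnit, Int.cast_one]
    simp [habs]
  refine hx.trans ?_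
  rw [one_div, inv_mul_eq_div]
  exact div_le_one_of_le₀ hsum (Nat.cast_nonneg n)

theorem IsBiased.mul_le_abs_sum {ρ : ℝ} {x : Fin n → ℤˣ} (hn : n ≠ 0) (hx : IsBiased ρ x) :
    ρ * n ≤ |∑ i, ((x i : ℤ) : ℝ)| := by
  rwa [IsBiased, one_div, inv_mul_eq_div, le_div_iff₀ (by positivity)] at hx

theorem not_exists_isBiased_and_isSatisfying (I : SignedHypergraph 3 n) (ρ : ℝ)
    (hρ : (biasBound ⟨n, I⟩ : ℝ) ≤ ρ) :
    ¬ ∃ x : Fin n → ℤˣ, IsBiased ρ x ∧ IsSatisfying I (ρ / 32) x := by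
  rintro ⟨x, hbiased, hsat⟩
  by_cases hzero : #I * n = 0
  · rw [biasBound, if_pos hzero] at hρ
    norm_num at hρ
    linarith [hbiased.le_one]
  rw [biasBound, if_neg hzero] at hρ
  have hpos : (0 : ℝ) < #I * n := by exact_mod_cast Nat.pos_of_ne_zero hzero
  have hbound : (2 * degreeDeviation I + 7 * n ^ 2 * normBound I + 1 : ℝ) ≤ ρ * (#I * n) := by
    rw [← div_le_iff₀ hpos]
    exact_mod_cast hρ
  have hcount : (2 * #I * |∑ i, ((x i : ℤ) : ℝ)| : ℝ) ≤ 2 * degreeDeviation I +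
      n * (16 * (#I - satisfiedCount I x) + 7 * (n * normBound I)) := by
    exact_mod_cast card_mul_abs_sum_le I x
  have hsum := mul_le_mul_of_nonneg_left (hbiased.mul_le_abs_sum (right_ne_zero_of_mul hzero))
    (show (0 : ℝ) ≤ 2 * #I by positivity)
  have hunsat : (n : ℝ) * (#I - satisfiedCount I x) ≤ n * (ρ / 32 * #I) :=
    mul_le_mul_of_nonneg_left (by linarith [show (1 - ρ / 32) * #I ≤ _ from hsat])
      (Nat.cast_nonneg n)
  have hdeviation : (0 : ℝ) ≤ degreeDeviation I := by
    exact_mod_cast sum_nonneg fun i _ => abs_nonneg _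
  have hnorm : (0 : ℝ) ≤ 7 * n ^ 2 * normBound I := by positivity
  nlinarith

end Certificate

section RandomInstance

open Finset Matrix

variable {n : ℕ}

/-- The clause with the sign at position `h` reversed. -/
def flipSign (h : Fin 3) (e : Clause 3 n) : Clause 3 n := (Function.update e.1 h (-e.1 h), e.2)

theorem flipSign_involutive (h : Fin 3) : Function.Involutive (flipSign (n := n) h) := fun e => by
  simp [flipSign]

theorem SignForm.sign_flipSign (f : SignForm) (hnodup : f.signs.Nodup) {h : Fin 3}
    (hh : h ∈ f.signs) (e : Clause 3 n) : f.sign (flipSign h e) = -f.sign e := by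
  have herase : (f.signs.erase h).map (fun i => (((flipSign h e).1 i : ℤˣ) : ℤ)) =
      (f.signs.erase h).map (fun i => ((e.1 i : ℤˣ) : ℤ)) :=
    List.map_congr_left fun i hi => by simp [flipSign, (hnodup.mem_erase_iff.1 hi).1]
  rw [sign, sign, ← List.prod_map_erase _ hh, ← List.prod_map_erase _ hh, herase]
  simp [flipSign]

theorem SignForm.exists_sign_flipSign {f : SignForm} (hf : f ∈ signForms) :
    ∃ h : Fin 3, ∀ e : Clause 3 n, f.sign (flipSign h e) = -f.sign e := by
  have hsigns : f.signs.Nodup ∧ f.signs ≠ [] := by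
    simp only [signForms, List.mem_cons, List.not_mem_nil, or_false] at hf
    rcases hf with rfl | rfl | rfl | rfl | rfl | rfl | rfl <;> simp
  exact ⟨f.signs.head hsigns.2, f.sign_flipSign hsigns.1 (List.head_mem hsigns.2)⟩

theorem SignForm.sign_sq (f : SignForm) (e : Clause 3 n) : f.sign e ^ 2 = 1 := by
  rw [sign]
  induction f.signs with
  | nil => simp
  | cons i l ih =>
    rw [List.map_cons, List.prod_cons, mul_pow, ih, mul_one, ← Units.val_pow_eq_pow_val,
      Int.units_sq, Units.val_one]

theorem degree_swapImage_flipSign (h a : Fin 3) (i : Fin n) (e : Clause 3 n)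
    (I : SignedHypergraph 3 n) : degree (swapImage e (flipSign h e) I) a i = degree I a i := by
  have hvertex (g : Clause 3 n) : (Equiv.swap e (flipSign h e) g).2 = g.2 := by
    rw [Equiv.swap_apply_def]
    split_ifs with h₁ h₂
    · rw [h₁, flipSign]
    · rw [h₂, flipSign]
    · rfl
  rw [degree, degree, swapImage, filter_map, card_map]
  congr 1
  exact filter_congr fun g _ => by simp [hvertex]

theorem SignForm.trace_edge_mul_edge_mul_le (f : SignForm) (e : Clause 3 n)
    {Y : Matrix (Fin n) (Fin n) ℝ} (hY : ∀ i, 0 ≤ Y i i) :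
    (f.edge ℝ e * f.edge ℝ e * Y).trace ≤
      2 * (Y (e.2 f.fst) (e.2 f.fst) + Y (e.2 f.snd) (e.2 f.snd)) := by
  have hfst := hY (e.2 f.fst)
  have hsnd := hY (e.2 f.snd)
  by_cases h : e.2 f.fst = e.2 f.snd
  · refine le_of_eq ?_
    simp only [SignForm.edge, h, add_mul, mul_add, single_mul_single_same, trace_add,
      trace_single_mul, smul_eq_mul]
    ring
  · simp only [SignForm.edge, add_mul, mul_add, single_mul_single_same, trace_add,
      trace_single_mul, smul_eq_mul, single_mul_single_of_ne _ _ _ _ h,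
      single_mul_single_of_ne _ _ _ _ (Ne.symm h), Matrix.zero_mul, trace_zero]
    linarith

theorem SignForm.sum_trace_edge_mul_edge_mul_le (f : SignForm) {I : SignedHypergraph 3 n} {d : ℝ}
    (hd : ∀ a i, (degree I a i : ℝ) ≤ d) {Y : Matrix (Fin n) (Fin n) ℝ} (hY : ∀ i, 0 ≤ Y i i) :
    ∑ e ∈ I, (f.edge ℝ e * f.edge ℝ e * Y).trace ≤ 4 * d * Y.trace := by
  have hdegree (a : Fin 3) : ∑ e ∈ I, Y (e.2 a) (e.2 a) ≤ d * Y.trace := by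
    rw [sum_comp_eq_sum_degree_mul I a fun i => Y i i, trace, mul_sum]
    exact sum_le_sum fun i _ => mul_le_mul_of_nonneg_right (hd a i) (hY i)
  refine (sum_le_sum fun e _ => f.trace_edge_mul_edge_mul_le e hY).trans ?_
  rw [← mul_sum, sum_add_distrib]
  linarith [hdegree f.fst, hdegree f.snd]

theorem card_filter_vertex_eq (a : Fin 3) (i : Fin n) :
    #{e : Clause 3 n | e.2 a = i} = 8 * n ^ 2 := by
  have hprod : ({e : Clause 3 n | e.2 a = i} : Finset (Clause 3 n)) =
      univ ×ˢ ({U | U a = i} : Finset (Fin 3 → Fin n)) := by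
    ext
    simp
  have hpi : ({U | U a = i} : Finset (Fin 3 → Fin n)) =
      Fintype.piFinset (Function.update (fun _ => univ) a ({i} : Finset (Fin n))) := by
    ext U
    simp only [mem_filter, mem_univ, true_and, Fintype.mem_piFinset]
    refine ⟨fun hU j => ?_, fun hU => by simpa using hU a⟩
    rcases eq_or_ne j a with rfl | hj <;> simp [*]
  rw [hprod, card_product, hpi, Fintype.card_piFinset]
  fin_cases a <;> simp [Fin.prod_univ_three, Fintype.card_units_int, sq, Function.update_apply]

/-- All degrees differ from `d` by at most `ε`. -/
def DegreesNear (d ε : ℝ) (I : SignedHypergraph 3 n) : Prop :=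
  ∀ a i, |(degree I a i : ℝ) - d| ≤ ε

theorem bernoulliProb_not_degreesNear_le_exp {p d c : ℝ} (hp0 : 0 ≤ p) (hp1 : p ≤ 1)
    (hd : p * (8 * n ^ 2) = d) (hc0 : 0 ≤ c) (hc1 : c ≤ 1) (ε : ℝ) :
    bernoulliProb p (fun I : SignedHypergraph 3 n => ¬ DegreesNear d ε I) ≤
      6 * n * Real.exp (d * c ^ 2 - c * ε) := by
  have hdegree (k : Fin 3 × Fin n) :
      bernoulliProb p (fun I : SignedHypergraph 3 n => ε < |(degree I k.1 k.2 : ℝ) - d|) ≤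
        2 * Real.exp (d * c ^ 2 - c * ε) := by
    have h := bernoulliProb_lt_abs_card_filter_sub_le hp0 hp1
      (fun e : Clause 3 n => e.2 k.1 = k.2) hc0 hc1 ε
    rw [card_filter_vertex_eq] at h
    push_cast at h
    rwa [hd] at h
  calc bernoulliProb p (fun I : SignedHypergraph 3 n => ¬ DegreesNear d ε I)
      ≤ bernoulliProb p fun I => ∃ k : Fin 3 × Fin n, ε < |(degree I k.1 k.2 : ℝ) - d| :=
        bernoulliProb_mono hp0 hp1 fun I hI => by simpa [DegreesNear] using hI
    _ ≤ ∑ k : Fin 3 × Fin n,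
          bernoulliProb p fun I => ε < |(degree I k.1 k.2 : ℝ) - d| :=
        bernoulliProb_exists_le hp0 hp1 _
    _ ≤ ∑ _k : Fin 3 × Fin n, 2 * Real.exp (d * c ^ 2 - c * ε) :=
        sum_le_sum fun k _ => hdegree k
    _ = 6 * n * Real.exp (d * c ^ 2 - c * ε) := by
        simp
        ring

theorem bernoulliProb_not_degreesNear_le {p d : ℝ} (hp0 : 0 ≤ p) (hp1 : p ≤ 1)
    (hd : p * (8 * n ^ 2) = d) (hd0 : 0 < d) (hn : n ≠ 0) (hlogd : Real.log n ≤ d) :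
    bernoulliProb p (fun I : SignedHypergraph 3 n =>
      ¬ DegreesNear d (3 * √(d * Real.log n)) I) ≤ 6 / n := by
  have hlog : 0 ≤ Real.log n := Real.log_natCast_nonneg n
  refine (bernoulliProb_not_degreesNear_le_exp hp0 hp1 hd (Real.sqrt_nonneg (Real.log n / d))
    (Real.sqrt_le_one.2 (div_le_one_of_le₀ hlogd hd0.le)) _).trans_eq ?_
  have hsqrt : √(Real.log n / d) * √(d * Real.log n) = Real.log n := by
    rw [← Real.sqrt_mul (div_nonneg hlog hd0.le),
      show Real.log n / d * (d * Real.log n) = Real.log n * Real.log n by field_simp,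
      Real.sqrt_mul_self hlog]
  have hexponent : d * √(Real.log n / d) ^ 2 - √(Real.log n / d) * (3 * √(d * Real.log n)) =
      -(2 * Real.log n) := by
    rw [Real.sq_sqrt (div_nonneg hlog hd0.le), mul_div_cancel₀ _ hd0.ne']
    linear_combination -3 * hsqrt
  rw [hexponent, Real.exp_neg, two_mul, Real.exp_add, Real.exp_log (by positivity)]
  field_simp

open scoped Classical in
theorem SignForm.sum_trace_pow_le {f : SignForm} (hf : f ∈ signForms) {p : ℝ} (hp0 : 0 ≤ p)
    (hp1 : p ≤ 1) {d : ℝ} (hd0 : 0 ≤ d) (r : ℕ) :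
    ∑ I : SignedHypergraph 3 n with (∀ a i, (degree I a i : ℝ) ≤ d),
      bernoulliWeight p I * ((f.matrix I ^ (2 * r)).trace : ℝ) ≤ (8 * r * d) ^ r * n := by
  obtain ⟨h, hflip⟩ := f.exists_sign_flipSign (n := n) hf
  have hw (I : SignedHypergraph 3 n) := bernoulliWeight_nonneg hp0 hp1 I
  have hmoment := sum_weight_mul_trace_signedSum_pow_le (χ := fun e => (f.sign e : ℝ))
    (H := f.edge ℝ) (τ := flipSign h) (d := 4 * d)
    (W := fun I : SignedHypergraph 3 n =>
      if ∀ a i, (degree I a i : ℝ) ≤ d then bernoulliWeight p I else 0)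
    (fun e => by exact_mod_cast f.sign_sq e) (flipSign_involutive h)
    (fun e => by rw [hflip, Int.cast_neg]) (fun e => rfl) f.isHermitian_edge
    (fun I => by positivity [hw I])
    (fun e I => by simp only [degree_swapImage_flipSign, bernoulliWeight_swapImage])
    (by positivity)
    (fun I hI Y hY =>
      f.sum_trace_edge_mul_edge_mul_le (ite_ne_right_iff.1 hI).1
        fun i => hY.diag_nonneg) r
  have hmass : ∑ I : SignedHypergraph 3 n,
      (if ∀ a i, (degree I a i : ℝ) ≤ d then bernoulliWeight p I else 0) ≤ 1 := by
    rw [← sum_filter, ← sum_bernoulliWeight (α := Clause 3 n) p]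
    exact sum_le_sum_of_subset_of_nonneg (filter_subset _ _) fun I _ _ => hw I
  simp only [ite_mul, zero_mul, ← sum_filter, Fintype.card_fin] at hmoment hmass
  simp only [f.cast_trace_matrix_pow]
  refine hmoment.trans ?_
  calc (2 * r * (4 * d)) ^ r * _ ≤ (2 * r * (4 * d)) ^ r * (1 * n) := by gcongr
    _ = (8 * r * d) ^ r * n := by
        rw [one_mul]
        ring

open scoped Classical in
theorem sum_traceSum_le {p : ℝ} (hp0 : 0 ≤ p) (hp1 : p ≤ 1) {d : ℝ} (hd0 : 0 ≤ d) :
    ∑ I : SignedHypergraph 3 n with (∀ a i, (degree I a i : ℝ) ≤ d),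
      bernoulliWeight p I * (traceSum I : ℝ) ≤
      7 * ((8 * (Nat.clog 2 n + 1 : ℕ) * d) ^ (Nat.clog 2 n + 1) * n) := by
  have hlist (l : List SignForm) (hl : ∀ f ∈ l, f ∈ signForms) :
      ∑ I : SignedHypergraph 3 n with (∀ a i, (degree I a i : ℝ) ≤ d), bernoulliWeight p I *
        (((l.map fun f => (f.matrix I ^ traceExponent n).trace).sum : ℤ) : ℝ) ≤
      l.length * ((8 * (Nat.clog 2 n + 1 : ℕ) * d) ^ (Nat.clog 2 n + 1) * n) := by
    induction l with
    | nil => simp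
    | cons f l ih =>
      have hhead := f.sum_trace_pow_le (n := n) (hl f List.mem_cons_self) hp0 hp1 hd0
        (Nat.clog 2 n + 1)
      have htail := ih fun g hg => hl g (List.mem_cons_of_mem f hg)
      simp only [List.map_cons, List.sum_cons, Int.cast_add, mul_add, sum_add_distrib,
        List.length_cons]
      rw [Nat.cast_succ l.length, add_one_mul, add_comm]
      exact add_le_add htail hhead
  exact hlist signForms fun f hf => hf

end RandomInstance

section TailBound

open Finset

variable {n : ℕ}

theorem normBound_le_two_mul (I : SignedHypergraph 3 n) {Y : ℝ} (hY : 1 ≤ Y)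
    (h : (traceSum I : ℝ) ≤ Y ^ traceExponent n) : (normBound I : ℝ) ≤ 2 * Y := by
  rcases (normLog I).eq_zero_or_pos with hzero | hpos
  · rw [normBound, hzero, pow_zero, Nat.cast_one]
    linarith
  have hone : 1 < (traceSum I).toNat := by
    by_contra hle
    exact hpos.ne' (Nat.clog_of_right_le_one (not_lt.1 hle) _)
  have hlt : (2 ^ traceExponent n) ^ (normLog I - 1) < (traceSum I).toNat :=
    Nat.pow_pred_clog_lt_self (one_lt_two_pow_traceExponent n) hone
  have hpow : ((2 : ℝ) ^ (normLog I - 1)) ^ traceExponent n ≤ Y ^ traceExponent n := by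
    refine le_trans ?_ h
    rw [← Int.toNat_of_nonneg (traceSum_nonneg I), ← pow_mul, mul_comm, pow_mul]
    exact_mod_cast hlt.le
  have hroot : (2 : ℝ) ^ (normLog I - 1) ≤ Y :=
    (pow_le_pow_iff_left₀ (by positivity) (by linarith) (by simp [traceExponent])).1 hpow
  rw [normBound, ← Nat.sub_add_cancel hpos, pow_succ']
  push_cast
  linarith

theorem clog_add_one_le (hn : 1 ≤ Real.log n) : ((Nat.clog 2 n + 1 : ℕ) : ℝ) ≤ 4 * Real.log n := by
  have hone : 1 < n := by
    by_contra hle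
    have hlog : Real.log n ≤ 0 :=
      Real.log_nonpos (Nat.cast_nonneg n) (by exact_mod_cast not_lt.1 hle)
    linarith
  have hpos : 1 ≤ Nat.clog 2 n := Nat.clog_pos one_lt_two hone
  have hpow : (2 : ℝ) ^ (Nat.clog 2 n - 1) ≤ n := by
    exact_mod_cast (Nat.pow_pred_clog_lt_self one_lt_two hone).le
  have hlog := Real.log_le_log (by positivity) hpow
  have hclog : (1 : ℝ) ≤ Nat.clog 2 n := by exact_mod_cast hpos
  rw [Real.log_pow, Nat.cast_sub hpos, Nat.cast_one] at hlog
  push_cast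
  nlinarith [Real.log_two_gt_d9]

theorem normBound_le_of_traceSum_le (I : SignedHypergraph 3 n) {d : ℝ} (hn : 1 ≤ Real.log n)
    (hd : 1 ≤ d) (hT : (traceSum I : ℝ) ≤
      7 * (n : ℝ) ^ 2 * (16 * (Nat.clog 2 n + 1 : ℕ) * d) ^ (Nat.clog 2 n + 1)) :
    (normBound I : ℝ) ≤ 88 * √(d * Real.log n) := by
  set k := Nat.clog 2 n + 1 with hk
  have hk_one : (1 : ℝ) ≤ k := by exact_mod_cast Nat.le_add_left 1 _
  have hkd : 1 ≤ √(k * d) := Real.one_le_sqrt.2 (one_le_mul_of_one_le_of_one_le hk_one hd)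
  have hn_le : (n : ℝ) ≤ 2 ^ k := by
    exact_mod_cast (Nat.le_pow_clog one_lt_two n).trans
      (Nat.pow_le_pow_right two_pos (Nat.le_succ _))
  have hseven : (7 : ℝ) ≤ 7 ^ k := le_self_pow₀ (by norm_num) (by omega)
  have htrace : (traceSum I : ℝ) ≤ (22 * √(k * d)) ^ traceExponent n :=
    calc (traceSum I : ℝ) ≤ 7 * (n : ℝ) ^ 2 * (16 * k * d) ^ k := hT
      _ ≤ 7 ^ k * (2 ^ k) ^ 2 * (16 * k * d) ^ k := by gcongr
      _ = (448 * (k * d)) ^ k := by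
        rw [← pow_mul, mul_comm k 2, pow_mul, ← mul_pow, ← mul_pow]
        congr 1
        ring
      _ ≤ (484 * (k * d)) ^ k := by gcongr; norm_num
      _ = (22 * √(k * d)) ^ traceExponent n := by
        rw [traceExponent, ← hk, pow_mul, mul_pow 22, Real.sq_sqrt (by positivity)]
        norm_num
  have hsqrt : √(k * d) ≤ 2 * √(d * Real.log n) := by
    refine Real.sqrt_le_iff.2 ⟨by positivity, ?_⟩
    rw [mul_pow, Real.sq_sqrt (by positivity)]
    nlinarith [clog_add_one_le hn]
  linarith [normBound_le_two_mul I (by linarith) htrace]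

theorem DegreesNear.abs_card_sub_le {d ε : ℝ} {I : SignedHypergraph 3 n}
    (hI : DegreesNear d ε I) : |(#I : ℝ) - n * d| ≤ n * ε := by
  have hcard : (#I : ℝ) - n * d = ∑ i, ((degree I 2 i : ℝ) - d) := by
    simpa using sum_comp_eq_sum_degree_mul I 2 fun _ => (1 : ℝ)
  rw [hcard]
  refine (abs_sum_le_sum_abs _ _).trans ((sum_le_sum fun i _ => hI 2 i).trans_eq ?_)
  simp

theorem DegreesNear.degreeDeviation_le {d ε : ℝ} {I : SignedHypergraph 3 n}
    (hI : DegreesNear d ε I) : (degreeDeviation I : ℝ) ≤ 2 * n ^ 2 * ε := by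
  have hterm (i : Fin n) : |(n : ℝ) * degree I 2 i - #I| ≤ 2 * n * ε :=
    calc |(n : ℝ) * degree I 2 i - #I|
        = |n * (degree I 2 i - d) - (#I - n * d)| := by ring_nf
      _ ≤ n * |(degree I 2 i : ℝ) - d| + |(#I : ℝ) - n * d| := by
        refine (abs_sub _ _).trans_eq ?_
        rw [abs_mul, Nat.abs_cast]
      _ ≤ n * ε + n * ε := add_le_add (by gcongr; exact hI 2 i) hI.abs_card_sub_le
      _ = 2 * n * ε := by ring
  rw [degreeDeviation]
  push_cast
  refine (sum_le_sum fun i _ => hterm i).trans_eq ?_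
  simp
  ring

theorem six_mul_sqrt_le {d : ℝ} (hd : 36 * Real.log n ≤ d) : 6 * √(d * Real.log n) ≤ d := by
  have hlog := Real.log_natCast_nonneg n
  have hsqrt : √(d * Real.log n) ≤ d / 6 :=
    Real.sqrt_le_iff.2 ⟨by linarith, by nlinarith⟩
  linarith

theorem sqrt_div_eq_sqrt_mul_div {x d : ℝ} (hd : 0 < d) : √(x / d) = √(d * x) / d := by
  rw [← Real.sqrt_mul_self hd.le, ← Real.sqrt_div' _ (by positivity), Real.sqrt_mul_self hd.le]
  congr 1
  field_simp

theorem biasBound_le_of_degreesNear (I : SignedHypergraph 3 n) {d : ℝ} (hn : 1 ≤ Real.log n)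
    (hd : 36 * Real.log n ≤ d) (hI : DegreesNear d (3 * √(d * Real.log n)) I)
    (hT : (traceSum I : ℝ) ≤
      7 * (n : ℝ) ^ 2 * (16 * (Nat.clog 2 n + 1 : ℕ) * d) ^ (Nat.clog 2 n + 1)) :
    (biasBound ⟨n, I⟩ : ℝ) ≤ 1258 * √(Real.log n / d) := by
  have hn0 : n ≠ 0 := by
    rintro rfl
    norm_num at hn
  have hd0 : 0 < d := by linarith
  rw [sqrt_div_eq_sqrt_mul_div hd0]
  have hdeviation := hI.degreeDeviation_le
  have hnorm := normBound_le_of_traceSum_le I hn (by linarith) hT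
  have hcard := (abs_le.1 hI.abs_card_sub_le).1
  have hsmall := six_mul_sqrt_le hd
  have hlarge : 1 ≤ √(d * Real.log n) := Real.one_le_sqrt.2 (by nlinarith)
  set L := √(d * Real.log n)
  have hone : (1 : ℝ) ≤ n ^ 2 * L :=
    one_le_mul_of_one_le_of_one_le
      (one_le_pow₀ (by exact_mod_cast Nat.one_le_iff_ne_zero.2 hn0)) hlarge
  have hhalf : n * d / 2 ≤ (#I : ℝ) := by nlinarith [Nat.cast_nonneg (α := ℝ) n]
  have hden : (0 : ℝ) < #I * n := by
    have : (0 : ℝ) < n * d / 2 := by positivity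
    exact mul_pos (by linarith) (by positivity)
  rw [biasBound, if_neg (by exact_mod_cast hden.ne')]
  push_cast
  rw [div_le_iff₀ hden]
  calc 2 * (degreeDeviation I : ℝ) + 7 * n ^ 2 * normBound I + 1
      ≤ 2 * (2 * n ^ 2 * (3 * L)) + 7 * n ^ 2 * (88 * L) + n ^ 2 * L := by gcongr
    _ = 1258 * (L / d) * (n * d / 2 * n) := by
        field_simp
        norm_num
    _ ≤ 1258 * (L / d) * (#I * n) := by gcongr

theorem bernoulliProb_traceSum_ge_le {p d : ℝ} (hp0 : 0 ≤ p) (hp1 : p ≤ 1) (hd0 : 0 < d)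
    (hn : n ≠ 0) :
    bernoulliProb p (fun I : SignedHypergraph 3 n => (∀ a i, (degree I a i : ℝ) ≤ 2 * d) ∧
      7 * (n : ℝ) ^ 2 * (16 * (Nat.clog 2 n + 1 : ℕ) * d) ^ (Nat.clog 2 n + 1) ≤ traceSum I) ≤
      1 / n := by
  have hmoment := sum_traceSum_le (n := n) hp0 hp1 (d := 2 * d) (by positivity)
  have hk := (Nat.clog 2 n).succ_pos
  rw [Nat.succ_eq_add_one] at hk
  generalize Nat.clog 2 n + 1 = k at hmoment hk ⊢
  have ht : 0 < 7 * (n : ℝ) ^ 2 * (16 * k * d) ^ k := by positivity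
  have hMarkov := mul_bernoulliProb_and_le hp0 hp1
    (G := fun I : SignedHypergraph 3 n => ∀ a i, (degree I a i : ℝ) ≤ 2 * d)
    (F := fun I => (traceSum I : ℝ)) (fun I _ => Int.cast_nonneg (traceSum_nonneg I))
    (7 * (n : ℝ) ^ 2 * (16 * k * d) ^ k)
  refine le_of_mul_le_mul_left (hMarkov.trans ?_) ht
  have hvalue : 7 * ((8 * (k : ℝ) * (2 * d)) ^ k * n) =
      7 * (n : ℝ) ^ 2 * (16 * k * d) ^ k * (1 / n) := by
    rw [show 8 * (k : ℝ) * (2 * d) = 16 * k * d by ring]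
    field_simp
  rw [← hvalue]
  refine le_trans (le_of_eq ?_) hmoment
  congr!

theorem le_bernoulliProb_biasBound_le {p d : ℝ} (hp0 : 0 ≤ p) (hp1 : p ≤ 1)
    (hp : p * (8 * n ^ 2) = d) (hn : 1 ≤ Real.log n) (hd : 36 * Real.log n ≤ d) :
    1 - 7 / n ≤ bernoulliProb p (fun I : SignedHypergraph 3 n =>
      (biasBound ⟨n, I⟩ : ℝ) ≤ 1258 * √(Real.log n / d)) := by
  have hn0 : n ≠ 0 := by
    rintro rfl
    norm_num at hn
  have hd0 : 0 < d := by linarith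
  have hdegree (I : SignedHypergraph 3 n) (hI : DegreesNear d (3 * √(d * Real.log n)) I)
      (a : Fin 3) (i : Fin n) : (degree I a i : ℝ) ≤ 2 * d := by
    linarith [(abs_le.1 (hI a i)).2, six_mul_sqrt_le hd]
  have hnear := bernoulliProb_not_degreesNear_le hp0 hp1 hp hd0 hn0 (by linarith)
  have htrace := bernoulliProb_traceSum_ge_le hp0 hp1 hd0 hn0
  have hunion := bernoulliProb_or_le hp0 hp1
    (fun I : SignedHypergraph 3 n => ¬ DegreesNear d (3 * √(d * Real.log n)) I)
    (fun I => (∀ a i, (degree I a i : ℝ) ≤ 2 * d) ∧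
      7 * (n : ℝ) ^ 2 * (16 * (Nat.clog 2 n + 1 : ℕ) * d) ^ (Nat.clog 2 n + 1) ≤ traceSum I)
  have hbad : bernoulliProb p (fun I : SignedHypergraph 3 n =>
      ¬ (biasBound ⟨n, I⟩ : ℝ) ≤ 1258 * √(Real.log n / d)) ≤ _ :=
    (bernoulliProb_mono hp0 hp1 fun I hI => by
      by_contra hgood
      obtain ⟨hI_near, hI_trace⟩ := not_or.1 hgood
      rw [not_not] at hI_near
      exact hI (biasBound_le_of_degreesNear I hn hd hI_near
        (lt_of_not_ge fun h => hI_trace ⟨hdegree I hI_near, h⟩).le)).trans hunion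
  have hcompl := bernoulliProb_add_compl p fun I : SignedHypergraph 3 n =>
    (biasBound ⟨n, I⟩ : ℝ) ≤ 1258 * √(Real.log n / d)
  linarith [show (7 : ℝ) / n = 6 / n + 1 / n by ring]

theorem eventually_rpow_div_mem_Icc {δ : ℝ} (hδ : δ ≤ 2) :
    ∀ᶠ n : ℕ in atTop, (n : ℝ) ^ (1 + δ) / (2 ^ 3 * (n : ℝ) ^ 3) ∈ Set.Icc 0 1 := by
  filter_upwards [eventually_ge_atTop 1] with n hn
  refine ⟨by positivity, div_le_one_of_le₀ ?_ (by positivity)⟩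
  calc (n : ℝ) ^ (1 + δ) ≤ (n : ℝ) ^ ((3 : ℕ) : ℝ) :=
        Real.rpow_le_rpow_of_exponent_le (by exact_mod_cast hn) (by push_cast; linarith)
    _ = (n : ℝ) ^ 3 := Real.rpow_natCast _ _
    _ ≤ 2 ^ 3 * (n : ℝ) ^ 3 := le_mul_of_one_le_left (by positivity) (by norm_num)

theorem eventually_mul_log_le_rpow {δ : ℝ} (hδ : 0 < δ) (c : ℝ) :
    ∀ᶠ n : ℕ in atTop, c * Real.log n ≤ (n : ℝ) ^ δ := by
  have hlittle := ((isLittleO_log_rpow_atTop hδ).const_mul_left c).comp_tendsto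
    (tendsto_natCast_atTop_atTop (R := ℝ))
  filter_upwards [hlittle.bound one_pos] with n hn
  rw [one_mul] at hn
  exact (le_abs_self _).trans (hn.trans_eq (abs_of_nonneg (Real.rpow_nonneg n.cast_nonneg δ)))

theorem tendsto_instanceProb_biasBound_le {δ : ℝ} (hδ0 : 0 < δ) (hδ2 : δ ≤ 2) {ρ : ℕ → ℝ}
    (hρ : Tendsto (fun n : ℕ => ρ n / √(Real.log n / (n : ℝ) ^ δ)) atTop atTop) :
    Tendsto (fun n : ℕ => instanceProb 3 n ((n : ℝ) ^ (1 + δ))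
      (fun I => (biasBound ⟨n, I⟩ : ℝ) ≤ ρ n)) atTop (𝓝 1) := by
  simp only [instanceProb_eq_bernoulliProb]
  have hlog : ∀ᶠ n : ℕ in atTop, 1 ≤ Real.log n :=
    (Real.tendsto_log_atTop.comp tendsto_natCast_atTop_atTop).eventually_ge_atTop 1
  have hlim : Tendsto (fun n : ℕ => 1 - 7 / (n : ℝ)) atTop (𝓝 1) := by
    simpa using (tendsto_const_div_atTop_nhds_zero_nat (7 : ℝ)).const_sub 1
  refine tendsto_of_tendsto_of_tendsto_of_le_of_le' hlim tendsto_const_nhds ?_ ?_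
  · filter_upwards [eventually_rpow_div_mem_Icc hδ2, eventually_mul_log_le_rpow hδ0 36, hlog,
      hρ.eventually_ge_atTop 1258, eventually_gt_atTop 0] with n hp hdensity hn hratio hpos
    have hpos' : (0 : ℝ) < n := by exact_mod_cast hpos
    have hdegree : (n : ℝ) ^ (1 + δ) / (2 ^ 3 * (n : ℝ) ^ 3) * (8 * (n : ℝ) ^ 2) =
        (n : ℝ) ^ δ := by
      rw [Real.rpow_one_add' hpos'.le (by linarith)]
      field_simp
      norm_num
    refine (le_bernoulliProb_biasBound_le hp.1 hp.2 hdegree hn hdensity).trans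
      (bernoulliProb_mono hp.1 hp.2 fun I hI => hI.trans ?_)
    exact (le_div_iff₀ <| Real.sqrt_pos.2 <|
      div_pos (by linarith) (Real.rpow_pos_of_pos hpos' δ)).1 hratio
  · filter_upwards [eventually_rpow_div_mem_Icc hδ2] with n hp
    exact bernoulliProb_le_one hp.1 hp.2 _

end TailBound
namespace RAM

/-! ## Logarithmic cost and step counts -/

theorem one_le_bitCost (z : ℤ) : 1 ≤ bitCost z := Nat.le_add_left 1 _

theorem bitCost_le_of_natAbs_le {x y : ℤ} (h : x.natAbs ≤ y.natAbs) : bitCost x ≤ bitCost y :=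
  Nat.add_le_add_right (Nat.size_le_size h) 1

theorem bitCost_le_natAbs_add_one (z : ℤ) : bitCost z ≤ z.natAbs + 1 :=
  Nat.add_le_add_right (Nat.size_le.2 Nat.lt_two_pow_self) 1

theorem bitCost_le_of_natAbs_le_add {x y z : ℤ} (h : z.natAbs ≤ x.natAbs + y.natAbs) :
    bitCost z ≤ max (bitCost x) (bitCost y) + 1 := by
  rw [bitCost, bitCost, bitCost, max_add_add_right]
  refine Nat.add_le_add_right (Nat.size_le.2 (h.trans_lt ?_)) 1
  rw [pow_succ, mul_two]
  exact add_lt_add (Nat.size_le.1 (le_max_left _ _)) (Nat.size_le.1 (le_max_right _ _))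

theorem bitCost_mul_le (x y : ℤ) : bitCost (x * y) ≤ bitCost x + bitCost y := by
  have hlt : (x * y).natAbs.size ≤ x.natAbs.size + y.natAbs.size := by
    rw [Int.natAbs_mul, Nat.size_le, pow_add]
    exact Nat.mul_lt_mul'' (Nat.lt_size_self _) (Nat.lt_size_self _)
  simp only [bitCost]
  omega

theorem natAbs_ediv_mul_self_le (x y : ℤ) : (x / y * y).natAbs ≤ x.natAbs + y.natAbs := by
  rcases eq_or_ne y 0 with rfl | hy
  · simp
  · have hdiv := Int.emod_add_mul_ediv x y
    have hnonneg := Int.emod_nonneg x hy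
    have hlt := Int.emod_lt_abs x hy
    rw [Int.abs_eq_natAbs] at hlt
    rw [mul_comm]
    generalize y * (x / y) = q at *
    omega

/-- Every memory cell holds a number whose charge is at most `b`. -/
def State.BoundedBy (s : State) (b : ℕ) : Prop := ∀ a i, bitCost (s a i) ≤ b

theorem State.BoundedBy.mono {s : State} {b b' : ℕ} (h : s.BoundedBy b) (hb : b ≤ b') :
    s.BoundedBy b' := fun a i => (h a i).trans hb

theorem State.BoundedBy.one_le {s : State} {b : ℕ} (h : s.BoundedBy b) : 1 ≤ b :=
  (one_le_bitCost _).trans (h 0 0)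

theorem State.BoundedBy.write {s : State} {b : ℕ} (h : s.BoundedBy b) (a : ℕ) (i : ℤ) {z : ℤ}
    (hz : bitCost z ≤ b) : (s.write a i z).BoundedBy b := by
  intro a' j
  rcases eq_or_ne a' a with rfl | ha
  · rcases eq_or_ne j i with rfl | hj
    · simpa only [State.write, Function.update_self] using hz
    · simpa only [State.write, Function.update_self, Function.update_of_ne hj] using h a' j
  · simpa only [State.write, Function.update_of_ne ha] using h a' j

namespace Expr

/-- The bit length of the value of `e` exceeds the bit lengths in the memory by at most `C`, and
the cost of `e` is at most `C` times the largest of them. -/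
def TameWith (C : ℕ) (e : Expr) : Prop :=
  ∀ (s : State) (b : ℕ), s.BoundedBy b → bitCost (e.val s) ≤ b + C ∧ e.cost s ≤ C * b

/-- Expressions that increase bit lengths by at most a constant. A product of two arbitrary tame
expressions is not tame, so that repeated multiplication cannot produce numbers of exponential
length. -/
def Tame (e : Expr) : Prop := ∃ C, e.TameWith C

theorem TameWith.mono {C C' : ℕ} {e : Expr} (h : e.TameWith C) (hC : C ≤ C') : e.TameWith C' :=
  fun s b hs => ⟨(h s b hs).1.trans (Nat.add_le_add_left hC b),
    (h s b hs).2.trans (Nat.mul_le_mul_right b hC)⟩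

theorem tame_const (z : ℤ) : (const z).Tame := by
  refine ⟨bitCost z, fun s b hs => ⟨Nat.le_add_left _ _, ?_⟩⟩
  exact Nat.le_mul_of_pos_right _ hs.one_le

theorem Tame.get {i : Expr} (hi : i.Tame) (a : ℕ) : (get a i).Tame := by
  obtain ⟨C, hC⟩ := hi
  refine ⟨1 + C, fun s b hs => ⟨(hs a _).trans (Nat.le_add_right _ _), ?_⟩⟩
  rw [add_mul, one_mul]
  exact add_le_add (hs a _) (hC s b hs).2

theorem tame_of_bitCost_val_le {e e₁ e₂ : Expr} (h₁ : e₁.Tame) (h₂ : e₂.Tame)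
    (hcost : ∀ s, e.cost s = bitCost (e.val s) + e₁.cost s + e₂.cost s)
    (hval : ∃ D, ∀ (s : State) (b : ℕ), s.BoundedBy b → bitCost (e.val s) ≤ b + D) : e.Tame := by
  obtain ⟨C₁, h₁⟩ := h₁
  obtain ⟨C₂, h₂⟩ := h₂
  obtain ⟨D, hD⟩ := hval
  refine ⟨1 + D + C₁ + C₂, fun s b hs => ⟨(hD s b hs).trans (by omega), ?_⟩⟩
  have hb : D ≤ D * b := Nat.le_mul_of_pos_right D hs.one_le
  have hcost₁ := (h₁ s b hs).2
  have hcost₂ := (h₂ s b hs).2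
  have hcost₀ := hD s b hs
  rw [hcost]
  linarith

theorem Tame.exists_bitCost_le_of_natAbs_le_add {e₁ e₂ : Expr} (h₁ : e₁.Tame) (h₂ : e₂.Tame)
    {f : State → ℤ} (hf : ∀ s, (f s).natAbs ≤ (e₁.val s).natAbs + (e₂.val s).natAbs) :
    ∃ D, ∀ (s : State) (b : ℕ), s.BoundedBy b → bitCost (f s) ≤ b + D := by
  obtain ⟨C₁, h₁⟩ := h₁
  obtain ⟨C₂, h₂⟩ := h₂
  refine ⟨C₁ + C₂ + 1, fun s b hs => (bitCost_le_of_natAbs_le_add (hf s)).trans ?_⟩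
  have hval₁ := (h₁ s b hs).1
  have hval₂ := (h₂ s b hs).1
  omega

theorem Tame.add {e₁ e₂ : Expr} (h₁ : e₁.Tame) (h₂ : e₂.Tame) : (add e₁ e₂).Tame :=
  tame_of_bitCost_val_le h₁ h₂ (fun _ => rfl)
    (h₁.exists_bitCost_le_of_natAbs_le_add h₂ fun _ => Int.natAbs_add_le _ _)

theorem Tame.sub {e₁ e₂ : Expr} (h₁ : e₁.Tame) (h₂ : e₂.Tame) : (sub e₁ e₂).Tame :=
  tame_of_bitCost_val_le h₁ h₂ (fun _ => rfl)
    (h₁.exists_bitCost_le_of_natAbs_le_add h₂ fun _ => Int.natAbs_sub_le _ _)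

theorem Tame.div {e₁ e₂ : Expr} (h₁ : e₁.Tame) (h₂ : e₂.Tame) : (div e₁ e₂).Tame :=
  tame_of_bitCost_val_le h₁ h₂ (fun _ => rfl) <|
    h₁.exists_bitCost_le_of_natAbs_le_add h₂ fun s => by
      have hdiv := Int.abs_ediv_le_abs (e₁.val s) (e₂.val s)
      rw [Int.abs_eq_natAbs, Int.abs_eq_natAbs] at hdiv
      simp only [val]
      omega

theorem Tame.div_mul_self {e₁ e₂ : Expr} (h₁ : e₁.Tame) (h₂ : e₂.Tame) :
    (mul (.div e₁ e₂) e₂).Tame :=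
  tame_of_bitCost_val_le (h₁.div h₂) h₂ (fun _ => rfl)
    (h₁.exists_bitCost_le_of_natAbs_le_add h₂ fun _ => natAbs_ediv_mul_self_le _ _)

theorem Tame.mul_of_natAbs_le {e₁ e₂ : Expr} (h₁ : e₁.Tame) (h₂ : e₂.Tame) (D : ℕ)
    (hD : ∀ s, (e₁.val s).natAbs ≤ D) : (mul e₁ e₂).Tame := by
  refine tame_of_bitCost_val_le h₁ h₂ (fun _ => rfl) ?_
  obtain ⟨C₂, h₂⟩ := h₂
  refine ⟨bitCost D + C₂, fun s b hs => (bitCost_mul_le _ _).trans ?_⟩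
  have hval₁ : bitCost (e₁.val s) ≤ bitCost D := bitCost_le_of_natAbs_le (hD s)
  have hval₂ := (h₂ s b hs).1
  omega

theorem Tame.const_mul {e : Expr} (h : e.Tame) (z : ℤ) : (mul (const z) e).Tame :=
  .mul_of_natAbs_le (tame_const z) h z.natAbs fun _ => le_rfl

/-- The remainder of a division. -/
def mod (e₁ e₂ : Expr) : Expr := .sub e₁ (.mul (.div e₁ e₂) e₂)

theorem val_mod (s : State) (e₁ e₂ : Expr) : (e₁.mod e₂).val s = e₁.val s % e₂.val s := by
  simp only [mod, val]
  rw [Int.emod_def, mul_comm]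

theorem Tame.mod {e₁ e₂ : Expr} (h₁ : e₁.Tame) (h₂ : e₂.Tame) : (e₁.mod e₂).Tame :=
  h₁.sub (h₁.div_mul_self h₂)

/-- The scalar variable stored in cell `0` of array `a`. -/
def var (a : ℕ) : Expr := .get a (.const 0)

theorem val_var (s : State) (a : ℕ) : (var a).val s = s a 0 := rfl

theorem tame_var (a : ℕ) : (var a).Tame := (tame_const 0).get a

end Expr

namespace Prog

/-- All expressions occurring in a program satisfy `p`. -/
def ForallExpr (p : Expr → Prop) : Prog → Prop
  | .skip => True
  | .store _ i e => p i ∧ p e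
  | .seq c₁ c₂ => c₁.ForallExpr p ∧ c₂.ForallExpr p
  | .branch e c₁ c₂ => p e ∧ c₁.ForallExpr p ∧ c₂.ForallExpr p
  | .loop e c => p e ∧ c.ForallExpr p

theorem ForallExpr.imp {p q : Expr → Prop} (h : ∀ e, p e → q e) :
    ∀ {c : Prog}, c.ForallExpr p → c.ForallExpr q
  | .skip, _ => trivial
  | .store _ _ _, hc => ⟨h _ hc.1, h _ hc.2⟩
  | .seq _ _, hc => ⟨hc.1.imp h, hc.2.imp h⟩
  | .branch _ _ _, hc => ⟨h _ hc.1, hc.2.1.imp h, hc.2.2.imp h⟩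
  | .loop _ _, hc => ⟨h _ hc.1, hc.2.imp h⟩

theorem ForallExpr.exists_tameWith {c : Prog} (h : c.ForallExpr Expr.Tame) :
    ∃ C, 1 ≤ C ∧ c.ForallExpr (Expr.TameWith C) := by
  have mono {C C' : ℕ} (hC : C ≤ C') (e : Expr) (he : e.TameWith C) : e.TameWith C' := he.mono hC
  induction c with
  | skip => exact ⟨1, le_rfl, trivial⟩
  | store a i e =>
    obtain ⟨⟨C₁, h₁⟩, ⟨C₂, h₂⟩⟩ := h
    exact ⟨C₁ + C₂ + 1, by omega, h₁.mono (by omega), h₂.mono (by omega)⟩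
  | seq c₁ c₂ ih₁ ih₂ =>
    obtain ⟨C₁, hC₁, h₁⟩ := ih₁ h.1
    obtain ⟨C₂, _, h₂⟩ := ih₂ h.2
    exact ⟨C₁ + C₂, by omega, h₁.imp (mono (by omega)), h₂.imp (mono (by omega))⟩
  | branch e c₁ c₂ ih₁ ih₂ =>
    obtain ⟨C₀, h₀⟩ := h.1
    obtain ⟨C₁, hC₁, h₁⟩ := ih₁ h.2.1
    obtain ⟨C₂, _, h₂⟩ := ih₂ h.2.2
    exact ⟨C₀ + C₁ + C₂, by omega, h₀.mono (by omega), h₁.imp (mono (by omega)),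
      h₂.imp (mono (by omega))⟩
  | loop e c ih =>
    obtain ⟨C₀, h₀⟩ := h.1
    obtain ⟨C₁, hC₁, h₁⟩ := ih h.2
    exact ⟨C₀ + C₁, by omega, h₀.mono (by omega), h₁.imp (mono (by omega))⟩

end Prog

/-- `Steps c s k s'`: the program `c`, started in the memory `s`, halts in the memory `s'` after
`k` steps, where evaluating an expression is free. -/
inductive Steps : Prog → State → ℕ → State → Prop
  | skip (s : State) : Steps .skip s 1 s
  | store (s : State) (a : ℕ) (i e : Expr) :
      Steps (.store a i e) s 1 (s.write a (i.val s) (e.val s))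
  | seq {c₁ c₂ : Prog} {s s' s'' : State} {t t' : ℕ} :
      Steps c₁ s t s' → Steps c₂ s' t' s'' → Steps (.seq c₁ c₂) s (t + t' + 1) s''
  | branch_pos {e : Expr} {c₁ c₂ : Prog} {s s' : State} {t : ℕ} :
      0 < e.val s → Steps c₁ s t s' → Steps (.branch e c₁ c₂) s (t + 1) s'
  | branch_neg {e : Expr} {c₁ c₂ : Prog} {s s' : State} {t : ℕ} :
      ¬ 0 < e.val s → Steps c₂ s t s' → Steps (.branch e c₁ c₂) s (t + 1) s'
  | loop_done {e : Expr} {c : Prog} {s : State} :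
      ¬ 0 < e.val s → Steps (.loop e c) s 1 s
  | loop_step {e : Expr} {c : Prog} {s s' s'' : State} {t t' : ℕ} :
      0 < e.val s → Steps c s t s' → Steps (.loop e c) s' t' s'' →
        Steps (.loop e c) s (t + t' + 1) s''

/-- Each step increases the bit lengths in the memory by at most `C`, so along `k` steps no
expression costs more than `C * m` with `m = b + k * C`. -/
theorem Steps.exists_exec {C : ℕ} (hC : 1 ≤ C) {c : Prog} {s s' : State} {k : ℕ}
    (h : Steps c s k s') (hc : c.ForallExpr (Expr.TameWith C)) {b m : ℕ} (hs : s.BoundedBy b)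
    (hm : b + k * C ≤ m) :
    s'.BoundedBy (b + k * C) ∧ ∃ t ≤ k * (3 * (C * m)), Exec c s t s' := by
  have one_le {s : State} {b : ℕ} (hs : s.BoundedBy b) (hbm : b ≤ m) : 1 ≤ C * m :=
    Nat.mul_pos hC (hs.one_le.trans hbm)
  have cost_le {e : Expr} (he : e.TameWith C) {s : State} {b : ℕ} (hs : s.BoundedBy b)
      (hbm : b ≤ m) : 1 ≤ C * m ∧ e.cost s ≤ C * m :=
    ⟨one_le hs hbm, (he s b hs).2.trans (Nat.mul_le_mul_left C hbm)⟩
  induction h generalizing b with simp only [add_mul, one_mul] at hm ⊢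
  | skip s =>
    exact ⟨hs.mono (by omega), 1, (one_le hs (by omega)).trans (by omega), .skip s⟩
  | store s a i e =>
    have hi := cost_le hc.1 hs (by omega)
    have he := cost_le hc.2 hs (by omega)
    exact ⟨(hs.mono (by omega)).write _ _ (hc.2 s b hs).1, _, by omega, .store s a i e⟩
  | seq _ _ ih₁ ih₂ =>
    have hone := one_le hs (by omega)
    obtain ⟨b₁, t₁, ht₁, x₁⟩ := ih₁ hc.1 hs (by omega)
    obtain ⟨b₂, t₂, ht₂, x₂⟩ := ih₂ hc.2 b₁ (by omega)
    exact ⟨b₂.mono (by omega), _, by omega, .seq x₁ x₂⟩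
  | branch_pos he _ ih =>
    have hcost := cost_le hc.1 hs (by omega)
    obtain ⟨b₁, t₁, ht₁, x₁⟩ := ih hc.2.1 hs (by omega)
    exact ⟨b₁.mono (by omega), _, by omega, .branch_pos he x₁⟩
  | branch_neg he _ ih =>
    have hcost := cost_le hc.1 hs (by omega)
    obtain ⟨b₁, t₁, ht₁, x₁⟩ := ih hc.2.2 hs (by omega)
    exact ⟨b₁.mono (by omega), _, by omega, .branch_neg he x₁⟩
  | loop_done he =>
    have hcost := cost_le hc.1 hs (by omega)
    exact ⟨hs.mono (by omega), _, by omega, .loop_done he⟩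
  | loop_step he _ _ ih₁ ih₂ =>
    have hcost := cost_le hc.1 hs (by omega)
    obtain ⟨b₁, t₁, ht₁, x₁⟩ := ih₁ hc.2 hs (by omega)
    obtain ⟨b₂, t₂, ht₂, x₂⟩ := ih₂ hc b₁ (by omega)
    exact ⟨b₂.mono (by omega), _, by omega, .loop_step he x₁ x₂⟩

/-! ## Total correctness with step counts -/

/-- The arrays addressed by the stores of a program. -/
def Prog.writes : Prog → Finset ℕ
  | .skip => ∅
  | .store a _ _ => {a}
  | .seq c₁ c₂ => c₁.writes ∪ c₂.writes
  | .branch _ c₁ c₂ => c₁.writes ∪ c₂.writes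
  | .loop _ c => c.writes

theorem State.write_of_ne {a b : ℕ} (h : b ≠ a) (s : State) (i z : ℤ) : s.write a i z b = s b :=
  Function.update_of_ne h _ _

theorem State.write_self (s : State) (a : ℕ) (i z : ℤ) :
    s.write a i z a = Function.update (s a) i z :=
  Function.update_self _ _ _

theorem Steps.eq_of_notMem_writes {c : Prog} {s s' : State} {k : ℕ} (h : Steps c s k s') {a : ℕ}
    (ha : a ∉ c.writes) : s' a = s a := by
  induction h with simp only [Prog.writes, Finset.mem_union, Finset.mem_singleton, not_or] at ha
  | skip s => rfl
  | store s b i e => exact State.write_of_ne ha _ _ _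
  | seq _ _ ih₁ ih₂ => exact (ih₂ ha.2).trans (ih₁ ha.1)
  | branch_pos _ _ ih => exact ih ha.1
  | branch_neg _ _ ih => exact ih ha.2
  | loop_done _ => rfl
  | loop_step _ _ _ ih₁ ih₂ => exact (ih₂ ha).trans (ih₁ ha)

/-- Started in `s`, the program `c` halts after at most `k` steps in a memory with property `Q`. -/
def Runs (c : Prog) (s : State) (k : ℕ) (Q : State → Prop) : Prop :=
  ∃ t ≤ k, ∃ s', Steps c s t s' ∧ Q s'

theorem Runs.mono {c : Prog} {s : State} {k k' : ℕ} {Q Q' : State → Prop} (h : Runs c s k Q)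
    (hk : k ≤ k') (hQ : ∀ s', (∀ a ∉ c.writes, s' a = s a) → Q s' → Q' s') :
    Runs c s k' Q' := by
  obtain ⟨t, ht, s', hs, hq⟩ := h
  exact ⟨t, ht.trans hk, s', hs, hQ s' (fun _ ha => hs.eq_of_notMem_writes ha) hq⟩

theorem Runs.mono_steps {c : Prog} {s : State} {k k' : ℕ} {Q : State → Prop} (h : Runs c s k Q)
    (hk : k ≤ k') : Runs c s k' Q :=
  h.mono hk fun _ _ hq => hq

theorem Runs.imp {c : Prog} {s : State} {k : ℕ} {Q Q' : State → Prop} (h : Runs c s k Q)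
    (hQ : ∀ s', (∀ a ∉ c.writes, s' a = s a) → Q s' → Q' s') : Runs c s k Q' :=
  h.mono le_rfl hQ

theorem Runs.skip {s : State} {Q : State → Prop} (h : Q s) : Runs .skip s 1 Q :=
  ⟨1, le_rfl, s, .skip s, h⟩

theorem Runs.store {s : State} {Q : State → Prop} {a : ℕ} {i e : Expr}
    (h : Q (s.write a (i.val s) (e.val s))) : Runs (.store a i e) s 1 Q :=
  ⟨1, le_rfl, _, .store s a i e, h⟩

/-- The assignment of a scalar variable. -/
def Prog.set (a : ℕ) (e : Expr) : Prog := .store a (.const 0) e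

theorem Runs.set {s : State} {Q : State → Prop} {a : ℕ} {e : Expr}
    (h : Q (s.write a 0 (e.val s))) : Runs (.set a e) s 1 Q :=
  Runs.store h

theorem Runs.seq {s : State} {Q : State → Prop} {c₁ c₂ : Prog} {k₁ k₂ : ℕ}
    (h : Runs c₁ s k₁ (fun s' => Runs c₂ s' k₂ Q)) : Runs (.seq c₁ c₂) s (k₁ + k₂ + 1) Q := by
  obtain ⟨t, ht, s', hs, t', ht', s'', hs', hq⟩ := h
  exact ⟨t + t' + 1, by omega, s'', .seq hs hs', hq⟩

theorem Runs.branch {s : State} {Q : State → Prop} {e : Expr} {c₁ c₂ : Prog} {k : ℕ}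
    (h₁ : 0 < e.val s → Runs c₁ s k Q) (h₂ : ¬ 0 < e.val s → Runs c₂ s k Q) :
    Runs (.branch e c₁ c₂) s (k + 1) Q := by
  by_cases he : 0 < e.val s
  · obtain ⟨t, ht, s', hs, hq⟩ := h₁ he
    exact ⟨t + 1, by omega, s', .branch_pos he hs, hq⟩
  · obtain ⟨t, ht, s', hs, hq⟩ := h₂ he
    exact ⟨t + 1, by omega, s', .branch_neg he hs, hq⟩

theorem Runs.loop {e : Expr} {c : Prog} {k : ℕ} (N : ℕ) (Inv : ℕ → State → Prop)
    (hstep : ∀ j < N, ∀ s, Inv j s → 0 < e.val s ∧ Runs c s k (Inv (j + 1)))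
    (hend : ∀ s, Inv N s → ¬ 0 < e.val s) {s : State} (h0 : Inv 0 s) :
    Runs (.loop e c) s (N * (k + 1) + 1) (Inv N) := by
  suffices key : ∀ m j, j + m = N → ∀ s, Inv j s →
      Runs (.loop e c) s (m * (k + 1) + 1) (Inv N) from key N 0 (by omega) s h0
  intro m
  induction m with
  | zero =>
    intro j hj s hs
    obtain rfl : j = N := by omega
    exact ⟨1, by omega, s, .loop_done (hend s hs), hs⟩
  | succ m ih =>
    intro j hj s hs
    obtain ⟨he, t, ht, s', hs', hInv⟩ := hstep j (by omega) s hs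
    obtain ⟨t', ht', s'', hs'', hInv'⟩ := ih (j + 1) (by omega) s' hInv
    refine ⟨t + t' + 1, ?_, s'', .loop_step he hs' hs'', hInv'⟩
    rw [add_mul, one_mul]
    omega

/-- `for v = 0, …, N - 1 do c`, where `N` is the value of the scalar variable `b`. -/
def Prog.for (v b : ℕ) (c : Prog) : Prog :=
  .seq (.set v (.const 0))
    (.loop (.sub (.var b) (.var v))
      (.seq c (.set v (.add (.var v) (.const 1)))))

theorem Prog.writes_for (v b : ℕ) (c : Prog) : (Prog.for v b c).writes = insert v c.writes := by
  ext a
  simp only [Prog.for, Prog.set, Prog.writes, Finset.mem_union, Finset.mem_singleton,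
    Finset.mem_insert]
  tauto

theorem Runs.for {v b : ℕ} {c : Prog} {s : State} {N k : ℕ} (Inv : ℕ → State → Prop)
    (hN : s b 0 = N) (hvb : b ≠ v) (hb : b ∉ c.writes) (hv : v ∉ c.writes)
    (h0 : Inv 0 (s.write v 0 0))
    (hstep : ∀ j < N, ∀ s', (∀ a ∉ (Prog.for v b c).writes, s' a = s a) → s' v 0 = (j : ℤ) →
      Inv j s' → Runs c s' k (fun s'' => Inv (j + 1) (s''.write v 0 (j + 1)))) :
    Runs (.for v b c) s (N * (k + 3) + 3) (Inv N) := by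
  have hwrites {a : ℕ} : a ∉ (Prog.for v b c).writes ↔ a ≠ v ∧ a ∉ c.writes := by
    rw [Prog.writes_for, Finset.mem_insert, not_or]
  have htest {j : ℕ} {s' : State} (hfr : ∀ a ∉ (Prog.for v b c).writes, s' a = s a)
      (hj : s' v 0 = j) : (Expr.sub (.var b) (.var v)).val s' = N - j := by
    simp only [Expr.val, Expr.val_var, hj, hfr b (hwrites.2 ⟨hvb, hb⟩), hN]
  have hloop := Runs.loop (e := .sub (.var b) (.var v))
    (c := .seq c (.set v (.add (.var v) (.const 1)))) (k := k + 1 + 1) N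
    (fun j s' => (∀ a ∉ (Prog.for v b c).writes, s' a = s a) ∧ s' v 0 = (j : ℤ) ∧ Inv j s') ?_ ?_
    (s := s.write v 0 0) ⟨fun a ha => State.write_of_ne (hwrites.1 ha).1 _ _ _, ?_, h0⟩
  · refine (Runs.seq (Runs.set hloop)).mono ?_ fun s' _ h => h.2.2
    rw [show k + 1 + 1 + 1 = k + 3 by ring]
    omega
  · rintro j hj s' ⟨hfr, hjv, hinv⟩
    refine ⟨by rw [htest hfr hjv]; omega, Runs.seq ((hstep j hj s' hfr hjv hinv).imp ?_)⟩
    intro s'' hfr' hinv'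
    have hjv' : (Expr.add (.var v) (.const 1)).val s'' = j + 1 := by
      simp only [Expr.val, Expr.val_var, hfr' v hv, hjv]
    refine Runs.set ⟨fun a ha => ?_, ?_, ?_⟩
    · rw [State.write_of_ne (hwrites.1 ha).1, hfr' a (hwrites.1 ha).2, hfr a ha]
    · rw [State.write_self, hjv']
      exact Function.update_self _ _ _
    · simpa only [hjv'] using hinv'
  · rintro s' ⟨hfr, hjv, -⟩
    rw [htest hfr hjv, sub_self]
    exact lt_irrefl 0
  · rw [State.write_self, Function.update_self]
    rfl

/-- `f` is bounded by a polynomial with natural coefficients. -/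
@[fun_prop]
def PolyBounded (f : ℕ → ℕ) : Prop := ∃ P : Polynomial ℕ, ∀ n, f n ≤ P.eval n

theorem eval_monotone (P : Polynomial ℕ) : Monotone fun n => P.eval n := fun a b hab => by
  simp only [Polynomial.eval_eq_sum, Polynomial.sum]
  exact Finset.sum_le_sum fun i _ => Nat.mul_le_mul_left _ (Nat.pow_le_pow_left hab i)

@[fun_prop]
theorem polyBounded_const (c : ℕ) : PolyBounded fun _ => c := ⟨.C c, fun n => by simp⟩

@[fun_prop]
theorem polyBounded_id : PolyBounded fun n => n := ⟨.X, fun n => by simp⟩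

@[fun_prop]
theorem PolyBounded.add {f g : ℕ → ℕ} (hf : PolyBounded f) (hg : PolyBounded g) :
    PolyBounded fun n => f n + g n := by
  obtain ⟨P, hP⟩ := hf
  obtain ⟨Q, hQ⟩ := hg
  exact ⟨P + Q, fun n => by rw [Polynomial.eval_add]; exact add_le_add (hP n) (hQ n)⟩

@[fun_prop]
theorem PolyBounded.mul {f g : ℕ → ℕ} (hf : PolyBounded f) (hg : PolyBounded g) :
    PolyBounded fun n => f n * g n := by
  obtain ⟨P, hP⟩ := hf
  obtain ⟨Q, hQ⟩ := hg
  exact ⟨P * Q, fun n => by rw [Polynomial.eval_mul]; exact Nat.mul_le_mul (hP n) (hQ n)⟩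

@[fun_prop]
theorem PolyBounded.pow {f : ℕ → ℕ} (hf : PolyBounded f) (k : ℕ) :
    PolyBounded fun n => f n ^ k := by
  obtain ⟨P, hP⟩ := hf
  exact ⟨P ^ k, fun n => by rw [Polynomial.eval_pow]; exact Nat.pow_le_pow_left (hP n) k⟩

end RAM

namespace RAM

open Finset Matrix

/-! ## The clause table in the memory -/

/-- The array of the input list. -/
@[simp] abbrev Reg.input : ℕ := 0

/-- The variable with the length of the input list. -/
@[simp] abbrev Reg.length : ℕ := 1

/-- The variable with the number `n` of variables of the instance. -/
@[simp] abbrev Reg.numVars : ℕ := 2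

/-- The variable with the number `8 * n ^ 3` of potential clauses. -/
@[simp] abbrev Reg.tableSize : ℕ := 3

/-- The variable with `n ^ 3`. -/
@[simp] abbrev Reg.cube : ℕ := 4

/-- The variable with `n ^ 2`. -/
@[simp] abbrev Reg.square : ℕ := 5

/-- The variable with the position of the current clause in the table. -/
@[simp] abbrev Reg.clause : ℕ := 11

section Vector

variable {n : ℕ}

/-- The array with the entries of `x` in the cells `0, …, n - 1` and zeros elsewhere. -/
def vecArray (x : Fin n → ℤ) : ℤ → ℤ := fun z =>
  if h : 0 ≤ z ∧ z < n then x ⟨z.toNat, by omega⟩ else 0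

theorem vecArray_apply (x : Fin n → ℤ) (i : Fin n) : vecArray x (i : ℕ) = x i :=
  dif_pos ⟨by omega, by omega⟩

theorem vecArray_zero : vecArray (0 : Fin n → ℤ) = 0 := by
  funext z
  simp [vecArray]

theorem update_vecArray (x : Fin n → ℤ) (i : Fin n) (y : ℤ) :
    Function.update (vecArray x) (i : ℕ) y = vecArray (Function.update x i y) := by
  funext z
  by_cases hz : 0 ≤ z ∧ z < n
  · lift z to ℕ using hz.1
    obtain ⟨j, rfl⟩ : ∃ j : Fin n, (j : ℕ) = z := ⟨⟨z, by omega⟩, rfl⟩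
    simp only [vecArray_apply, Function.update_apply, Nat.cast_inj, Fin.ext_iff]
  · rw [Function.update_of_ne (by omega), vecArray, vecArray, dif_neg hz, dif_neg hz]

theorem update_vecArray_add (x : Fin n → ℤ) (i : Fin n) (y : ℤ) :
    Function.update (vecArray x) (i : ℕ) (vecArray x (i : ℕ) + y) =
      vecArray (x + Pi.single i y) := by
  rw [vecArray_apply, update_vecArray]
  congr 1
  funext j
  rcases eq_or_ne j i with rfl | hj
  · simp
  · simp [hj]

/-- The vector `v` with the first `j` entries replaced by those of `u`: the state of a loop that
overwrites `v` by `u`. -/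
def blend (j : ℕ) (u v : Fin n → ℤ) : Fin n → ℤ := fun i => if i < j then u i else v i

theorem blend_zero (u v : Fin n → ℤ) : blend 0 u v = v := by
  funext i
  simp [blend]

theorem blend_self (u v : Fin n → ℤ) : blend n u v = u := by
  funext i
  simp [blend]

theorem vecArray_blend_apply (u v : Fin n → ℤ) {j : ℕ} (hj : j < n) :
    vecArray (blend j u v) j = v ⟨j, hj⟩ := by
  rw [vecArray_apply _ ⟨j, hj⟩, blend, if_neg (lt_irrefl _)]

theorem update_vecArray_blend (u v : Fin n → ℤ) {j : ℕ} (hj : j < n) :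
    Function.update (vecArray (blend j u v)) j (u ⟨j, hj⟩) = vecArray (blend (j + 1) u v) := by
  rw [update_vecArray _ ⟨j, hj⟩]
  congr 1
  funext i
  rcases eq_or_ne i ⟨j, hj⟩ with rfl | hi
  · simp [blend]
  · rw [Function.update_of_ne hi]
    simp only [blend, Nat.lt_succ_iff_lt_or_eq, Fin.val_ne_of_ne hi, or_false]

end Vector

section ClauseIndex

variable {n : ℕ}

theorem clauseAt_injective (n : ℕ) : Function.Injective (clauseAt n) := by
  intro j j' h
  have hsign : Function.Injective fun d : Fin 2 => if d = 0 then (1 : ℤˣ) else -1 := by decide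
  have hdiv : j.divNat = j'.divNat := finFunctionFinEquiv.symm.injective <|
    funext fun i => hsign (congrFun (congrArg Prod.fst h) i)
  have hmod : j.modNat = j'.modNat :=
    finFunctionFinEquiv.symm.injective (congrArg Prod.snd h)
  exact finProdFinEquiv.symm.injective (Prod.ext hdiv hmod)

/-- The enumeration of the potential clauses as a bijection. -/
noncomputable def clauseEquiv (n : ℕ) : Fin (2 ^ 3 * n ^ 3) ≃ Clause 3 n :=
  Equiv.ofBijective (clauseAt n) ((Fintype.bijective_iff_injective_and_card _).2
    ⟨clauseAt_injective n, by simp [Clause, Fintype.card_prod, Fintype.card_units_int]⟩)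

/-- The position of a clause in the table. -/
noncomputable def clauseIndex (e : Clause 3 n) : ℕ := ((clauseEquiv n).symm e : ℕ)

theorem clauseIndex_lt (e : Clause 3 n) : clauseIndex e < 8 * n ^ 3 :=
  ((clauseEquiv n).symm e).isLt

theorem clauseAt_clauseEquiv_symm (e : Clause 3 n) : clauseAt n ((clauseEquiv n).symm e) = e :=
  (clauseEquiv n).apply_symm_apply e

theorem exists_clauseIndex_eq {j : ℕ} (hj : j < 8 * n ^ 3) :
    ∃ e : Clause 3 n, clauseIndex e = j :=
  ⟨clauseEquiv n ⟨j, hj⟩, by simp [clauseIndex]⟩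

theorem clauseIndex_injective : Function.Injective (clauseIndex (n := n)) :=
  Fin.val_injective.comp (clauseEquiv n).symm.injective

theorem filter_clauseIndex_lt_succ (I : SignedHypergraph 3 n) (e : Clause 3 n) :
    ({e' ∈ I | clauseIndex e' < clauseIndex e + 1} : SignedHypergraph 3 n) =
      if e ∈ I then insert e {e' ∈ I | clauseIndex e' < clauseIndex e}
      else {e' ∈ I | clauseIndex e' < clauseIndex e} := by
  ext e'
  have heq : clauseIndex e' = clauseIndex e ↔ e' = e := clauseIndex_injective.eq_iff
  split_ifs with he <;> simp only [mem_filter, mem_insert, Nat.lt_succ_iff_lt_or_eq, heq] <;>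
    grind

theorem snd_eq_clauseIndex (e : Clause 3 n) (a : Fin 3) :
    ((e.2 a : ℕ) : ℤ) = (clauseIndex e : ℤ) % (n : ℤ) ^ 3 / (n : ℤ) ^ (a : ℕ) % n := by
  conv_lhs => rw [← clauseAt_clauseEquiv_symm e, clauseAt, finFunctionFinEquiv_symm_apply_val]
  push_cast
  rfl

theorem fst_eq_clauseIndex (e : Clause 3 n) (a : Fin 3) :
    ((e.1 a : ℤˣ) : ℤ) = 1 - 2 * ((clauseIndex e : ℤ) / (n : ℤ) ^ 3 / 2 ^ (a : ℕ) % 2) := by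
  have hdigit : (clauseIndex e : ℤ) / (n : ℤ) ^ 3 / 2 ^ (a : ℕ) % 2 =
      ((finFunctionFinEquiv.symm ((clauseEquiv n).symm e).divNat a : Fin 2) : ℕ) := by
    rw [finFunctionFinEquiv_symm_apply_val]
    push_cast
    rfl
  have hsign (d : Fin 2) : (((if d = 0 then 1 else -1 : ℤˣ) : ℤˣ) : ℤ) = 1 - 2 * (d : ℕ) := by
    revert d
    decide
  rw [hdigit, ← hsign]
  conv_lhs => rw [← clauseAt_clauseEquiv_symm e, clauseAt]

end ClauseIndex

/-- The `a`-th vertex of the current clause. -/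
def vertexExpr (a : Fin 3) : Expr :=
  (Expr.div ((Expr.var Reg.clause).mod (.var Reg.cube))
    (![.const 1, .var Reg.numVars, .var Reg.square] a)).mod (.var Reg.numVars)

/-- The `a`-th sign of the current clause. -/
def signExpr (a : Fin 3) : Expr :=
  .sub (.const 1) (.mul (.const 2)
    ((Expr.div (.div (.var Reg.clause) (.var Reg.cube)) (.const (2 ^ (a : ℕ)))).mod (.const 2)))

/-- The product of the signs of the current clause at the positions in `l`. -/
def signProdExpr (l : List (Fin 3)) : Expr :=
  l.foldr (fun a e => .mul (signExpr a) e) (.const 1)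

theorem tame_vertexExpr (a : Fin 3) : (vertexExpr a).Tame := by
  refine Expr.Tame.mod (.div (.mod (Expr.tame_var _) (Expr.tame_var _)) ?_) (Expr.tame_var _)
  fin_cases a
  exacts [Expr.tame_const _, Expr.tame_var _, Expr.tame_var _]

theorem tame_signExpr (a : Fin 3) : (signExpr a).Tame :=
  .sub (Expr.tame_const _) (.const_mul (.mod
    (.div (.div (Expr.tame_var _) (Expr.tame_var _)) (Expr.tame_const _)) (Expr.tame_const _)) _)

theorem natAbs_signExpr_le (s : State) (a : Fin 3) : ((signExpr a).val s).natAbs ≤ 1 := by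
  simp only [signExpr, Expr.val, Expr.val_mod]
  omega

theorem tame_signProdExpr (l : List (Fin 3)) : (signProdExpr l).Tame := by
  induction l with
  | nil => exact Expr.tame_const 1
  | cons a l ih => exact .mul_of_natAbs_le (tame_signExpr a) ih 1 (natAbs_signExpr_le · a)

theorem natAbs_signProdExpr_le (l : List (Fin 3)) (s : State) :
    ((signProdExpr l).val s).natAbs ≤ 1 := by
  induction l with
  | nil => simp [signProdExpr, Expr.val]
  | cons a l ih =>
    change ((signExpr a).val s * (signProdExpr l).val s).natAbs ≤ 1
    rw [Int.natAbs_mul]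
    exact Nat.mul_le_mul (natAbs_signExpr_le s a) ih

/-- The arrays which hold the instance and the numbers computed from its size. -/
def instanceRegs : Finset ℕ := {Reg.input, Reg.numVars, Reg.tableSize, Reg.cube, Reg.square}

/-- The memory holds the membership table of the instance and the numbers computed from its
size. -/
structure Ready (n : ℕ) (I : SignedHypergraph 3 n) (s : State) : Prop where
  table : ∀ e : Clause 3 n, s Reg.input (clauseIndex e + 1) = if e ∈ I then 1 else 0
  numVars : s Reg.numVars 0 = n
  tableSize : s Reg.tableSize 0 = (8 * n ^ 3 : ℕ)
  cube : s Reg.cube 0 = (n : ℤ) ^ 3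
  square : s Reg.square 0 = (n : ℤ) ^ 2

namespace Ready

variable {n : ℕ} {I : SignedHypergraph 3 n} {s : State}

theorem congr_of_disjoint {s' : State} {W : Finset ℕ} (h : Ready n I s)
    (hW : Disjoint instanceRegs W) (hs' : ∀ a ∉ W, s' a = s a) : Ready n I s' := by
  have heq {a : ℕ} (ha : a ∈ instanceRegs) : s' a = s a := hs' a (disjoint_left.1 hW ha)
  constructor
  · simpa only [heq (by decide : Reg.input ∈ instanceRegs)] using h.table
  · rw [heq (by decide), h.numVars]
  · rw [heq (by decide), h.tableSize]
  · rw [heq (by decide), h.cube]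
  · rw [heq (by decide), h.square]

theorem write (h : Ready n I s) {a : ℕ} (ha : a ∉ instanceRegs) (i z : ℤ) :
    Ready n I (s.write a i z) :=
  h.congr_of_disjoint (disjoint_singleton_right.2 ha) fun _ hb =>
    State.write_of_ne (notMem_singleton.1 hb) _ _ _

theorem val_vertexExpr (h : Ready n I s) {e : Clause 3 n} (he : s Reg.clause 0 = clauseIndex e)
    (a : Fin 3) : (vertexExpr a).val s = (e.2 a : ℕ) := by
  rw [snd_eq_clauseIndex]
  fin_cases a <;>
    simp [vertexExpr, Expr.val, Expr.val_mod, Expr.val_var, he, h.numVars, h.cube, h.square]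

theorem val_signExpr (h : Ready n I s) {e : Clause 3 n} (he : s Reg.clause 0 = clauseIndex e)
    (a : Fin 3) : (signExpr a).val s = ((e.1 a : ℤˣ) : ℤ) := by
  rw [fst_eq_clauseIndex]
  simp only [signExpr, Expr.val, Expr.val_mod, Expr.val_var, he, h.cube]

theorem val_signProdExpr (h : Ready n I s) {e : Clause 3 n} (he : s Reg.clause 0 = clauseIndex e)
    (f : SignForm) : (signProdExpr f.signs).val s = f.sign e := by
  rw [SignForm.sign]
  induction f.signs with
  | nil => rfl
  | cons a l ih =>
    change (signExpr a).val s * (signProdExpr l).val s = _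
    rw [ih, h.val_signExpr he, List.map_cons, List.prod_cons]

end Ready

/-- Run `c` for every clause of the instance. -/
def Prog.forClauses (c : Prog) : Prog :=
  .for Reg.clause Reg.tableSize
    (.branch (.get Reg.input (.add (.var Reg.clause) (.const 1))) c .skip)

theorem Prog.writes_forClauses (c : Prog) : c.forClauses.writes = insert Reg.clause c.writes := by
  rw [forClauses, writes_for, writes, writes, union_empty]

theorem Runs.forClauses {n : ℕ} {I : SignedHypergraph 3 n} {s : State} {c : Prog} {k : ℕ}
    (hs : Ready n I s) (P : SignedHypergraph 3 n → State → Prop)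
    (hc : Disjoint instanceRegs c.writes) (hclause : Reg.clause ∉ c.writes)
    (h0 : P ∅ (s.write Reg.clause 0 0))
    (hP : ∀ J s' z, P J s' → P J (s'.write Reg.clause 0 z))
    (hstep : ∀ J, ∀ e ∉ J, ∀ s', Ready n I s' → s' Reg.clause 0 = clauseIndex e → P J s' →
      Runs c s' (k + 1)
        (fun s'' => P (insert e J) (s''.write Reg.clause 0 (clauseIndex e + 1)))) :
    Runs c.forClauses s (8 * n ^ 3 * (k + 5) + 3) (P I) := by
  have hwrites : (Prog.branch (.get Reg.input (.add (.var Reg.clause) (.const 1))) c .skip).writes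
      = c.writes := union_empty _
  refine (Runs.for (k := k + 1 + 1) (fun j s' => P {e ∈ I | clauseIndex e < j} s') hs.tableSize
    (by decide) ?_ ?_ (by simpa using h0) ?_).imp fun s' _ hs' => ?_
  · rw [hwrites]
    exact disjoint_left.1 hc (by decide)
  · rwa [hwrites]
  · intro j hj s' hfr hj' hPj
    obtain ⟨e, rfl⟩ := exists_clauseIndex_eq hj
    have hready : Ready n I s' := hs.congr_of_disjoint (W := c.forClauses.writes)
      (by rw [Prog.writes_forClauses]; exact disjoint_insert_right.2 ⟨by decide, hc⟩) hfr
    have hval : (Expr.get Reg.input (.add (.var Reg.clause) (.const 1))).val s' =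
        if e ∈ I then 1 else 0 := by
      simp only [← hready.table e, Expr.val, Expr.val_var, hj']
    by_cases he : e ∈ I
    · rw [if_pos he] at hval
      rw [filter_clauseIndex_lt_succ, if_pos he]
      exact Runs.branch (fun _ => hstep _ e (by simp) s' hready hj' hPj) fun h => by omega
    · rw [if_neg he] at hval
      rw [filter_clauseIndex_lt_succ, if_neg he]
      exact Runs.branch (fun h => by omega) fun _ =>
        (Runs.skip (Q := fun s'' => P _ (s''.write Reg.clause 0 (clauseIndex e + 1)))
          (hP _ s' _ hPj)).mono_steps (Nat.le_add_left 1 k)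
  · rwa [filter_true_of_mem fun e _ => clauseIndex_lt e] at hs'

end RAM

namespace RAM

open Finset Matrix

/-! ## Traces of matrix powers -/

/-- The variable with the exponent of the traces. -/
@[simp] abbrev Reg.exponent : ℕ := 7

/-- The loop counter for the diagonal entries of a matrix. -/
@[simp] abbrev Reg.row : ℕ := 8

/-- The loop counter for the entries of a vector. -/
@[simp] abbrev Reg.entry : ℕ := 9

/-- The loop counter for repeated operations. -/
@[simp] abbrev Reg.count : ℕ := 10

/-- The array with the current vector. -/
@[simp] abbrev Reg.vector : ℕ := 12

/-- The array which collects the image of the current vector. -/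
@[simp] abbrev Reg.image : ℕ := 13

/-- The variable which collects the traces. -/
@[simp] abbrev Reg.trace : ℕ := 14

variable {n : ℕ} {I : SignedHypergraph 3 n} {s : State}

/-- Add the contribution of the current clause to the image of the vector. -/
def formStep (f : SignForm) : Prog :=
  .seq
    (.store Reg.image (vertexExpr f.fst) (.add (.get Reg.image (vertexExpr f.fst))
      (.mul (signProdExpr f.signs) (.get Reg.vector (vertexExpr f.snd)))))
    (.store Reg.image (vertexExpr f.snd) (.add (.get Reg.image (vertexExpr f.snd))
      (.mul (signProdExpr f.signs) (.get Reg.vector (vertexExpr f.fst)))))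

theorem writes_formStep (f : SignForm) : (formStep f).writes = {Reg.image} := rfl

theorem runs_formStep (f : SignForm) (hs : Ready n I s) {e : Clause 3 n}
    (he : s Reg.clause 0 = clauseIndex e) {x y : Fin n → ℤ} (hx : s Reg.vector = vecArray x)
    (hy : s Reg.image = vecArray y) :
    Runs (formStep f) s 3 fun s' => s' Reg.vector = vecArray x ∧
      s' Reg.image = vecArray (y + f.sign e • (f.edge ℤ e *ᵥ x)) := by
  refine Runs.seq (Runs.store (Runs.store ⟨?_, ?_⟩))
  · rw [State.write_of_ne (by decide), State.write_of_ne (by decide), hx]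
  have hs' (i z : ℤ) : Ready n I (s.write Reg.image i z) := hs.write (by decide) i z
  have hother {a : ℕ} (ha : a ≠ Reg.image) (i z : ℤ) : s.write Reg.image i z a = s a :=
    State.write_of_ne ha s i z
  have he' (i z : ℤ) : s.write Reg.image i z Reg.clause 0 = clauseIndex e := by
    rw [hother (by decide), he]
  simp only [Expr.val, (hs' _ _).val_vertexExpr (he' _ _), hs.val_vertexExpr he,
    (hs' _ _).val_signProdExpr (he' _ _), hs.val_signProdExpr he, State.write_self,
    hother (show Reg.vector ≠ Reg.image by decide), hx, hy, update_vecArray_add]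
  rw [vecArray_apply, vecArray_apply, f.edge_mulVec, smul_add, add_assoc]
  simp only [← Pi.single_smul, smul_eq_mul]

/-- Add the image of the current vector under the matrix of the form to the image array. -/
def imageProg (f : SignForm) : Prog := (formStep f).forClauses

theorem writes_imageProg (f : SignForm) : (imageProg f).writes = {Reg.clause, Reg.image} :=
  Prog.writes_forClauses _

theorem runs_imageProg (f : SignForm) (hs : Ready n I s) {x : Fin n → ℤ}
    (hx : s Reg.vector = vecArray x) (hy : s Reg.image = vecArray (0 : Fin n → ℤ)) :
    Runs (imageProg f) s (8 * n ^ 3 * 7 + 3) fun s' =>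
      s' Reg.vector = vecArray x ∧ s' Reg.image = vecArray (f.matrix I *ᵥ x) := by
  have hwrite {a : ℕ} (ha : a ≠ Reg.clause) (s : State) (z : ℤ) : s.write Reg.clause 0 z a = s a :=
    State.write_of_ne ha s 0 z
  have hvector := hwrite (show Reg.vector ≠ Reg.clause by decide)
  have himage := hwrite (show Reg.image ≠ Reg.clause by decide)
  refine Runs.forClauses (k := 2) hs
    (fun J s' => s' Reg.vector = vecArray x ∧ s' Reg.image = vecArray (f.matrix J *ᵥ x))
    (by rw [writes_formStep]; decide) (by rw [writes_formStep]; decide) ?_ ?_ ?_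
  · rw [hvector, himage, hx, hy, SignForm.matrix, sum_empty, zero_mulVec]
    exact ⟨rfl, rfl⟩
  · intro J s' z h
    rwa [hvector, himage]
  · rintro J e he s' hs' hj ⟨hx', hy'⟩
    refine (runs_formStep f hs' hj hx' hy').imp fun s'' _ h => ?_
    rw [hvector, himage, SignForm.matrix, sum_insert he, add_comm, add_mulVec, smul_mulVec]
    exact h

/-- Make the collected image the current vector and clear the image array. -/
def moveImageProg : Prog :=
  .for Reg.entry Reg.numVars (.seq (.store Reg.vector (.var Reg.entry)
    (.get Reg.image (.var Reg.entry))) (.store Reg.image (.var Reg.entry) (.const 0)))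

theorem writes_moveImageProg :
    moveImageProg.writes = {Reg.entry, Reg.vector, Reg.image} := Prog.writes_for _ _ _

theorem runs_moveImageProg (hn : s Reg.numVars 0 = n) {x y : Fin n → ℤ}
    (hx : s Reg.vector = vecArray x) (hy : s Reg.image = vecArray y) :
    Runs moveImageProg s (n * 6 + 3) fun s' =>
      s' Reg.vector = vecArray y ∧ s' Reg.image = vecArray (0 : Fin n → ℤ) := by
  refine (Runs.for (k := 3) (fun j s' => s' Reg.vector = vecArray (blend j y x) ∧
    s' Reg.image = vecArray (blend j 0 y)) hn (by decide) (by decide) (by decide) ?_ ?_).imp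
    fun s' _ h => ?_
  · rw [State.write_of_ne (by decide), State.write_of_ne (by decide), blend_zero, blend_zero]
    exact ⟨hx, hy⟩
  · rintro j hj s' - hj' ⟨hx', hy'⟩
    have hupdate := update_vecArray_blend 0 y hj
    rw [Pi.zero_apply] at hupdate
    refine Runs.seq (Runs.store (Runs.store ?_))
    simp [State.write_of_ne, State.write_self, Expr.val, Expr.val_var, hj', hx', hy',
      vecArray_blend_apply _ _ hj, update_vecArray_blend y x hj, hupdate]
  · rwa [blend_self, blend_self] at h

/-- Replace the vector by its image under the matrix of the form. -/
def mulVecProg (f : SignForm) : Prog := .seq (imageProg f) moveImageProg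

theorem writes_mulVecProg (f : SignForm) : (mulVecProg f).writes =
    {Reg.clause, Reg.entry, Reg.vector, Reg.image} := by
  rw [mulVecProg, Prog.writes, writes_imageProg, writes_moveImageProg]
  decide

theorem runs_mulVecProg (f : SignForm) (hs : Ready n I s) {x : Fin n → ℤ}
    (hx : s Reg.vector = vecArray x) (hy : s Reg.image = vecArray (0 : Fin n → ℤ)) :
    Runs (mulVecProg f) s (56 * n ^ 3 + 6 * n + 7) fun s' =>
      s' Reg.vector = vecArray (f.matrix I *ᵥ x) ∧ s' Reg.image = vecArray (0 : Fin n → ℤ) := by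
  refine (Runs.seq ((runs_imageProg f hs hx hy).imp fun s₁ hfr h =>
    runs_moveImageProg ?_ h.1 h.2)).mono_steps (by omega)
  rw [hfr Reg.numVars (by rw [writes_imageProg]; decide), hs.numVars]

/-- Replace the vector by the unit vector with the index stored in the row counter. -/
def unitVectorProg : Prog :=
  .seq (.for Reg.entry Reg.numVars (.store Reg.vector (.var Reg.entry) (.const 0)))
    (.store Reg.vector (.var Reg.row) (.const 1))

theorem runs_unitVectorProg (hn : s Reg.numVars 0 = n) {x : Fin n → ℤ}
    (hx : s Reg.vector = vecArray x) (i : Fin n) (hi : s Reg.row 0 = (i : ℕ)) :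
    Runs unitVectorProg s (n * 4 + 5) fun s' => s' Reg.vector = vecArray (Pi.single i 1) := by
  refine Runs.seq (k₁ := n * 4 + 3) (k₂ := 1) ((Runs.for (v := Reg.entry) (b := Reg.numVars)
    (c := .store Reg.vector (.var Reg.entry) (.const 0)) (k := 1)
    (fun j s' => s' Reg.vector = vecArray (blend j 0 x)) hn
    (by decide) (by decide) (by decide) ?_ ?_).imp fun s' hfr hx' => Runs.store ?_)
  · rw [State.write_of_ne (by decide), blend_zero, hx]
  · intro j hj s' _ hj' hx'
    refine Runs.store ?_
    rw [State.write_of_ne (by decide), State.write_self, Expr.val_var, hj', hx',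
      ← update_vecArray_blend 0 x hj]
    rfl
  · rw [State.write_self, Expr.val_var, hfr Reg.row (by decide), hi, hx', blend_self,
      update_vecArray]
    rfl

/-- Multiply the vector by the power of the matrix of the form. -/
def powerProg (f : SignForm) : Prog := .for Reg.count Reg.exponent (mulVecProg f)

theorem writes_powerProg (f : SignForm) : (powerProg f).writes =
    {Reg.count, Reg.clause, Reg.entry, Reg.vector, Reg.image} := by
  rw [powerProg, Prog.writes_for, writes_mulVecProg]

theorem runs_powerProg (f : SignForm) (hs : Ready n I s) {E : ℕ} (hE : s Reg.exponent 0 = E)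
    {x : Fin n → ℤ} (hx : s Reg.vector = vecArray x)
    (hy : s Reg.image = vecArray (0 : Fin n → ℤ)) :
    Runs (powerProg f) s (E * (56 * n ^ 3 + 6 * n + 10) + 3) fun s' =>
      s' Reg.vector = vecArray (f.matrix I ^ E *ᵥ x) ∧
        s' Reg.image = vecArray (0 : Fin n → ℤ) := by
  refine Runs.for (fun k s' => s' Reg.vector = vecArray (f.matrix I ^ k *ᵥ x) ∧
    s' Reg.image = vecArray (0 : Fin n → ℤ)) hE (by decide) (by rw [writes_mulVecProg]; decide)
    (by rw [writes_mulVecProg]; decide) ?_ ?_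
  · rw [State.write_of_ne (by decide), State.write_of_ne (by decide), pow_zero, one_mulVec]
    exact ⟨hx, hy⟩
  · rintro k - s' hfr - ⟨hx', hy'⟩
    have hs' : Ready n I s' := hs.congr_of_disjoint (W := (powerProg f).writes)
      (by rw [writes_powerProg]; decide) hfr
    refine (runs_mulVecProg f hs' hx' hy').imp fun s'' _ h => ?_
    rwa [State.write_of_ne (by decide), State.write_of_ne (by decide), pow_succ', ← mulVec_mulVec]

/-- Add the diagonal entry of the power of the matrix with the index stored in the row counter. -/
def diagProg (f : SignForm) : Prog :=
  .seq unitVectorProg (.seq (powerProg f)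
    (.set Reg.trace (.add (.var Reg.trace) (.get Reg.vector (.var Reg.row)))))

theorem writes_diagProg (f : SignForm) : (diagProg f).writes =
    {Reg.entry, Reg.count, Reg.clause, Reg.vector, Reg.image, Reg.trace} := by
  rw [diagProg, Prog.writes, Prog.writes, writes_powerProg]
  decide

/-- The number of steps of `diagProg` for vectors of length `n` and exponent `E`. -/
def diagSteps (n E : ℕ) : ℕ := n * 4 + E * (56 * n ^ 3 + 6 * n + 10) + 11

theorem runs_diagProg (f : SignForm) (hs : Ready n I s) {E : ℕ} (hE : s Reg.exponent 0 = E)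
    {x : Fin n → ℤ} (hx : s Reg.vector = vecArray x)
    (hy : s Reg.image = vecArray (0 : Fin n → ℤ)) (i : Fin n) (hi : s Reg.row 0 = (i : ℕ)) :
    Runs (diagProg f) s (diagSteps n E) fun s' => (∃ x : Fin n → ℤ, s' Reg.vector = vecArray x) ∧
      s' Reg.image = vecArray (0 : Fin n → ℤ) ∧
      s' Reg.trace 0 = s Reg.trace 0 + (f.matrix I ^ E) i i := by
  refine (Runs.seq ((runs_unitVectorProg hs.numVars hx i hi).imp fun s₁ hfr₁ hx₁ =>
    Runs.seq ((runs_powerProg f (E := E) (hs.congr_of_disjoint (by decide) hfr₁) ?_ hx₁ ?_).imp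
      fun s₂ hfr₂ h₂ => Runs.set ?_))).mono_steps (by rw [diagSteps]; omega)
  · rw [hfr₁ Reg.exponent (by decide), hE]
  · rw [hfr₁ Reg.image (by decide), hy]
  have hrow : s₂ Reg.row = s Reg.row := by
    rw [hfr₂ Reg.row (by rw [writes_powerProg]; decide), hfr₁ Reg.row (by decide)]
  have htrace : s₂ Reg.trace = s Reg.trace := by
    rw [hfr₂ Reg.trace (by rw [writes_powerProg]; decide), hfr₁ Reg.trace (by decide)]
  rw [State.write_of_ne (by decide), State.write_of_ne (by decide), State.write_self,
    Function.update_self, h₂.1, h₂.2]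
  refine ⟨⟨_, rfl⟩, rfl, ?_⟩
  simp only [Expr.val, Expr.val_var, h₂.1, hrow, htrace, hi, vecArray_apply, mulVec_single_one]
  rfl

theorem sum_filter_lt_succ {M : Type*} [AddCommMonoid M] (g : Fin n → M) {j : ℕ} (hj : j < n) :
    ∑ i : Fin n with i.val < j + 1, g i = (∑ i : Fin n with i.val < j, g i) + g ⟨j, hj⟩ := by
  have hinsert : univ.filter (fun i : Fin n => (i : ℕ) < j + 1) =
      insert ⟨j, hj⟩ (univ.filter fun i : Fin n => (i : ℕ) < j) := by
    ext i
    simp only [mem_filter, mem_univ, true_and, mem_insert, Fin.ext_iff]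
    omega
  rw [hinsert, sum_insert (by simp), add_comm]

/-- Add the trace of the power of the matrix of the form. -/
def traceProg (f : SignForm) : Prog := .for Reg.row Reg.numVars (diagProg f)

theorem writes_traceProg (f : SignForm) : (traceProg f).writes = {Reg.row, Reg.entry, Reg.count,
    Reg.clause, Reg.vector, Reg.image, Reg.trace} := by
  rw [traceProg, Prog.writes_for, writes_diagProg]

theorem runs_traceProg (f : SignForm) (hs : Ready n I s) {E : ℕ} (hE : s Reg.exponent 0 = E)
    (hx : ∃ x : Fin n → ℤ, s Reg.vector = vecArray x)
    (hy : s Reg.image = vecArray (0 : Fin n → ℤ)) :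
    Runs (traceProg f) s (n * (diagSteps n E + 3) + 3) fun s' =>
      (∃ x : Fin n → ℤ, s' Reg.vector = vecArray x) ∧ s' Reg.image = vecArray (0 : Fin n → ℤ) ∧
      s' Reg.trace 0 = s Reg.trace 0 + (f.matrix I ^ E).trace := by
  refine (Runs.for (fun j s' => (∃ x : Fin n → ℤ, s' Reg.vector = vecArray x) ∧
    s' Reg.image = vecArray (0 : Fin n → ℤ) ∧
    s' Reg.trace 0 = s Reg.trace 0 + ∑ i : Fin n with i.val < j, (f.matrix I ^ E) i i)
    hs.numVars (by decide) (by rw [writes_diagProg]; decide)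
    (by rw [writes_diagProg]; decide) ?_ ?_).imp fun s' _ h => ?_
  · simpa [State.write_of_ne, hy] using hx
  · rintro j hj s' hfr hj' ⟨⟨x, hx'⟩, hy', htrace⟩
    have hs' : Ready n I s' := hs.congr_of_disjoint (W := (traceProg f).writes)
      (by rw [writes_traceProg]; decide) hfr
    have hE' : s' Reg.exponent 0 = E := by
      rw [hfr Reg.exponent (by rw [← traceProg, writes_traceProg]; decide), hE]
    refine (runs_diagProg f hs' hE' hx' hy' ⟨j, hj⟩ hj').imp fun s'' _ h => ?_
    rw [State.write_of_ne (by decide), State.write_of_ne (by decide),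
      State.write_of_ne (by decide), sum_filter_lt_succ _ hj, ← add_assoc, ← htrace]
    exact h
  · simpa [trace] using h

/-- Add the traces for all forms in the list. -/
def traceSumProg (l : List SignForm) : Prog :=
  l.foldr (fun f c => .seq (traceProg f) c) .skip

theorem writes_traceSumProg_subset (l : List SignForm) : (traceSumProg l).writes ⊆
    {Reg.row, Reg.entry, Reg.count, Reg.clause, Reg.vector, Reg.image, Reg.trace} := by
  induction l with
  | nil => exact empty_subset _
  | cons f l ih => exact union_subset (writes_traceProg f).subset ih

theorem runs_traceSumProg (l : List SignForm) (hs : Ready n I s) {E : ℕ}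
    (hE : s Reg.exponent 0 = E) (hx : ∃ x : Fin n → ℤ, s Reg.vector = vecArray x)
    (hy : s Reg.image = vecArray (0 : Fin n → ℤ)) :
    Runs (traceSumProg l) s (l.length * (n * (diagSteps n E + 3) + 4) + 1) fun s' =>
      s' Reg.trace 0 = s Reg.trace 0 + (l.map fun f => (f.matrix I ^ E).trace).sum := by
  induction l generalizing s with
  | nil => exact (Runs.skip (by simp)).mono_steps (by omega)
  | cons f l ih =>
    refine (Runs.seq ((runs_traceProg f hs hE hx hy).imp fun s' hfr h => ?_)).mono_steps
      (k := n * (diagSteps n E + 3) + 3 + (l.length * (n * (diagSteps n E + 3) + 4) + 1) + 1)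
      (by rw [List.length_cons]; ring_nf; omega)
    rw [writes_traceProg] at hfr
    refine (ih (hs.congr_of_disjoint (by decide) hfr) ?_ h.1 h.2.1).imp fun s'' _ h' => ?_
    · rw [hfr Reg.exponent (by decide), hE]
    · rw [h', h.2.2, List.map_cons, List.sum_cons, add_assoc]

end RAM

namespace RAM

open Finset Matrix

/-! ## The statistics of the instance -/

/-- The variable with the powers of two that are compared with the number of variables. -/
@[simp] abbrev Reg.power : ℕ := 6

/-- The array with the degrees at the last position, multiplied by `n`. -/
@[simp] abbrev Reg.degrees : ℕ := 15

/-- The variable with the number of clauses. -/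
@[simp] abbrev Reg.card : ℕ := 16

/-- The variable with the number of clauses, multiplied by `n`. -/
@[simp] abbrev Reg.cardMul : ℕ := 17

/-- The variable with the total deviation of the degrees. -/
@[simp] abbrev Reg.deviation : ℕ := 18

/-- The variable with the bound on the spectral norms, multiplied by `7 * n ^ 2`. -/
@[simp] abbrev Reg.norm : ℕ := 19

/-- The variable with the powers that are compared with the trace. -/
@[simp] abbrev Reg.normPower : ℕ := 20

variable {n : ℕ} {I : SignedHypergraph 3 n} {s : State}

/-- Compute the numbers in `Ready`: the input list has length `8 * n ^ 3 + 1`. -/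
def setupProg : Prog :=
  .seq (.set Reg.numVars (.get Reg.input (.const 0)))
    (.seq (.set Reg.tableSize (.sub (.var Reg.length) (.const 1)))
      (.seq (.set Reg.cube (.div (.var Reg.tableSize) (.const 8)))
        (.set Reg.square (.div (.var Reg.cube) (.var Reg.numVars)))))

theorem length_encodeInstance (n : ℕ) (I : SignedHypergraph 3 n) :
    (encodeInstance ⟨n, I⟩).length = 8 * n ^ 3 + 1 := by
  simp [encodeInstance]

theorem initial_of_two_le (l : List ℤ) {a : ℕ} (ha : 2 ≤ a) : initial l a = 0 := by
  funext i
  rw [initial, if_neg (by omega), if_neg (by omega)]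
  rfl

theorem initial_table (e : Clause 3 n) :
    initial (encodeInstance ⟨n, I⟩) Reg.input (clauseIndex e + 1) = if e ∈ I then 1 else 0 := by
  have hcell : ((clauseIndex e : ℤ) + 1).toNat = clauseIndex e + 1 := by omega
  rw [initial, if_pos rfl, if_pos (by omega), hcell, encodeInstance, List.getD_cons_succ,
    List.getD_eq_getElem _ _ (by simpa using clauseIndex_lt e), List.getElem_ofFn]
  have hindex : (⟨clauseIndex e, clauseIndex_lt e⟩ : Fin (2 ^ 3 * n ^ 3)) =
      (clauseEquiv n).symm e := rfl
  simp only [hindex, clauseAt_clauseEquiv_symm]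

theorem runs_setupProg (n : ℕ) (I : SignedHypergraph 3 n) :
    Runs setupProg (initial (encodeInstance ⟨n, I⟩)) 7 (Ready n I) := by
  set s := initial (encodeInstance ⟨n, I⟩)
  have hinput : s Reg.input 0 = n := by
    simp [s, initial, encodeInstance]
  have hlength : s Reg.length 0 = (8 * n ^ 3 + 1 : ℕ) := by
    simp [s, initial, ← length_encodeInstance n I]
  have hsquare : (n : ℤ) ^ 3 / n = n ^ 2 := by
    rcases Nat.eq_zero_or_pos n with rfl | hn
    · simp
    · rw [pow_succ, Int.mul_ediv_cancel _ (by omega)]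
  refine Runs.seq (k₂ := 5) (Runs.set (Runs.seq (k₂ := 3) (Runs.set (Runs.seq (Runs.set
    (Runs.set ⟨fun e => ?_, ?_, ?_, ?_, ?_⟩))))))
  · simpa [State.write_of_ne] using initial_table e
  all_goals
    simp [State.write_of_ne, State.write_self, Expr.val, Expr.val_var, hinput, hlength, hsquare]

/-- Compute the exponent of the traces. -/
def exponentProg : Prog :=
  .seq (.set Reg.power (.const 1)) (.seq (.set Reg.exponent (.const 2))
    (.loop (.sub (.var Reg.numVars) (.var Reg.power))
      (.seq (.set Reg.power (.add (.var Reg.power) (.var Reg.power)))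
        (.set Reg.exponent (.add (.var Reg.exponent) (.const 2))))))

theorem runs_exponentProg (hn : s Reg.numVars 0 = n) :
    Runs exponentProg s (n * 4 + 5) fun s' => s' Reg.exponent 0 = traceExponent n := by
  have hclog : Nat.clog 2 n ≤ n := Nat.clog_le_of_le_pow Nat.lt_two_pow_self.le
  refine (Runs.seq (Runs.set (Runs.seq (Runs.set ((Runs.loop (k := 3) (Nat.clog 2 n)
    (fun k s' => s' Reg.numVars 0 = n ∧ s' Reg.power 0 = 2 ^ k ∧
      s' Reg.exponent 0 = 2 * (k + 1)) ?_ ?_ ?_).imp ?_))))).mono_steps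
    (k := 1 + (1 + (Nat.clog 2 n * 4 + 1) + 1) + 1) (by omega)
  · rintro k hk s' ⟨hn', hpower, hexponent⟩
    have hlt : (2 : ℤ) ^ k < n := by
      exact_mod_cast (Nat.lt_clog_iff_pow_lt (by norm_num)).1 hk
    refine ⟨?_, Runs.seq (Runs.set (Runs.set ⟨?_, ?_, ?_⟩))⟩
    · simpa only [Expr.val, Expr.val_var, hn', hpower, sub_pos] using hlt
    · rw [State.write_of_ne (by decide), State.write_of_ne (by decide), hn']
    · rw [State.write_of_ne (by decide), State.write_self, Function.update_self, Expr.val,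
        Expr.val_var, hpower]
      ring
    · rw [State.write_self, Function.update_self, Expr.val, Expr.val_var,
        State.write_of_ne (by decide), hexponent, Expr.val]
      push_cast
      ring
  · rintro s' ⟨hn', hpower, -⟩
    have hle : (n : ℤ) ≤ 2 ^ Nat.clog 2 n := by
      exact_mod_cast Nat.le_pow_clog (by norm_num) n
    simpa only [Expr.val, Expr.val_var, hn', hpower, sub_pos, not_lt] using hle
  · simp [State.write_of_ne, State.write_self, Expr.val, hn]
  · rintro s' - ⟨-, -, hexponent⟩
    rw [hexponent, traceExponent]
    push_cast
    rfl

/-- Count the current clause for its last vertex and in the total. -/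
def degreeStep : Prog :=
  .seq (.store Reg.degrees (vertexExpr 2)
      (.add (.get Reg.degrees (vertexExpr 2)) (.var Reg.numVars)))
    (.seq (.set Reg.card (.add (.var Reg.card) (.const 1)))
      (.set Reg.cardMul (.add (.var Reg.cardMul) (.var Reg.numVars))))

theorem natCast_mul_degree_insert {J : SignedHypergraph 3 n} {e : Clause 3 n} (he : e ∉ J)
    (a : Fin 3) : (fun i => (n : ℤ) * degree (insert e J) a i) =
      (fun i => (n : ℤ) * degree J a i) + Pi.single (e.2 a) (n : ℤ) := by
  funext i
  rw [Pi.add_apply, degree, degree, filter_insert]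
  rcases eq_or_ne (e.2 a) i with rfl | hi
  · rw [if_pos rfl, card_insert_of_notMem (by simp [he]), Pi.single_eq_same]
    push_cast
    ring
  · rw [if_neg hi, Pi.single_eq_of_ne hi.symm, add_zero]

/-- The memory holds the degrees and the number of clauses of `J`. -/
structure HoldsDegrees (n : ℕ) (J : SignedHypergraph 3 n) (s : State) : Prop where
  degrees : s Reg.degrees = vecArray fun i : Fin n => (n : ℤ) * degree J 2 i
  card : s Reg.card 0 = #J
  cardMul : s Reg.cardMul 0 = (#J * n : ℕ)

theorem runs_degreeStep (hs : Ready n I s) {e : Clause 3 n} (he : s Reg.clause 0 = clauseIndex e)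
    {J : SignedHypergraph 3 n} (heJ : e ∉ J) (hJ : HoldsDegrees n J s) :
    Runs degreeStep s 5 (HoldsDegrees n (insert e J)) := by
  refine Runs.seq (k₁ := 1) (k₂ := 3) (Runs.store (Runs.seq (Runs.set (Runs.set ⟨?_, ?_, ?_⟩))))
  · rw [natCast_mul_degree_insert heJ, State.write_of_ne (by decide), State.write_of_ne (by decide),
      State.write_self, ← update_vecArray_add]
    simp only [Expr.val, hs.val_vertexExpr he, hJ.degrees, Expr.val_var, hs.numVars]
  · simp [State.write_of_ne, State.write_self, Expr.val, Expr.val_var, hJ.card, heJ]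
  · simp [State.write_of_ne, State.write_self, Expr.val, Expr.val_var, hJ.cardMul, heJ, hs.numVars,
      add_mul]

/-- Compute the degrees and the number of clauses. -/
def degreeProg : Prog := degreeStep.forClauses

theorem writes_degreeProg :
    degreeProg.writes = {Reg.clause, Reg.degrees, Reg.card, Reg.cardMul} :=
  Prog.writes_forClauses _

theorem runs_degreeProg (hs : Ready n I s) (hdegrees : s Reg.degrees = 0)
    (hcard : s Reg.card = 0) (hcardMul : s Reg.cardMul = 0) :
    Runs degreeProg s (8 * n ^ 3 * 9 + 3) (HoldsDegrees n I) := by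
  have hwrite {J : SignedHypergraph 3 n} {s : State} (h : HoldsDegrees n J s) (z : ℤ) :
      HoldsDegrees n J (s.write Reg.clause 0 z) := by
    constructor <;> rw [State.write_of_ne (by decide)]
    exacts [h.degrees, h.card, h.cardMul]
  refine Runs.forClauses hs (HoldsDegrees n) (by decide) (by decide) (hwrite ⟨?_, ?_, ?_⟩ 0)
    (fun _ _ z h => hwrite h z) fun J e he s' hs' hj h =>
      (runs_degreeStep hs' hj he h).imp fun _ _ h' => hwrite h' _
  · simp only [degree, filter_empty, card_empty, Nat.cast_zero, mul_zero, hdegrees]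
    exact vecArray_zero.symm
  · simp [hcard]
  · simp [hcardMul]

/-- Compute the total deviation of the degrees. -/
def deviationProg : Prog :=
  .for Reg.row Reg.numVars (.branch (.sub (.get Reg.degrees (.var Reg.row)) (.var Reg.card))
    (.set Reg.deviation
      (.add (.var Reg.deviation) (.sub (.get Reg.degrees (.var Reg.row)) (.var Reg.card))))
    (.set Reg.deviation
      (.sub (.var Reg.deviation) (.sub (.get Reg.degrees (.var Reg.row)) (.var Reg.card)))))

theorem runs_deviationProg (hn : s Reg.numVars 0 = n) (hs : HoldsDegrees n I s)
    (hdeviation : s Reg.deviation = 0) :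
    Runs deviationProg s (n * 5 + 3) fun s' => s' Reg.deviation 0 = degreeDeviation I := by
  refine (Runs.for (k := 2) (fun j s' => s' Reg.deviation 0 =
    ∑ i : Fin n with i.val < j, |(n : ℤ) * degree I 2 i - #I|) hn (by decide) (by decide)
    (by decide) ?_ ?_).imp fun s' _ h => ?_
  · simp [State.write_of_ne, hdeviation]
  · intro j hj s' hfr hj' hsum
    have hval : (Expr.sub (.get Reg.degrees (.var Reg.row)) (.var Reg.card)).val s' =
        (n : ℤ) * degree I 2 ⟨j, hj⟩ - #I := by
      simp only [Expr.val, Expr.val_var, hj', hfr Reg.degrees (by decide),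
        hfr Reg.card (by decide), hs.degrees, hs.card]
      rw [vecArray_apply _ ⟨j, hj⟩]
    rw [sum_filter_lt_succ _ hj, ← hsum]
    refine Runs.branch (fun hpos => Runs.set ?_) fun hneg => Runs.set ?_
    all_goals rw [State.write_of_ne (by decide), State.write_self, Function.update_self, Expr.val,
      Expr.val_var, hval]
    · rw [abs_of_pos (hval ▸ hpos)]
    · rw [abs_of_nonpos (not_lt.1 (hval ▸ hneg)), sub_eq_add_neg]
  · rw [h, degreeDeviation, filter_true_of_mem fun i _ => i.isLt]

/-! ## The norm bound and the output -/

/-- Multiply the power for the comparison with the trace by `2 ^ E` for the exponent `E`. -/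
def doublePowerProg : Prog :=
  .for Reg.count Reg.exponent
    (.set Reg.normPower (.add (.var Reg.normPower) (.var Reg.normPower)))

theorem runs_doublePowerProg {E : ℕ} (hE : s Reg.exponent 0 = E) :
    Runs doublePowerProg s (E * 4 + 3) fun s' =>
      s' Reg.normPower 0 = s Reg.normPower 0 * 2 ^ E := by
  refine Runs.for (k := 1) (fun r s' => s' Reg.normPower 0 = s Reg.normPower 0 * 2 ^ r) hE
    (by decide) (by decide) (by decide) ?_ ?_
  · rw [State.write_of_ne (by decide), pow_zero, mul_one]
  · intro r _ s' _ _ h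
    refine Runs.set ?_
    rw [State.write_of_ne (by decide), State.write_self, Function.update_self, Expr.val,
      Expr.val_var, h]
    ring

/-- Double the norm bound until its power is at least the trace. -/
def normProg : Prog :=
  .seq (.set Reg.norm (.mul (.const 7) (.var Reg.square))) (.seq (.set Reg.normPower (.const 1))
    (.loop (.sub (.var Reg.trace) (.var Reg.normPower))
      (.seq (.set Reg.norm (.add (.var Reg.norm) (.var Reg.norm))) doublePowerProg)))

theorem pow_lt_traceSum_iff (I : SignedHypergraph 3 n) (k : ℕ) :
    ((2 : ℤ) ^ traceExponent n) ^ k < traceSum I ↔ k < normLog I := by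
  rw [normLog, Nat.lt_clog_iff_pow_lt (one_lt_two_pow_traceExponent n), Int.lt_toNat]
  push_cast
  rfl

theorem runs_normProg (hs : Ready n I s) (hE : s Reg.exponent 0 = traceExponent n)
    (htrace : s Reg.trace 0 = traceSum I) :
    Runs normProg s (normLog I * (traceExponent n * 4 + 6) + 5) fun s' =>
      s' Reg.norm 0 = 7 * n ^ 2 * normBound I := by
  have htest {k : ℕ} {s' : State} (h : s' Reg.trace 0 = traceSum I)
      (h' : s' Reg.normPower 0 = (2 ^ traceExponent n) ^ k) :
      0 < (Expr.sub (.var Reg.trace) (.var Reg.normPower)).val s' ↔ k < normLog I := by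
    rw [Expr.val, Expr.val_var, Expr.val_var, h, h', sub_pos, pow_lt_traceSum_iff]
  refine (Runs.seq (Runs.set (Runs.seq (Runs.set ((Runs.loop (k := traceExponent n * 4 + 5)
    (normLog I) (fun k s' => s' Reg.exponent 0 = traceExponent n ∧ s' Reg.trace 0 = traceSum I ∧
      s' Reg.norm 0 = 7 * n ^ 2 * 2 ^ k ∧ s' Reg.normPower 0 = (2 ^ traceExponent n) ^ k)
    ?_ ?_ ?_).imp ?_))))).mono_steps
    (k := 1 + (1 + (normLog I * (traceExponent n * 4 + 6) + 1) + 1) + 1) (by omega)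
  · rintro k hk s' ⟨hE', htrace', hnorm, hpower⟩
    refine ⟨(htest htrace' hpower).2 hk, (Runs.seq (Runs.set ((runs_doublePowerProg ?_).imp
      fun s'' hfr h => ⟨?_, ?_, ?_, ?_⟩))).mono_steps
        (k := 1 + (traceExponent n * 4 + 3) + 1) (by omega)⟩
    · rw [State.write_of_ne (by decide), hE']
    · rw [hfr Reg.exponent (by decide), State.write_of_ne (by decide), hE']
    · rw [hfr Reg.trace (by decide), State.write_of_ne (by decide), htrace']
    · rw [hfr Reg.norm (by decide), State.write_self, Function.update_self, Expr.val, Expr.val_var,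
        hnorm]
      ring
    · rw [h, State.write_of_ne (by decide), hpower, pow_succ]
  · rintro s' ⟨-, htrace', -, hpower⟩
    exact fun h => lt_irrefl _ ((htest htrace' hpower).1 h)
  · simp [State.write_of_ne, State.write_self, Expr.val, Expr.val_var, hE, htrace, hs.square]
  · rintro s' - ⟨-, -, hnorm, -⟩
    rw [hnorm, normBound]
    push_cast
    rfl

/-- Store the numerator and the denominator of the certified bound. -/
def outputProg : Prog :=
  .branch (.var Reg.cardMul)
    (.seq (.set 0 (.add (.add (.mul (.const 2) (.var Reg.deviation)) (.var Reg.norm)) (.const 1)))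
      (.store 0 (.const 1) (.var Reg.cardMul)))
    (.seq (.set 0 (.const 2)) (.store 0 (.const 1) (.const 1)))

theorem runs_outputProg (hcardMul : s Reg.cardMul 0 = (#I * n : ℕ))
    (hdeviation : s Reg.deviation 0 = degreeDeviation I)
    (hnorm : s Reg.norm 0 = 7 * n ^ 2 * normBound I) :
    Runs outputProg s 4 fun s' => biasBound ⟨n, I⟩ = (s' 0 0 : ℚ) / (s' 0 1 : ℚ) := by
  refine Runs.branch (fun hpos => Runs.seq (Runs.set (Runs.store ?_)))
    fun hneg => Runs.seq (Runs.set (Runs.store ?_))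
  · rw [Expr.val_var, hcardMul] at hpos
    rw [biasBound, if_neg (by exact_mod_cast hpos.ne')]
    simp [State.write_of_ne, State.write_self, Expr.val, Expr.val_var, hcardMul, hdeviation, hnorm]
  · rw [Expr.val_var, hcardMul] at hneg
    rw [biasBound, if_pos (Nat.eq_zero_of_not_pos (by exact_mod_cast hneg))]
    simp [State.write_self, Expr.val]

end RAM

namespace RAM

open Finset Matrix

/-! ## The whole algorithm -/

variable {n : ℕ} {I : SignedHypergraph 3 n}

/-- Compute the integers from which the certified bound is assembled. -/
def statisticsProg : Prog :=
  .seq setupProg (.seq exponentProg (.seq (traceSumProg signForms) (.seq degreeProg deviationProg)))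

/-- The memory holds the integers from which the certified bound is assembled. -/
structure HoldsStatistics (n : ℕ) (I : SignedHypergraph 3 n) (s : State) : Prop
    extends Ready n I s where
  exponent : s Reg.exponent 0 = traceExponent n
  trace : s Reg.trace 0 = traceSum I
  cardMul : s Reg.cardMul 0 = (#I * n : ℕ)
  deviation : s Reg.deviation 0 = degreeDeviation I

/-- A bound on the number of steps of `statisticsProg`. -/
def statisticsSteps (n : ℕ) : ℕ :=
  7 * (n * (diagSteps n (2 * n + 2) + 3) + 4) + 72 * n ^ 3 + 9 * n + 23

theorem traceExponent_le (n : ℕ) : traceExponent n ≤ 2 * n + 2 := by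
  have hclog : Nat.clog 2 n ≤ n := Nat.clog_le_of_le_pow Nat.lt_two_pow_self.le
  rw [traceExponent]
  omega

theorem diagSteps_mono (n : ℕ) : Monotone (diagSteps n) := by
  intro E E' hE
  unfold diagSteps
  gcongr

theorem runs_seq_degreeProg_deviationProg {s : State} (hs : Ready n I s)
    (hexponent : s Reg.exponent 0 = traceExponent n) (htrace : s Reg.trace 0 = traceSum I)
    (hzero : ∀ a, Reg.degrees ≤ a → s a = 0) :
    Runs (.seq degreeProg deviationProg) s (72 * n ^ 3 + 3 + (n * 5 + 3) + 1)
      (HoldsStatistics n I) := by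
  refine (Runs.seq ((runs_degreeProg hs (hzero _ le_rfl) (hzero _ (by decide))
    (hzero _ (by decide))).imp fun s₁ hfr₁ h₁ => ?_)).mono_steps
    (k := 8 * n ^ 3 * 9 + 3 + (n * 5 + 3) + 1) (by omega)
  rw [writes_degreeProg] at hfr₁
  have hs₁ : Ready n I s₁ := hs.congr_of_disjoint (by decide) hfr₁
  refine (runs_deviationProg hs₁.numVars h₁ ?_).imp fun s₂ hfr₂ h₂ =>
    ⟨hs₁.congr_of_disjoint (by decide) hfr₂, ?_, ?_, ?_, h₂⟩
  · rw [hfr₁ _ (by decide), hzero _ (by decide)]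
  · rw [hfr₂ _ (by decide), hfr₁ _ (by decide), hexponent]
  · rw [hfr₂ _ (by decide), hfr₁ _ (by decide), htrace]
  · rw [hfr₂ _ (by decide), h₁.cardMul]

theorem runs_statisticsProg (n : ℕ) (I : SignedHypergraph 3 n) :
    Runs statisticsProg (initial (encodeInstance ⟨n, I⟩)) (statisticsSteps n)
      (HoldsStatistics n I) := by
  have hsteps : 7 + (n * 4 + 5 + (7 * (n * (diagSteps n (traceExponent n) + 3) + 4) + 1 +
      (72 * n ^ 3 + 3 + (n * 5 + 3) + 1) + 1) + 1) + 1 ≤ statisticsSteps n := by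
    have hdiag := Nat.mul_le_mul_left n
      (Nat.add_le_add_right (diagSteps_mono n (traceExponent_le n)) 3)
    rw [statisticsSteps]
    omega
  refine (Runs.seq ((runs_setupProg n I).imp fun s₁ hfr₁ hs₁ => Runs.seq
    ((runs_exponentProg hs₁.numVars).imp fun s₂ hfr₂ hexponent => ?_))).mono_steps hsteps
  have hs₂ : Ready n I s₂ := hs₁.congr_of_disjoint (by decide) hfr₂
  have hzero₂ {a : ℕ} (ha : Reg.vector ≤ a) : s₂ a = 0 := by
    have hwrites : exponentProg.writes ∪ setupProg.writes ⊆ range Reg.vector := by decide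
    have hnot : a ∉ exponentProg.writes ∪ setupProg.writes := fun h =>
      (mem_range.1 (hwrites h)).not_ge ha
    rw [mem_union, not_or] at hnot
    rw [hfr₂ a hnot.1, hfr₁ a hnot.2, initial_of_two_le _ (le_trans (by decide) ha)]
  refine Runs.seq ((runs_traceSumProg signForms hs₂ hexponent
    ⟨0, by rw [hzero₂ le_rfl, vecArray_zero]⟩ (by rw [hzero₂ (by decide), vecArray_zero])).imp
    fun s₃ hfr₃ htrace => ?_)
  have hfr₃' (a : ℕ) (ha : a ∉ ({Reg.row, Reg.entry, Reg.count, Reg.clause, Reg.vector,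
      Reg.image, Reg.trace} : Finset ℕ)) : s₃ a = s₂ a :=
    hfr₃ a fun h => ha (writes_traceSumProg_subset _ h)
  refine runs_seq_degreeProg_deviationProg (hs₂.congr_of_disjoint (by decide) hfr₃') ?_ ?_ ?_
  · rw [hfr₃' _ (by decide), hexponent]
  · rw [htrace, hzero₂ (by decide), traceSum, Pi.zero_apply, zero_add]
  · intro a ha
    rw [hfr₃' a (by simp at ha ⊢; omega), hzero₂ (le_trans (by decide) ha)]

/-- Compute the certified bound. -/
def biasProg : Prog := .seq statisticsProg (.seq normProg outputProg)

theorem boundedBy_initial (n : ℕ) (I : SignedHypergraph 3 n) :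
    (initial (encodeInstance ⟨n, I⟩)).BoundedBy (8 * n ^ 3 + 2) := by
  have hn : n ≤ 8 * n ^ 3 + 1 := by nlinarith [Nat.le_self_pow (n := 3) (by norm_num) n]
  have hmem : ∀ z ∈ encodeInstance ⟨n, I⟩, z.natAbs ≤ 8 * n ^ 3 + 1 := by
    intro z hz
    simp only [encodeInstance, List.mem_cons, List.mem_ofFn] at hz
    rcases hz with rfl | ⟨j, rfl⟩
    · simpa using hn
    · split_ifs <;> simp
  refine fun a i => (bitCost_le_natAbs_add_one _).trans (Nat.add_le_add_right ?_ 1)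
  rw [initial, length_encodeInstance]
  split_ifs
  · rcases lt_or_ge i.toNat (encodeInstance ⟨n, I⟩).length with hlt | hge
    · rw [List.getD_eq_getElem _ _ hlt]
      exact hmem _ (List.getElem_mem hlt)
    · rw [List.getD_eq_default _ _ hge]
      exact Nat.zero_le _
  · exact Nat.zero_le _
  · exact (Int.natAbs_natCast _).le
  · exact Nat.zero_le _

theorem tame_traceSumProg (l : List SignForm) : (traceSumProg l).ForallExpr Expr.Tame := by
  have hadd (f : SignForm) (v w : Fin 3) : ((Expr.get Reg.image (vertexExpr v)).add
      ((signProdExpr f.signs).mul (.get Reg.vector (vertexExpr w)))).Tame :=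
    (Expr.Tame.get (tame_vertexExpr _) _).add <| .mul_of_natAbs_le (tame_signProdExpr _)
      (.get (tame_vertexExpr _) _) 1 (natAbs_signProdExpr_le _)
  induction l with
  | nil => trivial
  | cons f l ih =>
    refine ⟨?_, ih⟩
    simp [hadd f, traceProg, diagProg, unitVectorProg, powerProg, mulVecProg, imageProg,
      moveImageProg, formStep, Prog.forClauses, Prog.for, Prog.set, Prog.ForallExpr, Expr.Tame.get,
      Expr.Tame.add, Expr.Tame.sub, tame_vertexExpr, Expr.tame_var, Expr.tame_const]

theorem tame_biasProg : biasProg.ForallExpr Expr.Tame := by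
  have hnumerator : (((Expr.const 2).mul (.var Reg.deviation)).add (.var Reg.norm)).Tame :=
    ((Expr.tame_var _).const_mul 2).add (Expr.tame_var _)
  simp [hnumerator, biasProg, statisticsProg, setupProg, exponentProg, tame_traceSumProg,
    degreeProg, degreeStep, deviationProg, normProg, doublePowerProg, outputProg, Prog.forClauses,
    Prog.for, Prog.set, Prog.ForallExpr, Expr.Tame.get, Expr.Tame.add, Expr.Tame.sub,
    Expr.Tame.div, Expr.Tame.const_mul, tame_vertexExpr, Expr.tame_var, Expr.tame_const]

/-- A bound on the number of steps of `biasProg` if no step increases the bit lengths in the memory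
by more than `C`. -/
def biasSteps (C n : ℕ) : ℕ :=
  statisticsSteps n +
    ((8 * n ^ 3 + 2 + statisticsSteps n * C) * ((2 * n + 2) * 4 + 6) + 5 + 4 + 1) + 1

theorem normLog_le_bitCost (I : SignedHypergraph 3 n) : normLog I ≤ bitCost (traceSum I) := by
  refine Nat.clog_le_of_le_pow ?_
  rw [← pow_mul]
  have hexponent : 1 ≤ traceExponent n := by rw [traceExponent]; omega
  calc (traceSum I).toNat ≤ (traceSum I).natAbs := by omega
    _ ≤ 2 ^ (traceSum I).natAbs.size := (Nat.lt_size_self _).le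
    _ ≤ 2 ^ (traceExponent n * bitCost (traceSum I)) :=
      Nat.pow_le_pow_right two_pos ((Nat.le_succ _).trans (Nat.le_mul_of_pos_left _ hexponent))

theorem runs_biasProg {C : ℕ} (hC : 1 ≤ C) (hbias : biasProg.ForallExpr (Expr.TameWith C)) (n : ℕ)
    (I : SignedHypergraph 3 n) :
    Runs biasProg (initial (encodeInstance ⟨n, I⟩)) (biasSteps C n) fun s =>
      biasBound ⟨n, I⟩ = (s 0 0 : ℚ) / (s 0 1 : ℚ) := by
  obtain ⟨t, ht, s, hsteps, hs⟩ := runs_statisticsProg n I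
  have hlog : normLog I ≤ 8 * n ^ 3 + 2 + statisticsSteps n * C := by
    have hbounded := (hsteps.exists_exec hC hbias.1 (boundedBy_initial n I) le_rfl).1 Reg.trace 0
    rw [hs.trace] at hbounded
    exact (normLog_le_bitCost I).trans (hbounded.trans (by gcongr))
  obtain ⟨t', ht', s', hsteps', hout⟩ :=
    Runs.seq ((runs_normProg hs.toReady hs.exponent hs.trace).imp fun s' hfr hnorm =>
      runs_outputProg (by rw [hfr _ (by decide), hs.cardMul])
        (by rw [hfr _ (by decide), hs.deviation]) hnorm)
  have hmul := Nat.mul_le_mul hlog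
    (Nat.add_le_add_right (Nat.mul_le_mul_right 4 (traceExponent_le n)) 6)
  refine ⟨t + t' + 1, ?_, s', .seq hsteps hsteps', hout⟩
  rw [biasSteps]
  omega

@[fun_prop]
theorem polyBounded_biasSteps (C : ℕ) : PolyBounded (biasSteps C) := by
  unfold biasSteps statisticsSteps diagSteps
  fun_prop

theorem length_le_inputSize (l : List ℤ) : l.length ≤ inputSize l := by
  rw [inputSize, ← List.length_map (f := bitCost)]
  exact List.length_le_sum_of_one_le _ fun _ h => by
    obtain ⟨z, -, rfl⟩ := List.mem_map.1 h
    exact one_le_bitCost z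

theorem le_inputSize_encodeInstance (n : ℕ) (I : SignedHypergraph 3 n) :
    n ≤ inputSize (encodeInstance ⟨n, I⟩) := by
  refine le_trans ?_ (length_le_inputSize _)
  rw [length_encodeInstance]
  nlinarith [Nat.le_self_pow (n := 3) (by norm_num) n]

theorem polyTimeComputable_biasBound : PolyTimeComputable encodeInstance biasBound := by
  obtain ⟨C, hC, hbias⟩ := tame_biasProg.exists_tameWith
  obtain ⟨P, hP⟩ : PolyBounded fun n =>
      biasSteps C n * (3 * (C * (8 * n ^ 3 + 2 + biasSteps C n * C))) := by fun_prop
  refine ⟨biasProg, P, fun ⟨n, I⟩ => ?_⟩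
  obtain ⟨k, hk, s, hsteps, hout⟩ := runs_biasProg hC hbias n I
  obtain ⟨-, t, ht, hexec⟩ := hsteps.exists_exec hC hbias (boundedBy_initial n I) le_rfl
  refine ⟨t, s, hexec, ?_, hout⟩
  calc t ≤ k * (3 * (C * (8 * n ^ 3 + 2 + k * C))) := ht
    _ ≤ biasSteps C n * (3 * (C * (8 * n ^ 3 + 2 + biasSteps C n * C))) := by gcongr
    _ ≤ P.eval n := hP n
    _ ≤ P.eval (inputSize (encodeInstance ⟨n, I⟩)) :=
      eval_monotone P (le_inputSize_encodeInstance n I)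

end RAM

theorem mainTheorem6 :
    ∃ A : (Σ n : ℕ, SignedHypergraph 3 n) → ℚ,
      RAM.PolyTimeComputable encodeInstance A ∧
      (∀ (n : ℕ) (I : SignedHypergraph 3 n) (ρ : ℝ), (A ⟨n, I⟩ : ℝ) ≤ ρ →
        ¬ ∃ x : Fin n → ℤˣ, IsBiased ρ x ∧ IsSatisfying I (ρ / 32) x) ∧
      (∀ (δ : ℝ), 0 < δ → δ ≤ 2 → ∀ ρ : ℕ → ℝ,
        Tendsto (fun n : ℕ => ρ n / √(Real.log n / (n : ℝ) ^ δ)) atTop atTop →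
        Tendsto (fun n : ℕ => instanceProb 3 n ((n : ℝ) ^ (1 + δ))
          (fun I => (A ⟨n, I⟩ : ℝ) ≤ ρ n)) atTop (𝓝 1)) :=
  ⟨biasBound, RAM.polyTimeComputable_biasBound,
    fun _ I ρ hρ => not_exists_isBiased_and_isSatisfying I ρ hρ,
    fun _ hδ0 hδ2 _ hρ => tendsto_instanceProb_biasBound_le hδ0 hδ2 hρ⟩
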